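/- **Setting.** Let $\mu$ be a $\sigma$-finite measure on a measurable space $\mathcal X$, let $\Omega\subset\mathbb R^p$ be open, and let $\{f_\theta:\theta\in\Omega\}$ be an identifiable family of probability densities with respect to $\mu$, jointly measurable in $(\theta,x)$, whose support $\chi=\{x: f_\theta(x)>0\}$ does not depend on $\theta$. Let $B_1,B_2$ be strictly convex on $[0,\infty)$ and four times continuously differentiable on $(0,\infty)$, and put $$D_B(g,f)=\int [B(g)-B(f)-(g-f)B'(f)]\,d\mu .$$ Let $m:\mathbb R^p\to\mathbb R^r$, $r<p$, be continuously differentiable on $\Omega$, and let $M(\theta)=\big(\partial m_l/\partial\theta_j\big)_{j,l}$ (a $p\times r$ matrix) have rank $r$ at every $\theta\in\Omega$ with $m(\theta)=0$. Let $X_1,X_2,\dots$ be i.i.d. with density $g=f_{\theta_0}$, where $\theta_0\in\Omega$ satisfies the null hypothesis $m(\theta_0)=0$. Write $u_\theta=\nabla_\theta\log f_\theta$ and $$V_\theta(x)=\int[f_\theta B_1'(f_\theta)-B_1(f_\theta)]\,d\mu-B_1'(f_\theta(x)).$$ **Conditions.** There is an open set $\omega\subset\Omega$ containing $\theta_0$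 such that: 1. for almost all $x\in\chi$, $\theta\mapsto f_\theta(x)$ is three times continuously differentiable on $\omega$; 2. $\int[f_\theta B_1'(f_\theta)-B_1(f_\theta)]\,d\mu$ and $\int B_1'(f_\theta)\,g\,d\mu$ exist and can be differentiated three times with respect to $\theta\in\omega$, with the derivatives taken under the integral sign; 3. the matrix $J_{B_1}(\theta)=\big(E_g[\partial_k\partial_l V_\theta(X)]\big)_{k,l}$ is positive definite at $\theta=\theta_0$; 4. there are functions $M_{jkl}$ with $E_g[M_{jkl}(X)]<\infty$ such that, for almost all $x\in\chi$, $|\partial_j\partial_k\partial_l V_\theta(x)|\le M_{jkl}(x)$ for all $\theta\in\omega$; 5. $E_g\big\|u_{\theta_0}(X)B_1''(f_{\theta_0}(X))f_{\theta_0}(X)\big\|^2<\infty$; 6. the second partial derivatives of the components of $m$ exist and are bounded on $\omega$; 7. for all $a,b\in\omega$, $D_{B_2}(f_a,f_b)$ exists and can be differentiated twice with respect to $a$, with the derivatives taken under the integral sign, and its matrix of second derivatives with respect to $a$ is continuous in $(a,b)$ at $(\theta_0,\theta_0)$. **Matrices.** All matrices are evaluated at $\theta_0$: $K_{B_1}$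 is the covariance matrix of $u_{\theta_0}(X)B_1''(f_{\theta_0}(X))f_{\theta_0}(X)$ under $g$, $$A_{B_2}=\Big(\int B_2''(f_{\theta_0})\,\frac{\partial f_{\theta_0}}{\partial\theta_i}\frac{\partial f_{\theta_0}}{\partial\theta_j}\,d\mu\Big)_{i,j},\qquad B_{B_1}=J_{B_1}^{-1}M\,[M^TJ_{B_1}^{-1}M]^{-1}M^TJ_{B_1}^{-1}.$$ **Estimators.** The unrestricted minimum Bregman divergence estimator $\hat\theta_{B_1}$ is a consistent sequence of roots of $$\Psi_n(\theta):=\int u_\theta B_1''(f_\theta)f_\theta^2\,d\mu-\frac1n\sum_{i=1}^n u_\theta(X_i)B_1''(f_\theta(X_i))f_\theta(X_i)=0,$$ and the restricted one $\tilde\theta_{B_1}$ is a consistent sequence of roots of the system $\Psi_n(\theta)+M(\theta)\eta=0$ for some $\eta\in\mathbb R^r$, $m(\theta)=0$. Here a consistent sequence of roots is a sequence of measurable $\Omega$-valued functions of $(X_1,\dots,X_n)$ that solve the equations with probability tending to one and converge to $\theta_0$ in probability. **Theorem.** Such sequences $\hat\theta_{B_1}$ and $\tilde\theta_{B_1}$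 exist. Let $$k=\operatorname{rank}\big(B_{B_1}K_{B_1}B_{B_1}A_{B_2}B_{B_1}K_{B_1}B_{B_1}\big).$$ The matrix $A_{B_2}B_{B_1}K_{B_1}B_{B_1}$ has exactly $k$ nonzero eigenvalues $\lambda_1,\dots,\lambda_k$, counted with multiplicity, all of them real; and for all such $\hat\theta_{B_1}$ and $\tilde\theta_{B_1}$ the Bregman divergence test statistic satisfies $$T=2n\,D_{B_2}\big(f_{\hat\theta_{B_1}},f_{\tilde\theta_{B_1}}\big)\ \longrightarrow\ \sum_{i=1}^k\lambda_iZ_i^2\quad\text{in distribution as } n\to\infty,$$ where $Z_1,\dots,Z_k$ are independent standard normal variables. -/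

import Mathlib

open MeasureTheory ProbabilityTheory Filter Topology

/-- Euclidean parameter space `ℝ^p`. -/
abbrev Param (p : ℕ) : Type := EuclideanSpace ℝ (Fin p)

/-- The `j`-th coordinate vector of `ℝ^p`. -/
noncomputable def coordVec {p : ℕ} (j : Fin p) : Param p := EuclideanSpace.single j (1 : ℝ)

/-- Partial derivative of a real function on `ℝ^p` in the `j`-th coordinate. -/
noncomputable def partialD {p : ℕ} (j : Fin p) (F : Param p → ℝ) (θ : Param p) : ℝ :=
  fderiv ℝ F θ (coordVec j)

section Model

variable {p : ℕ} {X : Type*} [MeasurableSpace X]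

/-- The law with density `f θ` with respect to `μ`. -/
noncomputable def modelLaw (μ : Measure X) (f : Param p → X → ℝ) (θ : Param p) : Measure X :=
  μ.withDensity (fun x => ENNReal.ofReal (f θ x))

/-- An identifiable parametric family of `μ`-densities on the open parameter space `Ω`,
with a support that does not depend on the parameter. -/
structure IsDensityFamily (μ : Measure X) (Ω : Set (Param p)) (f : Param p → X → ℝ) : Prop where
  isOpen : IsOpen Ω
  measurable : Measurable (fun q : Ω × X => f (q.1 : Param p) q.2)
  nonneg : ∀ θ ∈ Ω, ∀ x, 0 ≤ f θ x
  isProbabilityMeasure : ∀ θ ∈ Ω, IsProbabilityMeasure (modelLaw μ f θ)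
  identifiable : Set.InjOn (modelLaw μ f) Ω
  commonSupport : ∀ θ ∈ Ω, ∀ θ' ∈ Ω, ∀ x, 0 < f θ x ↔ 0 < f θ' x

/-- A function `B` that generates a Bregman divergence between densities. -/
structure IsBregmanGenerator (B : ℝ → ℝ) : Prop where
  strictConvexOn : StrictConvexOn ℝ (Set.Ici 0) B
  contDiffOn : ContDiffOn ℝ 4 B (Set.Ioi 0)

/-- The integrand of the Bregman divergence. -/
noncomputable def bregmanIntegrand (B : ℝ → ℝ) (g f : X → ℝ) (x : X) : ℝ :=
  B (g x) - B (f x) - (g x - f x) * deriv B (f x)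

/-- The Bregman divergence `D_B(g, f)` between two densities. -/
noncomputable def bregmanDiv (μ : Measure X) (B : ℝ → ℝ) (g f : X → ℝ) : ℝ :=
  ∫ x, bregmanIntegrand B g f x ∂μ

/-- The likelihood score `u_θ(x)`, coordinatewise. -/
noncomputable def score (f : Param p → X → ℝ) (θ : Param p) (x : X) (j : Fin p) : ℝ :=
  partialD j (fun t => Real.log (f t x)) θ

/-- The weighted score `u_θ(x) B''(f_θ(x)) f_θ(x)`, coordinatewise. -/
noncomputable def weightedScore (B : ℝ → ℝ) (f : Param p → X → ℝ) (θ : Param p) (x : X)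
    (j : Fin p) : ℝ :=
  score f θ x j * deriv (deriv B) (f θ x) * f θ x

/-- `V_θ(x) = ∫ [f_θ B'(f_θ) - B(f_θ)] dμ - B'(f_θ(x))`. -/
noncomputable def objective (μ : Measure X) (B : ℝ → ℝ) (f : Param p → X → ℝ) (θ : Param p)
    (x : X) : ℝ :=
  (∫ y, (f θ y * deriv B (f θ y) - B (f θ y)) ∂μ) - deriv B (f θ x)

/-- The integral `∫ F(θ, x) dμ(x)` exists and can be differentiated `N` times with respect to
`θ ∈ ω`, and the derivatives can be taken under the integral sign. -/
def DiffUnderIntegral {Y : Type*} [MeasurableSpace Y] (μ : Measure Y) (ω : Set (Param p)) (N : ℕ)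
    (F : Param p → Y → ℝ) : Prop :=
  (∀ k ≤ N, ∀ θ ∈ ω, Integrable (fun x => iteratedFDeriv ℝ k (fun t => F t x) θ) μ) ∧
  ∀ k < N, ∀ θ ∈ ω,
    HasFDerivAt (fun t => ∫ x, iteratedFDeriv ℝ k (fun t' => F t' x) t ∂μ)
      (∫ x, fderiv ℝ (iteratedFDeriv ℝ k (fun t' => F t' x)) θ ∂μ) θ

/-- The matrix `J(θ)`, with entries `E_G[∂_k ∂_l V_θ]`. -/
noncomputable def matJ (μ : Measure X) (B : ℝ → ℝ) (f : Param p → X → ℝ) (G : Measure X)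
    (θ : Param p) : Matrix (Fin p) (Fin p) ℝ :=
  Matrix.of fun k l =>
    ∫ x, iteratedFDeriv ℝ 2 (fun t => objective μ B f t x) θ ![coordVec k, coordVec l] ∂G

/-- The matrix `K(θ)`, the covariance matrix of the weighted score under `G`. -/
noncomputable def matK (B : ℝ → ℝ) (f : Param p → X → ℝ) (G : Measure X)
    (θ : Param p) : Matrix (Fin p) (Fin p) ℝ :=
  Matrix.of fun k l =>
    (∫ x, weightedScore B f θ x k * weightedScore B f θ x l ∂G) -
      (∫ x, weightedScore B f θ x k ∂G) * ∫ x, weightedScore B f θ x l ∂G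

/-- The matrix `A_B(θ)`, with entries `∫ B''(f_θ) ∂_i f_θ ∂_j f_θ dμ`. -/
noncomputable def matA (μ : Measure X) (B : ℝ → ℝ) (f : Param p → X → ℝ)
    (θ : Param p) : Matrix (Fin p) (Fin p) ℝ :=
  Matrix.of fun i j =>
    ∫ x, deriv (deriv B) (f θ x) * partialD i (fun t => f t x) θ * partialD j (fun t => f t x) θ ∂μ

/-- The `p × r` matrix `M(θ)`, with entries `∂ m_l / ∂ θ_j`. -/
noncomputable def matM {r : ℕ} (m : Param p → EuclideanSpace ℝ (Fin r))
    (θ : Param p) : Matrix (Fin p) (Fin r) ℝ :=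
  Matrix.of fun j l => partialD j (fun t => m t l) θ

/-- The matrix `J⁻¹ M [Mᵀ J⁻¹ M]⁻¹ Mᵀ J⁻¹` at `θ`. -/
noncomputable def matB {r : ℕ} (μ : Measure X) (B : ℝ → ℝ) (f : Param p → X → ℝ) (G : Measure X)
    (m : Param p → EuclideanSpace ℝ (Fin r)) (θ : Param p) : Matrix (Fin p) (Fin p) ℝ :=
  (matJ μ B f G θ)⁻¹ * matM m θ * ((matM m θ).transpose * (matJ μ B f G θ)⁻¹ * matM m θ)⁻¹ *
    (matM m θ).transpose * (matJ μ B f G θ)⁻¹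

/-- A system of `r` restrictions `m(θ) = 0`: the matrix `M(θ)` exists and is continuous on `Ω`
and has rank `r` at the parameters that satisfy the restrictions. -/
structure IsRestriction {r : ℕ} (Ω : Set (Param p)) (m : Param p → EuclideanSpace ℝ (Fin r)) :
    Prop where
  contDiffOn : ContDiffOn ℝ 1 m Ω
  rank_eq : ∀ θ ∈ Ω, m θ = 0 → (matM m θ).rank = r

/-- The regularity conditions on the model, on an open neighbourhood `ω` of the true parameter
`θ₀`, for the generating function `B` that is used for estimation. -/
structure EstimationRegularity (μ : Measure X) (B : ℝ → ℝ) (f : Param p → X → ℝ)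
    (ω : Set (Param p)) (θ₀ : Param p) : Prop where
  /-- the densities are three times continuously differentiable in the parameter -/
  smooth : ∀ᵐ x ∂μ, 0 < f θ₀ x → ContDiffOn ℝ 3 (fun θ => f θ x) ω
  /-- differentiation under the integral sign, first integral -/
  diff_model : DiffUnderIntegral μ ω 3 (fun θ x => f θ x * deriv B (f θ x) - B (f θ x))
  /-- differentiation under the integral sign, second integral -/
  diff_cross : DiffUnderIntegral μ ω 3 (fun θ x => deriv B (f θ x) * f θ₀ x)
  /-- positive definiteness of `J` -/
  posDef : (matJ μ B f (modelLaw μ f θ₀) θ₀).PosDef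
  /-- integrable bound on the third derivatives of `V` -/
  third_bound : ∃ M : Fin p → Fin p → Fin p → X → ℝ,
    (∀ j k l, Integrable (M j k l) (modelLaw μ f θ₀)) ∧
    ∀ᵐ x ∂(modelLaw μ f θ₀), ∀ θ ∈ ω, ∀ j k l,
      |iteratedFDeriv ℝ 3 (fun t => objective μ B f t x) θ ![coordVec j, coordVec k, coordVec l]|
        ≤ M j k l x
  /-- the covariance matrix `K` of the weighted score exists -/
  memLp_score : ∀ j, MemLp (fun x => weightedScore B f θ₀ x j) 2 (modelLaw μ f θ₀)

/-- The second partial derivatives of the restrictions exist and are bounded on `ω`. -/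
def BoundedSecondPartials {r : ℕ} (ω : Set (Param p)) (m : Param p → EuclideanSpace ℝ (Fin r)) :
    Prop :=
  ∃ C : ℝ, ∀ θ ∈ ω, ∀ (j k : Fin p) (l : Fin r),
    LineDifferentiableAt ℝ (fun t => matM m t j l) θ (coordVec k) ∧
    |lineDeriv ℝ (fun t => matM m t j l) θ (coordVec k)| ≤ C

/-- The divergence `D_B(f_a, f_b)` of the test statistic exists for `a, b ∈ ω` and can be
differentiated twice with respect to `a` under the integral sign, and its second derivative is
continuous in `(a, b)` at `(θ₀, θ₀)`. -/
structure DivergenceRegularity (μ : Measure X) (B : ℝ → ℝ) (f : Param p → X → ℝ)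
    (ω : Set (Param p)) (θ₀ : Param p) : Prop where
  diff : ∀ b ∈ ω, DiffUnderIntegral μ ω 2 (fun a x => bregmanIntegrand B (f a) (f b) x)
  continuousAt : ContinuousAt
    (fun q : Param p × Param p =>
      iteratedFDeriv ℝ 2 (fun a => bregmanDiv μ B (f a) (f q.2)) q.1) (θ₀, θ₀)

/-- The empirical estimating function of the sample `x`: the gradient of
`∫ [f_θ B'(f_θ) - B(f_θ)] dμ - n⁻¹ ∑ B'(f_θ(x_i))`, written through the score as
`∫ u_θ B''(f_θ) f_θ² dμ - n⁻¹ ∑ u_θ(x_i) B''(f_θ(x_i)) f_θ(x_i)`. -/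
noncomputable def estimatingFun (μ : Measure X) (B : ℝ → ℝ) (f : Param p → X → ℝ) {n : ℕ}
    (x : Fin n → X) (θ : Param p) (j : Fin p) : ℝ :=
  (∫ y, weightedScore B f θ y j * f θ y ∂μ) - (n : ℝ)⁻¹ * ∑ i, weightedScore B f θ (x i) j

/-- `θ` solves the unrestricted minimum Bregman divergence estimating equation. -/
def IsRoot (μ : Measure X) (B : ℝ → ℝ) (f : Param p → X → ℝ) {n : ℕ} (x : Fin n → X)
    (θ : Param p) : Prop :=
  estimatingFun μ B f x θ = 0

/-- `θ` solves, with a Lagrange multiplier `η`, the restricted minimum Bregman divergence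
estimating equation under the restrictions `m(θ) = 0`. -/
def IsRestrictedRoot {r : ℕ} (μ : Measure X) (B : ℝ → ℝ) (f : Param p → X → ℝ)
    (m : Param p → EuclideanSpace ℝ (Fin r)) {n : ℕ} (x : Fin n → X) (θ : Param p) : Prop :=
  m θ = 0 ∧ ∃ η : Fin r → ℝ, estimatingFun μ B f x θ + (matM m θ).mulVec η = 0

/-- `est n`, a measurable `Ω`-valued function of the first `n` observations, is a consistent
sequence of roots of the estimating equations `IsSol n`: it solves them with probability tending to
one and converges to `θ₀` in probability. -/
structure IsConsistentRootSeq {S : Type*} [MeasurableSpace S] (P : Measure S) (obs : ℕ → S → X)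
    (Ω : Set (Param p)) (θ₀ : Param p) (IsSol : (n : ℕ) → (Fin n → X) → Param p → Prop)
    (est : (n : ℕ) → (Fin n → X) → Param p) : Prop where
  measurable : ∀ n, Measurable (est n)
  mem : ∀ n x, est n x ∈ Ω
  root : Tendsto (fun n => P {s | ¬ IsSol n (fun i => obs i s) (est n fun i => obs i s)}) atTop (𝓝 0)
  consistent : TendstoInMeasure P (fun n s => est n fun i => obs i s) atTop (fun _ => θ₀)

/-- The Bregman divergence test statistic `2 n D_B(f_{θ₁}, f_{θ₂})` of the sample `x`. -/
noncomputable def testStat (μ : Measure X) (B : ℝ → ℝ) (f : Param p → X → ℝ)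
    (est₁ est₂ : (n : ℕ) → (Fin n → X) → Param p) (n : ℕ) (x : Fin n → X) : ℝ :=
  2 * n * bregmanDiv μ B (f (est₁ n x)) (f (est₂ n x))

end Model

/-- `lam` lists the nonzero (complex) eigenvalues of `N`, with algebraic multiplicity. -/
def ListsNonzeroEigenvalues {p k : ℕ} (N : Matrix (Fin p) (Fin p) ℝ) (lam : Fin k → ℝ) : Prop :=
  (N.map Complex.ofReal).charpoly.roots.filter (fun z => z ≠ 0) =
    Finset.univ.val.map (fun i => (lam i : ℂ))

/-! Let `y` be the mean of the centred scores at `θ₀`; its covariance per observation is `K`. Near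
`θ₀` the estimating function is, with probability tending to one, uniformly close to its
linearisation with slope `J`: the second derivatives obey the law of large numbers and the third
ones have an integrable bound (`likely_linApprox`). Hence every consistent root of the Lagrange
system satisfies `θ - θ₀ = -(W⁻¹(y, 0)).1 + o(‖y‖)`, where `W` is the saddle matrix built from `J`
and `M` (`lagrange_root_expansion`). The unrestricted estimator is the case without restrictions.
Subtracting the two expansions and eliminating the multiplier gives `θ̂ - θ̃ = -B y + o(‖y‖)`
(`mulVec_eq_sub_of_saddle`).

The divergence vanishes together with its gradient on the diagonal, and its Hessian in the first
argument is close to `A` near `(θ₀, θ₀)`. So twice the divergence is `(a - b)ᵀ A (a - b) + o(‖a -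
b‖²)` (`bregmanDiv_expansion`), and `T` equals the quadratic form `(B v)ᵀ A (B v)` at `v = √n y`, up
to `o(‖v‖²)`. The central limit theorem, tightness of `v` and Slutsky's lemma give the limit `(B Y)ᵀ
A (B Y)` with `Y ~ N(0, K)`. With `K = T²` this is a form in standard normals with the symmetric
matrix `T B A B T`. It has the characteristic polynomial of `A B K B` and rank `k`; rotating to an
eigenbasis yields the weighted squares (`exists_eigenvalues_quadraticForm`).

Existence comes from a simplified Newton iteration started at `(θ₀, 0)`. It contracts with
probability tending to one, and its iterates are measurable in the sample, hence so is their limit.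
-/

/-! ### Events with probability tending to one -/

section Likely

variable {S : Type*} [MeasurableSpace S] {P : Measure S}

/-- The events `A n` have probability tending to one. -/
def Likely (P : Measure S) (A : ℕ → S → Prop) : Prop :=
  Tendsto (fun n => P {s | ¬ A n s}) atTop (𝓝 0)

/-- The weak form of the implication matters: the estimating function agrees with a sample mean only
almost surely and only for nonempty samples. -/
theorem Likely.mono_ae {A B : ℕ → S → Prop} (hA : Likely P A)
    (h : ∀ᶠ n in atTop, ∀ᵐ s ∂P, A n s → B n s) : Likely P B := by
  refine tendsto_of_tendsto_of_tendsto_of_le_of_le' tendsto_const_nhds hA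
    (Eventually.of_forall fun n => zero_le) ?_
  filter_upwards [h] with n hn
  refine measure_mono_ae ?_
  filter_upwards [hn] with s hs hB hA'
  exact hB (hs hA')

theorem Likely.mono {A B : ℕ → S → Prop} (hA : Likely P A) (h : ∀ n s, A n s → B n s) :
    Likely P B :=
  hA.mono_ae (Eventually.of_forall fun n => Eventually.of_forall fun s => h n s)

theorem Likely.and {A B : ℕ → S → Prop} (hA : Likely P A) (hB : Likely P B) :
    Likely P (fun n s => A n s ∧ B n s) := by
  have h : Tendsto (fun n => P {s | ¬ A n s} + P {s | ¬ B n s}) atTop (𝓝 (0 + 0)) := hA.add hB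
  rw [add_zero] at h
  refine tendsto_of_tendsto_of_tendsto_of_le_of_le tendsto_const_nhds h
    (fun n => zero_le) fun n => ?_
  refine (measure_mono fun s hs => ?_).trans (measure_union_le _ _)
  by_contra hc
  simp only [Set.mem_union, Set.mem_ofPred_eq, not_or, not_not] at hc hs
  exact hs hc

theorem tendstoInMeasure_iff_likely {F : Type*} [PseudoMetricSpace F] {Y : ℕ → S → F} {c : F} :
    TendstoInMeasure P Y atTop (fun _ => c) ↔
      ∀ ε : ℝ, 0 < ε → Likely P (fun n s => dist (Y n s) c < ε) := by
  rw [tendstoInMeasure_iff_dist]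
  simp only [Likely, not_lt]

/-- If `R n` is, with probability tending to one, below every fixed multiple of `‖Y n‖ ^ 2`, and
`Y n` converges in distribution, then `R n` tends to zero in probability. -/
theorem tendstoInMeasure_zero_of_likely_le [IsProbabilityMeasure P]
    {E : Type*} [NormedAddCommGroup E] [InnerProductSpace ℝ E] [FiniteDimensional ℝ E]
    [MeasurableSpace E] [BorelSpace E] {S' : Type*} [MeasurableSpace S'] {P' : Measure S'}
    [IsProbabilityMeasure P'] {Y : ℕ → S → E} {Z : S' → E}
    (hY : TendstoInDistribution Y atTop Z (fun _ => P) P') {R : ℕ → S → ℝ}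
    (hR : ∀ c : ℝ, 0 < c → Likely P (fun n s => |R n s| ≤ c * ‖Y n s‖ ^ 2)) :
    TendstoInMeasure P R atTop 0 := by
  change TendstoInMeasure P R atTop (fun _ => 0)
  rw [tendstoInMeasure_iff_likely]
  intro ε hε
  have hm := hY.forall_aemeasurable
  have hZ := hY.aemeasurable_limit
  have hprob : ∀ n, IsProbabilityMeasure (P.map (Y n)) :=
    fun n => Measure.isProbabilityMeasure_map (hm n)
  have : IsProbabilityMeasure (P'.map Z) := Measure.isProbabilityMeasure_map hZ
  -- Tightness follows from the convergence of characteristic functions, because their limit is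
  -- continuous at `0`.
  have htight : IsTightMeasureSet (Set.range fun n => P.map (Y n)) :=
    isTightMeasureSet_of_tendsto_charFun (f := charFun (P'.map Z))
      (continuous_charFun.continuousAt)
      (fun t => ProbabilityMeasure.tendsto_iff_tendsto_charFun.1 hY.tendsto t)
  have ht := tendsto_measure_norm_gt_of_isTightMeasureSet htight
  rw [Likely, ENNReal.tendsto_nhds_zero]
  intro η hη
  have hη2 : (0 : ENNReal) < η / 2 := ENNReal.half_pos hη.ne'
  obtain ⟨C, hCη, hC⟩ := (((ENNReal.tendsto_nhds_zero.1 ht) (η / 2) hη2).and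
    (eventually_gt_atTop 0)).exists
  -- With this multiple the bound on `|R n|` is at most `ε / 2` wherever `‖Y n‖ ≤ C`.
  have hc : 0 < ε / (2 * C ^ 2) := by positivity
  filter_upwards [(ENNReal.tendsto_nhds_zero.1 (hR _ hc)) (η / 2) hη2] with n hn
  have h1 : P {s | C < ‖Y n s‖} ≤ η / 2 := by
    have h2 : P {s | C < ‖Y n s‖} = (P.map (Y n)) {x | C < ‖x‖} := by
      rw [Measure.map_apply_of_aemeasurable (hm n) (measurableSet_lt measurable_const measurable_norm)]
      rfl
    rw [h2]
    refine le_trans ?_ hCη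
    exact le_iSup₂_of_le (P.map (Y n)) ⟨n, rfl⟩ le_rfl
  calc P {s | ¬ dist (R n s) 0 < ε}
      ≤ P ({s | ¬ |R n s| ≤ ε / (2 * C ^ 2) * ‖Y n s‖ ^ 2} ∪ {s | C < ‖Y n s‖}) := by
        refine measure_mono fun s hs => ?_
        by_contra hcon
        simp only [Set.mem_union, Set.mem_ofPred_eq, not_or, not_not, not_lt] at hcon hs
        rw [dist_zero_right, Real.norm_eq_abs] at hs
        have h3 : ‖Y n s‖ ^ 2 ≤ C ^ 2 := by gcongr; exact hcon.2
        have h4 : ε / (2 * C ^ 2) * ‖Y n s‖ ^ 2 ≤ ε / (2 * C ^ 2) * C ^ 2 := by gcongr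
        have h5 : ε / (2 * C ^ 2) * C ^ 2 = ε / 2 := by field_simp
        linarith [hcon.1]
    _ ≤ _ := measure_union_le _ _
    _ ≤ η / 2 + η / 2 := add_le_add hn h1
    _ = η := ENNReal.add_halves η

end Likely

/-! ### Law of large numbers and multivariate central limit theorem -/

section IID

/-- The mean of the values of `g` on a sample. -/
noncomputable def sampleMean {X F : Type*} [AddCommGroup F] [Module ℝ F] {n : ℕ} (x : Fin n → X)
    (g : X → F) : F :=
  (n : ℝ)⁻¹ • ∑ i, g (x i)

variable {S : Type*} [MeasurableSpace S] {P : Measure S}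
  {X : Type*} [MeasurableSpace X] {G : Measure X} {obs : ℕ → S → X}

theorem identDistrib_comp (hobs : ∀ i, Measurable (obs i)) (hlaw : ∀ i, P.map (obs i) = G)
    {F : Type*} [MeasurableSpace F] {g : X → F} (hg : AEMeasurable g G) (i : ℕ) :
    IdentDistrib (fun s => g (obs i s)) (fun s => g (obs 0 s)) P P := by
  refine IdentDistrib.comp_of_aemeasurable (u := g)
    ⟨(hobs i).aemeasurable, (hobs 0).aemeasurable, ?_⟩ ?_
  · rw [hlaw, hlaw]
  · rwa [hlaw]

variable [IsProbabilityMeasure P]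

/-- The weak law of large numbers for the sample mean. -/
theorem likely_sampleMean (hobs : ∀ i, Measurable (obs i)) (hindep : iIndepFun obs P)
    (hlaw : ∀ i, P.map (obs i) = G) {F : Type*} [NormedAddCommGroup F] [NormedSpace ℝ F]
    [CompleteSpace F] {g : X → F} (hg : Integrable g G) {ε : ℝ} (hε : 0 < ε) :
    Likely P (fun n s => ‖sampleMean (fun i : Fin n => obs i s) g - ∫ x, g x ∂G‖ < ε) := by
  borelize F
  have hgi : ∀ i, Integrable (fun s => g (obs i s)) P := fun i => by
    have := hg
    rw [← hlaw i] at this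
    exact this.comp_measurable (hobs i)
  have hslln := strong_law_ae (fun i s => g (obs i s)) (hgi 0)
    (fun i j hij => by
      have := hindep.indepFun hij
      refine this.comp₀ (hobs i).aemeasurable (hobs j).aemeasurable ?_ ?_
      · rw [hlaw]; exact hg.aestronglyMeasurable.aemeasurable
      · rw [hlaw]; exact hg.aestronglyMeasurable.aemeasurable)
    (fun i => identDistrib_comp hobs hlaw hg.aestronglyMeasurable.aemeasurable i)
  have h0 : ∫ s, g (obs 0 s) ∂P = ∫ x, g x ∂G := by
    rw [← hlaw 0, integral_map (hobs 0).aemeasurable (by rw [hlaw]; exact hg.aestronglyMeasurable)]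
  rw [h0] at hslln
  have hmeas := tendstoInMeasure_of_tendsto_ae (f := fun (n : ℕ) s =>
    (n : ℝ)⁻¹ • ∑ i ∈ Finset.range n, g (obs i s)) (μ := P) (fun n => by
      refine AEStronglyMeasurable.const_smul ?_ _
      exact Finset.aestronglyMeasurable_fun_sum _ fun i _ => (hgi i).aestronglyMeasurable) hslln
  refine (tendstoInMeasure_iff_likely.1 hmeas ε hε).mono fun n s hs => ?_
  rwa [sampleMean, Fin.sum_univ_eq_sum_range (fun i => g (obs i s)), ← dist_eq_norm]

theorem dotProduct_secondMoment_mulVec {ι : Type*} [Fintype ι] {g : X → ι → ℝ}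
    (hg : ∀ i, MemLp (fun x => g x i) 2 G) {K : Matrix ι ι ℝ}
    (hK : ∀ i j, K i j = ∫ x, g x i * g x j ∂G) (t : ι → ℝ) :
    t ⬝ᵥ K.mulVec t = ∫ x, (∑ i, t i * g x i) ^ 2 ∂G := by
  have hint : ∀ i j, Integrable (fun x => g x i * g x j) G := fun i j => (hg i).integrable_mul (hg j)
  have : ∀ x, (∑ i, t i * g x i) ^ 2 = ∑ i, ∑ j, t i * t j * (g x i * g x j) := by
    intro x
    rw [sq, Finset.sum_mul_sum]
    exact Finset.sum_congr rfl fun i _ => Finset.sum_congr rfl fun j _ => by ring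
  simp_rw [this]
  rw [integral_finsetSum _ fun i _ => integrable_finsetSum _ fun j _ => (hint i j).const_mul _]
  simp_rw [dotProduct, Matrix.mulVec, dotProduct, Finset.mul_sum]
  refine Finset.sum_congr rfl fun i _ => ?_
  rw [integral_finsetSum _ fun j _ => (hint i j).const_mul _]
  refine Finset.sum_congr rfl fun j _ => ?_
  rw [integral_const_mul, hK]
  ring

theorem posSemidef_of_secondMoment {ι : Type*} [Fintype ι] {g : X → ι → ℝ}
    (hg : ∀ i, MemLp (fun x => g x i) 2 G) {K : Matrix ι ι ℝ}
    (hK : ∀ i j, K i j = ∫ x, g x i * g x j ∂G) : K.PosSemidef := by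
  refine Matrix.PosSemidef.of_dotProduct_mulVec_nonneg ?_ fun t => ?_
  · ext i j
    simp only [Matrix.conjTranspose_apply, star_trivial, hK]
    simp_rw [mul_comm]
  · rw [star_trivial, dotProduct_secondMoment_mulVec hg hK]
    exact integral_nonneg fun x => sq_nonneg _

/-- The multivariate central limit theorem. -/
theorem tendstoInDistribution_sqrt_smul_sampleMean (hobs : ∀ i, Measurable (obs i))
    (hindep : iIndepFun obs P) (hlaw : ∀ i, P.map (obs i) = G) {ι : Type*} [Fintype ι]
    [DecidableEq ι] {g : X → EuclideanSpace ℝ ι} (hgm : Measurable g)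
    (hg : ∀ i, MemLp (fun x => g x i) 2 G) (hmean : ∀ i, ∫ x, g x i ∂G = 0) {K : Matrix ι ι ℝ}
    (hK : ∀ i j, K i j = ∫ x, g x i * g x j ∂G) :
    TendstoInDistribution
      (fun (n : ℕ) s => √(n : ℝ) • sampleMean (fun i : Fin n => obs i s) g) atTop
      (id : EuclideanSpace ℝ ι → EuclideanSpace ℝ ι) (fun _ => P) (multivariateGaussian 0 K) := by
  have hKpsd : K.PosSemidef := posSemidef_of_secondMoment (g := fun x i => g x i) hg hK
  have hGp : IsProbabilityMeasure G := by
    rw [← hlaw 0]; exact Measure.isProbabilityMeasure_map (hobs 0).aemeasurable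
  have hm : ∀ n : ℕ, Measurable
      (fun s => √(n : ℝ) • sampleMean (fun i : Fin n => obs i s) g) := fun n => by
    unfold sampleMean
    have : ∀ i : ℕ, Measurable fun s => g (obs i s) := fun i => hgm.comp (hobs i)
    fun_prop
  refine ⟨fun n => (hm n).aemeasurable, aemeasurable_id, ?_⟩
  refine ProbabilityMeasure.tendsto_iff_tendsto_charFun.2 fun t => ?_
  simp only [ProbabilityMeasure.coe_mk, Measure.map_id]
  rw [charFun_multivariateGaussian hKpsd]
  have hinner : ∀ x, inner ℝ (g x) t = ∑ i, t i * g x i := fun x => by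
    rw [PiLp.inner_apply]; simp
  have hhm : Measurable fun x => inner ℝ (g x) t := by fun_prop
  have hL2 : MemLp (fun x => inner ℝ (g x) t) 2 G := by
    simp_rw [hinner]
    exact memLp_finsetSum _ fun i _ => (hg i).const_mul _
  have hL2' : MemLp (fun s => inner ℝ (g (obs 0 s)) t) 2 P := by
    have := hL2
    rw [← hlaw 0] at this
    exact this.comp_measurePreserving ⟨hobs 0, rfl⟩
  have hmean0 : ∫ s, inner ℝ (g (obs 0 s)) t ∂P = 0 := by
    rw [← integral_map (f := fun x => inner ℝ (g x) t) (hobs 0).aemeasurable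
      hhm.aestronglyMeasurable, hlaw]
    simp_rw [hinner]
    rw [integral_finsetSum _ fun i _ => ((hg i).integrable (by norm_num)).const_mul _]
    simp [integral_const_mul, hmean]
  have hvar : Var[fun s => inner ℝ (g (obs 0 s)) t; P] = t ⬝ᵥ K.mulVec t := by
    have hcm : Measurable fun s => inner ℝ (g (obs 0 s)) t := hhm.comp (hobs 0)
    rw [variance_eq_integral hcm.aemeasurable]
    simp only [hmean0, sub_zero]
    rw [← integral_map (f := fun x => (inner ℝ (g x) t) ^ 2) (hobs 0).aemeasurable
      (hhm.pow_const 2).aestronglyMeasurable, hlaw,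
      dotProduct_secondMoment_mulVec (g := fun x i => g x i) hg hK]
    simp_rw [hinner]
  -- Cramér–Wold: the characteristic function of the vector at `t` is that of its projection on `t`
  -- at `1`, so the one-dimensional theorem for the projections suffices.
  have hclt := tendstoInDistribution_inv_sqrt_mul_sum_sub
    (P' := gaussianReal 0 Var[fun s => inner ℝ (g (obs 0 s)) t; P].toNNReal) (Y := id)
    (P := P) (X := fun i s => inner ℝ (g (obs i s)) t) ⟨by fun_prop, by simp⟩ hL2'
    (hindep.comp (fun _ x => inner ℝ (g x) t) fun _ => hhm)
    (fun i => identDistrib_comp hobs hlaw hhm.aemeasurable i)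
  have h1 := ProbabilityMeasure.tendsto_iff_tendsto_charFun.1 hclt.tendsto 1
  simp only [ProbabilityMeasure.coe_mk, Measure.map_id, charFun_gaussianReal] at h1
  convert h1 using 2
  · rename_i n
    rw [charFun_apply, charFun_apply_real, integral_map (hm n).aemeasurable (by fun_prop),
      integral_map (hclt.forall_aemeasurable n) (by fun_prop)]
    congr 1
    funext s
    congr 2
    simp only [hmean0, mul_zero, sub_zero, Complex.ofReal_one, one_mul]
    congr 1
    rw [sampleMean, smul_smul, real_inner_smul_left, sum_inner,
      Fin.sum_univ_eq_sum_range (fun i => inner ℝ (g (obs i s)) t)]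
    congr 1
    rcases Nat.eq_zero_or_pos n with rfl | hn
    · simp
    · have : (0 : ℝ) < √(n : ℝ) := Real.sqrt_pos.2 (by exact_mod_cast hn)
      have h2 : (n : ℝ) = √(n : ℝ) * √(n : ℝ) := (Real.mul_self_sqrt (by positivity)).symm
      nth_rewrite 2 [h2]
      field_simp
  · have h0 : 0 ≤ t ⬝ᵥ K.mulVec t := by
      rw [← hvar]; exact variance_nonneg _ _
    simp [hvar, Real.coe_toNNReal _ h0]

end IID

/-! ### Quadratic forms in normal vectors -/

section QuadraticForm

theorem mulVec_dotProduct_eq {m n : Type*} [Fintype m] [Fintype n] (A : Matrix m n ℝ) (v : n → ℝ)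
    (w : m → ℝ) : A.mulVec v ⬝ᵥ w = v ⬝ᵥ A.transpose.mulVec w := by
  rw [Matrix.dotProduct_mulVec, Matrix.vecMul_transpose]

/-- Over the reals `Rᵀ R` and `R` have the same kernel, so a left factor `Rᵀ` in front of `R` does
not enlarge the kernel. -/
theorem rank_transpose_mul_mul {n : Type*} [Fintype n] [DecidableEq n] (R N : Matrix n n ℝ) :
    (R.transpose * (R * N)).rank = (R * N).rank := by
  have hker : (R.transpose * (R * N)).mulVecLin.ker = (R * N).mulVecLin.ker := by
    ext v
    simp only [LinearMap.mem_ker, Matrix.mulVecLin_apply]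
    have h := Matrix.ker_mulVecLin_transpose_mul_self R
    rw [SetLike.ext_iff] at h
    have h' := h (N.mulVec v)
    simp only [LinearMap.mem_ker, Matrix.mulVecLin_apply, Matrix.mulVec_mulVec,
      Matrix.mul_assoc] at h'
    exact h'
  have h1 := (R.transpose * (R * N)).mulVecLin.finrank_range_add_finrank_ker
  have h2 := (R * N).mulVecLin.finrank_range_add_finrank_ker
  rw [hker] at h1
  unfold Matrix.rank
  omega

/-- Serves to discard the normal variables that carry a zero eigenvalue. -/
theorem map_pi_comp_injective {ι κ Y : Type*} [Fintype ι] [Fintype κ] [MeasurableSpace Y]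
    {ν : Measure Y} [IsProbabilityMeasure ν] {e : κ → ι} (he : Function.Injective e) :
    (Measure.pi fun _ : ι => ν).map (fun x k => x (e k)) = Measure.pi fun _ : κ => ν := by
  have h : iIndepFun (fun (i : ι) (x : ι → Y) => x i) (Measure.pi fun _ : ι => ν) :=
    iIndepFun_pi (X := fun _ => id) fun _ => aemeasurable_id
  have h' := h.precomp he
  rw [iIndepFun_iff_map_fun_eq_pi_map fun i => (measurable_pi_apply _).aemeasurable] at h'
  rw [h']
  congr 1
  funext k
  exact (measurePreserving_eval (fun _ : ι => ν) (e k)).map_eq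

/-- A quadratic form in standard normal variables has the law of the sum of the squares weighted
by the eigenvalues. -/
theorem map_quadraticForm_stdGaussian {p : ℕ} {C : Matrix (Fin p) (Fin p) ℝ} (hC : C.IsHermitian) :
    (stdGaussian (EuclideanSpace ℝ (Fin p))).map (fun z => z.ofLp ⬝ᵥ C.mulVec z.ofLp) =
      (Measure.pi fun _ : Fin p => gaussianReal 0 1).map
        (fun z => ∑ i, hC.eigenvalues i * z i ^ 2) := by
  -- Rotation invariance: the coordinates in the eigenbasis are again independent standard normals.
  rw [stdGaussian_eq_map_pi_orthonormalBasis hC.eigenvectorBasis, Measure.map_map]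
  rotate_left
  · simp only [dotProduct, Matrix.mulVec]; fun_prop
  · fun_prop
  congr 1
  funext z
  simp only [Function.comp_apply]
  set v := ∑ i, z i • hC.eigenvectorBasis i with hv
  have hCv : C.mulVec v.ofLp = (∑ i, (hC.eigenvalues i * z i) • hC.eigenvectorBasis i :
      EuclideanSpace ℝ (Fin p)).ofLp := by
    rw [hv, WithLp.ofLp_sum, Matrix.mulVec_sum, WithLp.ofLp_sum]
    refine Finset.sum_congr rfl fun i _ => ?_
    rw [WithLp.ofLp_smul, Matrix.mulVec_smul, hC.mulVec_eigenvectorBasis, WithLp.ofLp_smul,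
      smul_smul, mul_comm]
  have hin : ∀ a b : EuclideanSpace ℝ (Fin p), a.ofLp ⬝ᵥ b.ofLp = inner ℝ a b := fun a b => by
    rw [EuclideanSpace.inner_eq_star_dotProduct, star_trivial, dotProduct_comm]
  rw [hCv, hin, hv]
  rw [hC.eigenvectorBasis.orthonormal.inner_sum]
  refine Finset.sum_congr rfl fun i _ => ?_
  simp only [starRingEnd_apply, star_trivial]
  ring

/-- The nonzero eigenvalues of a symmetric matrix, listed by `Fin` of its rank, and the law of
its quadratic form in standard normal variables. -/
theorem exists_eigenvalues_of_isHermitian {p k : ℕ} {C : Matrix (Fin p) (Fin p) ℝ}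
    (hC : C.IsHermitian) (hk : k = C.rank) : ∃ lam : Fin k → ℝ, ListsNonzeroEigenvalues C lam ∧
      (stdGaussian (EuclideanSpace ℝ (Fin p))).map (fun z => z.ofLp ⬝ᵥ C.mulVec z.ofLp) =
        (Measure.pi fun _ : Fin k => gaussianReal 0 1).map (fun z => ∑ i, lam i * z i ^ 2) := by
  -- The rank of a symmetric matrix counts its nonzero eigenvalues, so any bijection gives a list.
  have hcard : Fintype.card (Fin k) = Fintype.card {i // hC.eigenvalues i ≠ 0} := by
    rw [Fintype.card_fin, hk, hC.rank_eq_card_non_zero_eigs]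
  let e : Fin k ≃ {i // hC.eigenvalues i ≠ 0} := Fintype.equivOfCardEq hcard
  refine ⟨fun j => hC.eigenvalues (e j), ?_, ?_⟩
  · have hroots : (C.map Complex.ofReal).charpoly.roots =
        Finset.univ.val.map (fun i => (hC.eigenvalues i : ℂ)) := by
      have h1 : (C.map Complex.ofReal).charpoly = C.charpoly.map Complex.ofRealHom :=
        Matrix.charpoly_map C Complex.ofRealHom
      rw [h1, hC.charpoly_eq, Polynomial.map_prod]
      have h2 : ∀ i, (Polynomial.X - Polynomial.C ((hC.eigenvalues i : ℝ) : ℝ)).map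
          Complex.ofRealHom = Polynomial.X - Polynomial.C (hC.eigenvalues i : ℂ) := by
        intro i; simp
      have h3 : ∏ i, (Polynomial.X - Polynomial.C ((hC.eigenvalues i : ℝ) : ℝ)).map
          Complex.ofRealHom = ((Finset.univ.val.map fun i => (hC.eigenvalues i : ℂ)).map
            fun a => Polynomial.X - Polynomial.C a).prod := by
        rw [Finset.prod_congr rfl fun i _ => h2 i, Multiset.map_map]
        rfl
      exact (congrArg Polynomial.roots h3).trans (Polynomial.roots_multiset_prod_X_sub_C _)
    rw [ListsNonzeroEigenvalues, hroots, Multiset.filter_map]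
    have huniv : (Finset.univ : Finset (Fin p)).val.filter
        ((fun z : ℂ => z ≠ 0) ∘ fun i => (hC.eigenvalues i : ℂ)) =
        (Finset.univ : Finset (Fin k)).val.map fun j => (e j : Fin p) := by
      have h4 : (Finset.univ.filter fun i => hC.eigenvalues i ≠ 0) =
          (Finset.univ : Finset (Fin k)).map ⟨fun j => (e j : Fin p),
            Subtype.val_injective.comp e.injective⟩ := by
        ext i
        simp only [Finset.mem_filter, Finset.mem_univ, true_and, Finset.mem_map,
          Function.Embedding.coeFn_mk]
        constructor
        · intro hi
          exact ⟨e.symm ⟨i, hi⟩, by simp⟩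
        · rintro ⟨j, rfl⟩
          exact (e j).2
      have h5 := congrArg Finset.val h4
      rw [Finset.filter_val, Finset.map_val] at h5
      rw [← Function.Embedding.coeFn_mk (fun j => (e j : Fin p))
        (Subtype.val_injective.comp e.injective), ← h5]
      refine Multiset.filter_congr fun i _ => ?_
      simp
    rw [huniv, Multiset.map_map]
    rfl
  · rw [map_quadraticForm_stdGaussian hC, ← map_pi_comp_injective (ν := gaussianReal 0 1)
      (e := fun j => (e j : Fin p)) (Subtype.val_injective.comp e.injective), Measure.map_map]
    rotate_left
    · fun_prop
    · fun_prop
    congr 1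
    funext z
    simp only [Function.comp_apply]
    have h6 : ∑ i, hC.eigenvalues i * z i ^ 2 =
        ∑ i ∈ Finset.univ.filter (fun i => hC.eigenvalues i ≠ 0), hC.eigenvalues i * z i ^ 2 := by
      refine (Finset.sum_filter_of_ne (p := fun i => hC.eigenvalues i ≠ 0)
        fun i _ hi h0 => hi ?_).symm
      rw [h0, zero_mul]
    rw [h6, ← Finset.sum_subtype_eq_sum_filter, Finset.subtype_univ]
    exact (Equiv.sum_comp e fun i => hC.eigenvalues i * z i ^ 2).symm

/-- The law of the quadratic form `(By)ᵀ A (By)` of a centered normal vector with covariance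
matrix `K`. -/
theorem exists_eigenvalues_quadraticForm {p : ℕ} {A B K : Matrix (Fin p) (Fin p) ℝ}
    (hA : A.transpose = A) (hB : B.transpose = B) (hK : K.PosSemidef) :
    ∃ lam : Fin (B * K * B * A * B * K * B).rank → ℝ,
      ListsNonzeroEigenvalues (A * B * K * B) lam ∧
      (multivariateGaussian 0 K).map
          (fun y => B.mulVec y.ofLp ⬝ᵥ A.mulVec (B.mulVec y.ofLp)) =
        (Measure.pi fun _ : Fin (B * K * B * A * B * K * B).rank => gaussianReal 0 1).map
          (fun z => ∑ i, lam i * z i ^ 2) := by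
  open scoped MatrixOrder in
  obtain ⟨T, hT, hTT, hTg⟩ : ∃ T : Matrix (Fin p) (Fin p) ℝ, T.transpose = T ∧ T * T = K ∧
      multivariateGaussian 0 K = (stdGaussian (EuclideanSpace ℝ (Fin p))).map
        (fun x => WithLp.toLp 2 (T.mulVec x.ofLp)) := by
    refine ⟨CFC.sqrt K, ?_, CFC.sqrt_mul_sqrt_self K hK.nonneg, ?_⟩
    · have h := (CFC.sqrt_nonneg K).isSelfAdjoint
      rw [IsSelfAdjoint, Matrix.star_eq_conjTranspose, Matrix.conjTranspose_eq_transpose_of_trivial]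
        at h
      exact h
    · rw [multivariateGaussian]
      congr 1
      funext x
      rw [zero_add]
      exact Matrix.toEuclideanCLM_toLp _ _
  -- For `y = T z` one has `B y = Rᵀ z`, so the form becomes `zᵀ C z` with `C = R A Rᵀ` symmetric.
  obtain ⟨R, hR⟩ : ∃ R, R = T * B := ⟨_, rfl⟩
  have hRt : R.transpose = B * T := by rw [hR, Matrix.transpose_mul, hT, hB]
  obtain ⟨C, hCdef⟩ : ∃ C, C = R * A * R.transpose := ⟨_, rfl⟩
  have hC : C.IsHermitian := by
    rw [Matrix.IsHermitian, Matrix.conjTranspose_eq_transpose_of_trivial, hCdef,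
      Matrix.transpose_mul, Matrix.transpose_mul, Matrix.transpose_transpose, hA, Matrix.mul_assoc]
  -- Since `B K B = Rᵀ R`, the matrix is `Rᵀ (R A Rᵀ) R`. The outer `Rᵀ` is stripped without
  -- changing the rank; a transposition brings the outer `R` to the left, and it is stripped
  -- likewise.
  have hrank : (B * K * B * A * B * K * B).rank = C.rank := by
    have h1 : B * K * B * A * B * K * B = R.transpose * (R * (A * R.transpose * R)) := by
      rw [hRt, hR, ← hTT]; simp only [Matrix.mul_assoc]
    have h2 : R * (A * R.transpose * R) =
        (R.transpose * (R * (A * R.transpose))).transpose := by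
      simp only [Matrix.transpose_mul, Matrix.transpose_transpose, hA, Matrix.mul_assoc]
    rw [h1, rank_transpose_mul_mul, h2, Matrix.rank_transpose, rank_transpose_mul_mul, hCdef,
      Matrix.mul_assoc]
  obtain ⟨lam, hlam, hlaw⟩ := exists_eigenvalues_of_isHermitian hC hrank
  refine ⟨lam, ?_, ?_⟩
  · have hchar : ((A * B * K * B).map Complex.ofReal).charpoly =
        (C.map Complex.ofReal).charpoly := by
      have h1 : (A * B * K * B).charpoly = C.charpoly := by
        have : A * B * K * B = (A * B * T) * (T * B) := by
          rw [← hTT]; simp only [Matrix.mul_assoc]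
        rw [this, Matrix.charpoly_mul_comm, hCdef, hRt, hR]
        simp only [Matrix.mul_assoc]
      have h2 := Matrix.charpoly_map (A * B * K * B) Complex.ofRealHom
      have h3 := Matrix.charpoly_map C Complex.ofRealHom
      rw [h1, ← h3] at h2
      exact h2
    rw [ListsNonzeroEigenvalues, hchar]
    exact hlam
  · rw [← hlaw, hTg, Measure.map_map]
    rotate_left
    · simp only [dotProduct, Matrix.mulVec]; fun_prop
    · fun_prop
    congr 1
    funext z
    simp only [Function.comp_apply]
    rw [mulVec_dotProduct_eq, mulVec_dotProduct_eq, hB, hT]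
    simp only [Matrix.mulVec_mulVec]
    rw [hCdef, hRt, hR]
    simp only [Matrix.mul_assoc]

end QuadraticForm

/-! ### Simplified Newton method -/

section Newton

/-- `Ψ` is, on the closed ball of radius `δ`, approximated by the linear map `J` up to the
Lipschitz constant `c`. -/
def LinApprox {E F : Type*} [NormedAddCommGroup E] [NormedSpace ℝ E] [NormedAddCommGroup F]
    [NormedSpace ℝ F] (Ψ : E → F) (J : E →L[ℝ] F) (a : E) (δ c : ℝ) : Prop :=
  ∀ θ ∈ Metric.closedBall a δ, ∀ θ' ∈ Metric.closedBall a δ,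
    ‖Ψ θ - Ψ θ' - J (θ - θ')‖ ≤ c * ‖θ - θ'‖

variable {Z : Type*} [NormedAddCommGroup Z] [NormedSpace ℝ Z]

/-- The simplified Newton step with the fixed derivative `W`. -/
def newtonStep (W : Z ≃L[ℝ] Z) (F : Z → Z) (z : Z) : Z := z - W.symm (F z)

theorem LinApprox.mono {E F : Type*} [NormedAddCommGroup E] [NormedSpace ℝ E]
    [NormedAddCommGroup F] [NormedSpace ℝ F] {Ψ : E → F} {J : E →L[ℝ] F} {a : E} {δ δ' c c' : ℝ}
    (h : LinApprox Ψ J a δ c) (hδ : δ' ≤ δ) (hc : c ≤ c') : LinApprox Ψ J a δ' c' :=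
  fun θ hθ θ' hθ' => (h θ (Metric.closedBall_subset_closedBall hδ hθ) θ'
    (Metric.closedBall_subset_closedBall hδ hθ')).trans (by gcongr)

variable {W : Z ≃L[ℝ] Z} {F : Z → Z} {z₀ : Z} {δ κ c : ℝ}

/-- On the ball of radius `2 κ ‖F z₀‖` the step has Lipschitz constant `κ c ≤ 1 / 2` and moves the
centre by at most half the radius, so it is a contraction of the ball; its fixed point is a root.
The convergence of the iterates is recorded because the measurability of the estimator rests on it.
-/
theorem exists_root_of_linApprox [CompleteSpace Z] (hκ : ∀ y, ‖W.symm y‖ ≤ κ * ‖y‖) (hκ0 : 0 ≤ κ)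
    (hκc : κ * c ≤ 1 / 2) (hF : LinApprox F (W : Z →L[ℝ] Z) z₀ δ c)
    (hδ : 2 * κ * ‖F z₀‖ ≤ δ) :
    ∃ z, F z = 0 ∧ ‖z - z₀‖ ≤ 2 * κ * ‖F z₀‖ ∧
      Tendsto (fun k => (newtonStep W F)^[k] z₀) atTop (𝓝 z) := by
  set ρ := 2 * κ * ‖F z₀‖ with hρ
  have hρ0 : 0 ≤ ρ := by positivity
  have hlip : ∀ z ∈ Metric.closedBall z₀ ρ, ∀ z' ∈ Metric.closedBall z₀ ρ,
      ‖newtonStep W F z - newtonStep W F z'‖ ≤ 1 / 2 * ‖z - z'‖ := by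
    intro z hz z' hz'
    have h1 : newtonStep W F z - newtonStep W F z' =
        -W.symm (F z - F z' - W (z - z')) := by
      simp only [newtonStep, map_sub, ContinuousLinearEquiv.symm_apply_apply]
      abel
    rw [h1, norm_neg]
    calc _ ≤ κ * ‖F z - F z' - W (z - z')‖ := hκ _
      _ ≤ κ * (c * ‖z - z'‖) := by
        gcongr
        exact hF.mono hδ le_rfl z hz z' hz'
      _ = (κ * c) * ‖z - z'‖ := by ring
      _ ≤ _ := by gcongr
  have hz₀ : z₀ ∈ Metric.closedBall z₀ ρ := Metric.mem_closedBall_self hρ0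
  have hmaps : Set.MapsTo (newtonStep W F) (Metric.closedBall z₀ ρ) (Metric.closedBall z₀ ρ) := by
    intro z hz
    have h1 := hlip z hz z₀ hz₀
    have h2 : ‖newtonStep W F z₀ - z₀‖ ≤ κ * ‖F z₀‖ := by
      have : newtonStep W F z₀ - z₀ = -W.symm (F z₀) := by simp [newtonStep]
      rw [this, norm_neg]
      exact hκ _
    rw [mem_closedBall_iff_norm] at hz ⊢
    calc _ = ‖(newtonStep W F z - newtonStep W F z₀) + (newtonStep W F z₀ - z₀)‖ := by
          congr 1; abel
      _ ≤ _ := norm_add_le _ _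
      _ ≤ 1 / 2 * ρ + κ * ‖F z₀‖ := by gcongr; exact h1.trans (by gcongr)
      _ = ρ := by rw [hρ]; ring
  have hcontr : ContractingWith (1 / 2) (hmaps.restrict (newtonStep W F) _ _) := by
    refine ⟨by rw [← NNReal.coe_lt_coe]; norm_num, ?_⟩
    refine LipschitzWith.of_dist_le_mul fun x y => ?_
    have := hlip x x.2 y y.2
    rw [Subtype.dist_eq, Subtype.dist_eq, dist_eq_norm, dist_eq_norm]
    simpa using this
  obtain ⟨z, hz, hfix, hlim, -⟩ := hcontr.exists_fixedPoint' Metric.isClosed_closedBall.isComplete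
    hmaps hz₀ (edist_ne_top _ _)
  refine ⟨z, ?_, mem_closedBall_iff_norm.1 hz, hlim⟩
  have h3 : W.symm (F z) = 0 := by
    have : z - W.symm (F z) = z := hfix
    simpa using this
  simpa using h3

/-- Applying `W⁻¹` to the linearisation error leaves at most `κ c ‖z - z₀‖`, and `κ c ≤ 1 / 2`
bounds `‖z - z₀‖` by `2 κ ‖F z₀‖`. This holds for every root in the ball, not only for the limit of
the iteration, since the theorem admits arbitrary consistent sequences. -/
theorem norm_root_expansion_le (hκ : ∀ y, ‖W.symm y‖ ≤ κ * ‖y‖) (hκ0 : 0 ≤ κ) (hc0 : 0 ≤ c)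
    (hκc : κ * c ≤ 1 / 2) (hF : LinApprox F (W : Z →L[ℝ] Z) z₀ δ c) {z : Z}
    (hz : z ∈ Metric.closedBall z₀ δ) (hz0 : F z = 0) :
    ‖z - z₀ + W.symm (F z₀)‖ ≤ 2 * κ ^ 2 * c * ‖F z₀‖ := by
  have hδ : 0 ≤ δ := dist_nonneg.trans hz
  have h1 := hF z hz z₀ (Metric.mem_closedBall_self hδ)
  have h2 : z - z₀ + W.symm (F z₀) = -W.symm (F z - F z₀ - W (z - z₀)) := by
    rw [hz0]
    simp only [map_sub, ContinuousLinearEquiv.symm_apply_apply, map_zero]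
    abel
  have h3 : ‖z - z₀ + W.symm (F z₀)‖ ≤ κ * (c * ‖z - z₀‖) := by
    rw [h2, norm_neg]
    refine (hκ _).trans ?_
    gcongr
    exact h1
  have h4 : ‖z - z₀‖ ≤ 2 * κ * ‖F z₀‖ := by
    have h5 : ‖z - z₀‖ ≤ ‖z - z₀ + W.symm (F z₀)‖ + ‖W.symm (F z₀)‖ := by
      have := norm_sub_le (z - z₀ + W.symm (F z₀)) (W.symm (F z₀))
      rwa [add_sub_cancel_right] at this
    have h6 : κ * (c * ‖z - z₀‖) ≤ 1 / 2 * ‖z - z₀‖ := by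
      rw [← mul_assoc]; gcongr
    linarith [hκ (F z₀)]
  calc _ ≤ κ * (c * ‖z - z₀‖) := h3
    _ ≤ κ * (c * (2 * κ * ‖F z₀‖)) := by gcongr
    _ = _ := by ring

theorem exists_bound_symm (W : Z ≃L[ℝ] Z) :
    ∃ κ > 0, ∀ y, ‖W.symm y‖ ≤ κ * ‖y‖ :=
  -- The added `1` keeps the constant positive on a trivial space.
  ⟨‖(W.symm : Z →L[ℝ] Z)‖ + 1, by positivity, fun y =>
    (ContinuousLinearMap.le_opNorm (W.symm : Z →L[ℝ] Z) y).trans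
      (by gcongr; linarith)⟩

end Newton

/-! ### Roots of the Lagrange system -/

section Lagrange

variable {E F : Type*} [NormedAddCommGroup E] [InnerProductSpace ℝ E] [FiniteDimensional ℝ E]
  [NormedAddCommGroup F] [InnerProductSpace ℝ F] [FiniteDimensional ℝ F]

/-- The Lagrange system `(Ψ(θ) + M(θ) η, m(θ))`. -/
def lagrangeMap (Ψ : E → E) (M : E → F →L[ℝ] E) (m : E → F) (z : E × F) : E × F :=
  (Ψ z.1 + M z.1 z.2, m z.1)

/-- `W` is the derivative `(a, b) ↦ (J a + M b, Mᵀ a)` of the Lagrange system. -/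
def IsSaddle (W : (E × F) ≃L[ℝ] (E × F)) (J : E →L[ℝ] E) (M : F →L[ℝ] E) : Prop :=
  ∀ a b, W (a, b) = (J a + M b, M.adjoint a)

/-- Pairing `J a + M b = 0` with `a` removes `M b`, because `Mᵀ a = 0`. Positivity of `J` forces `a
= 0`, and then injectivity of `M` forces `b = 0`; in finite dimension this suffices. -/
theorem exists_isSaddle {J : E →L[ℝ] E} {M : F →L[ℝ] E} (hJ : ∀ v, v ≠ 0 → 0 < inner ℝ (J v) v)
    (hM : Function.Injective M) : ∃ W, IsSaddle W J M := by
  let L : (E × F) →ₗ[ℝ] (E × F) :=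
    (((J : E →ₗ[ℝ] E).coprod (M : F →ₗ[ℝ] E))).prod
      ((M.adjoint : E →ₗ[ℝ] F) ∘ₗ LinearMap.fst ℝ E F)
  have hL : Function.Injective L := by
    rw [← LinearMap.ker_eq_bot, LinearMap.ker_eq_bot']
    rintro ⟨a, b⟩ hab
    have h1 : J a + M b = 0 := congrArg Prod.fst hab
    have h2 : M.adjoint a = 0 := congrArg Prod.snd hab
    have ha : a = 0 := by
      by_contra hne
      have h3 := hJ a hne
      have h4 : inner ℝ (J a + M b) a = 0 := by rw [h1, inner_zero_left]
      rw [inner_add_left, ← ContinuousLinearMap.adjoint_inner_right M, h2, inner_zero_right] at h4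
      linarith
    subst ha
    rw [map_zero, zero_add] at h1
    have hb : b = 0 := hM (by rw [h1, map_zero])
    rw [hb]
    rfl
  refine ⟨(LinearEquiv.ofInjectiveEndo L hL).toContinuousLinearEquiv, fun a b => rfl⟩

/-- The data of a restriction near `θ₀`. -/
structure RegularRestriction (M : E → F →L[ℝ] E) (m : E → F) (θ₀ : E) : Prop where
  zero : m θ₀ = 0
  strictDeriv : HasStrictFDerivAt m (M θ₀).adjoint θ₀
  lipschitz : ∃ C > 0, ∃ δ > 0, ∀ θ ∈ Metric.closedBall θ₀ δ, ∀ θ' ∈ Metric.closedBall θ₀ δ,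
    ‖M θ - M θ'‖ ≤ C * ‖θ - θ'‖
  injective : Function.Injective (M θ₀)

variable {J : E →L[ℝ] E} {M : E → F →L[ℝ] E} {m : E → F} {θ₀ : E} {W : (E × F) ≃L[ℝ] (E × F)}

/-- The radius `δ₀` does not depend on `Ψ`, so it can be fixed before the random estimating function
is inserted. -/
theorem lagrangeMap_linApprox (hm : RegularRestriction M m θ₀) (hW : IsSaddle W J (M θ₀)) {c : ℝ}
    (hc : 0 < c) : ∃ δ₀ > 0, ∀ δ ≤ δ₀, ∀ Ψ : E → E, LinApprox Ψ J θ₀ δ (c / 2) →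
      LinApprox (lagrangeMap Ψ M m) (W : (E × F) →L[ℝ] (E × F)) (θ₀, 0) δ c := by
  obtain ⟨C, hC, δ₁, hδ₁, hlip⟩ := hm.lipschitz
  obtain ⟨δ₂, hδ₂, hstrict⟩ : ∃ δ₂ > 0, ∀ θ ∈ Metric.closedBall θ₀ δ₂,
      ∀ θ' ∈ Metric.closedBall θ₀ δ₂, ‖m θ - m θ' - (M θ₀).adjoint (θ - θ')‖ ≤ c * ‖θ - θ'‖ := by
    have h := hm.strictDeriv.isLittleO.def hc
    rw [Metric.eventually_nhds_iff] at h
    obtain ⟨ε, hε, h⟩ := h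
    refine ⟨ε / 2, by positivity, fun θ hθ θ' hθ' => ?_⟩
    refine h (y := (θ, θ')) ?_
    rw [Prod.dist_eq, max_lt_iff]
    rw [Metric.mem_closedBall] at hθ hθ'
    exact ⟨by linarith, by linarith⟩
  -- The variation of `M` produces two terms; `C δ ≤ c / 4` for each, with `c / 2` from `Ψ`, gives
  -- `c` in the first component.
  refine ⟨min (min δ₁ δ₂) (c / (4 * C)), by positivity, fun δ hδ Ψ hΨ => ?_⟩
  rintro ⟨θ, η⟩ hz ⟨θ', η'⟩ hz'
  rw [Metric.mem_closedBall, Prod.dist_eq, max_le_iff] at hz hz'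
  dsimp only at hz hz'
  have hδ1 : δ ≤ δ₁ := hδ.trans ((min_le_left _ _).trans (min_le_left _ _))
  have hδ2 : δ ≤ δ₂ := hδ.trans ((min_le_left _ _).trans (min_le_right _ _))
  have hδ3 : C * δ ≤ c / 4 := by
    have := hδ.trans (min_le_right _ _)
    rw [le_div_iff₀ (by positivity)] at this
    linarith
  have hN1 : ‖θ - θ'‖ ≤ ‖((θ, η) : E × F) - (θ', η')‖ := le_max_left _ _
  have hN2 : ‖η - η'‖ ≤ ‖((θ, η) : E × F) - (θ', η')‖ := le_max_right _ _
  set N := ‖((θ, η) : E × F) - (θ', η')‖ with hN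
  have hN0 : 0 ≤ N := norm_nonneg _
  have e : lagrangeMap Ψ M m (θ, η) - lagrangeMap Ψ M m (θ', η') -
      (W : (E × F) →L[ℝ] (E × F)) ((θ, η) - (θ', η')) =
      ((Ψ θ - Ψ θ' - J (θ - θ')) + ((M θ - M θ') η + (M θ' - M θ₀) (η - η')),
        m θ - m θ' - (M θ₀).adjoint (θ - θ')) := by
    rw [Prod.mk_sub_mk, ContinuousLinearEquiv.coe_coe, hW]
    simp only [lagrangeMap, Prod.mk_sub_mk, Prod.mk.injEq, and_true]
    simp only [map_sub, sub_apply]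
    abel
  have hb1 : ‖Ψ θ - Ψ θ' - J (θ - θ')‖ ≤ c / 2 * N :=
    (hΨ θ hz.1 θ' hz'.1).trans (by gcongr)
  have hδ0 : 0 ≤ δ := dist_nonneg.trans hz.1
  have hη : ‖η‖ ≤ δ := by rw [← dist_zero_right]; exact hz.2
  have hb2 : ‖(M θ - M θ') η‖ ≤ c / 4 * N := by
    calc _ ≤ ‖M θ - M θ'‖ * ‖η‖ := ContinuousLinearMap.le_opNorm _ _
      _ ≤ (C * N) * δ := by
        gcongr
        exact (hlip θ (hz.1.trans hδ1) θ' (hz'.1.trans hδ1)).trans (by gcongr)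
      _ = C * δ * N := by ring
      _ ≤ _ := by gcongr
  have hb3 : ‖(M θ' - M θ₀) (η - η')‖ ≤ c / 4 * N := by
    calc _ ≤ ‖M θ' - M θ₀‖ * ‖η - η'‖ := ContinuousLinearMap.le_opNorm _ _
      _ ≤ (C * δ) * N := by
        gcongr
        refine (hlip θ' (hz'.1.trans hδ1) θ₀ (Metric.mem_closedBall_self hδ₁.le)).trans ?_
        gcongr
        rw [← dist_eq_norm]; exact hz'.1
      _ ≤ _ := by gcongr
  rw [e, Prod.norm_def, max_le_iff]
  refine ⟨?_, ?_⟩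
  · refine (norm_add_le _ _).trans ?_
    have := norm_add_le ((M θ - M θ') η) ((M θ' - M θ₀) (η - η'))
    linarith
  · refine (hstrict θ (hz.1.trans hδ2) θ' (hz'.1.trans hδ2)).trans ?_
    gcongr

theorem lagrangeMap_base (hm : RegularRestriction M m θ₀) (Ψ : E → E) :
    lagrangeMap Ψ M m (θ₀, 0) = (Ψ θ₀, 0) := by
  simp [lagrangeMap, hm.zero]

/-- The simplified Newton iteration for the Lagrange system converges to a root. -/
theorem exists_lagrange_root (hm : RegularRestriction M m θ₀) (hW : IsSaddle W J (M θ₀)) :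
    ∃ c > 0, ∃ κ > 0, ∃ δ₀ > 0, ∀ δ > 0, δ ≤ δ₀ → ∃ δ' > 0, ∀ Ψ : E → E,
      LinApprox Ψ J θ₀ δ c → ‖Ψ θ₀‖ ≤ δ' →
      ∃ z, lagrangeMap Ψ M m z = 0 ∧ ‖z - (θ₀, 0)‖ ≤ δ ∧ ‖z - (θ₀, 0)‖ ≤ κ * ‖Ψ θ₀‖ ∧
        Tendsto (fun k => (newtonStep W (lagrangeMap Ψ M m))^[k] (θ₀, 0)) atTop (𝓝 z) := by
  obtain ⟨κ, hκ, hκW⟩ := exists_bound_symm W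
  -- The largest linearisation error for which the Newton step still contracts by `1 / 2`.
  have hc : 0 < 1 / (2 * κ) := by positivity
  obtain ⟨δ₀, hδ₀, h⟩ := lagrangeMap_linApprox hm hW hc
  refine ⟨1 / (2 * κ) / 2, by positivity, 2 * κ, by positivity, δ₀, hδ₀, fun δ hδ hδδ =>
    ⟨δ / (2 * κ), by positivity, fun Ψ hΨ hΨ0 => ?_⟩⟩
  have hF := h δ hδδ Ψ hΨ
  have hn : ‖lagrangeMap Ψ M m (θ₀, 0)‖ = ‖Ψ θ₀‖ := by
    rw [lagrangeMap_base hm, Prod.norm_def, norm_zero, max_eq_left (norm_nonneg _)]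
  have hle : 2 * κ * ‖Ψ θ₀‖ ≤ δ := by
    rw [le_div_iff₀ (by positivity)] at hΨ0
    linarith
  obtain ⟨z, hz, hzn, hlim⟩ := exists_root_of_linApprox hκW hκ.le
    (le_of_eq (by field_simp)) hF (by rw [hn]; exact hle)
  rw [hn] at hzn
  exact ⟨z, hz, hzn.trans hle, hzn, hlim⟩

/-- Every root of the Lagrange system near `θ₀` has the linear expansion given by the inverse of
the saddle matrix. -/
theorem lagrange_root_expansion (hm : RegularRestriction M m θ₀) (hW : IsSaddle W J (M θ₀)) {ε : ℝ}
    (hε : 0 < ε) : ∃ c > 0, ∃ δ₀ > 0, ∀ δ > 0, δ ≤ δ₀ → ∃ δ' > 0, ∀ Ψ : E → E,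
      LinApprox Ψ J θ₀ δ c → ‖Ψ θ₀‖ ≤ δ' → ∀ θ η, ‖θ - θ₀‖ ≤ δ' → Ψ θ + M θ η = 0 → m θ = 0 →
      ‖θ - θ₀ + (W.symm (Ψ θ₀, 0)).1‖ ≤ ε * ‖Ψ θ₀‖ := by
  obtain ⟨κ, hκ, hκW⟩ := exists_bound_symm W
  obtain ⟨C, hC, δ₁, hδ₁, hlip⟩ := hm.lipschitz
  -- Nothing is assumed on the size of the multiplier; it is controlled because the injective map `M
  -- θ₀` is bounded below.
  obtain ⟨κ₁, hκ₁, hanti⟩ : ∃ κ₁ > 0, ∀ b, ‖b‖ ≤ κ₁ * ‖M θ₀ b‖ := by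
    obtain ⟨K, hK, hanti⟩ := LinearMap.exists_antilipschitzWith ((M θ₀ : F →L[ℝ] E) : F →ₗ[ℝ] E)
      (LinearMap.ker_eq_bot.2 hm.injective)
    refine ⟨K, by exact_mod_cast hK, fun b => ?_⟩
    have := hanti.le_mul_dist b 0
    simpa using this
  obtain ⟨c, hc, hc1, hc2⟩ : ∃ c > 0, κ * c ≤ 1 / 2 ∧ 2 * κ ^ 2 * c ≤ ε := by
    refine ⟨min (1 / (2 * κ)) (ε / (2 * κ ^ 2)), by positivity, ?_, ?_⟩
    · calc _ ≤ κ * (1 / (2 * κ)) := by gcongr; exact min_le_left _ _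
        _ = _ := by field_simp
    · calc _ ≤ 2 * κ ^ 2 * (ε / (2 * κ ^ 2)) := by gcongr; exact min_le_right _ _
        _ = _ := by field_simp
  obtain ⟨δ₀, hδ₀, h⟩ := lagrangeMap_linApprox hm hW hc
  refine ⟨c / 2, by positivity, δ₀, hδ₀, fun δ hδ hδδ => ?_⟩
  -- `b * δ'` bounds `‖Ψ θ‖` near `θ₀`: the `1` accounts for `Ψ θ₀`, the rest for the increment.
  set b := 1 + ‖J‖ + c / 2 with hb
  have hb0 : 0 < b := by positivity
  -- The last two radii concern the multiplier: the first lets the term `κ₁ C δ' ‖η‖` be absorbed in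
  -- `‖η‖`, the second then makes `‖η‖ ≤ δ`.
  refine ⟨min (min δ δ₁) (min (1 / (2 * κ₁ * C)) (δ / (2 * κ₁ * b))), by positivity,
    fun Ψ hΨ hΨ0 θ η hθ hroot hmθ => ?_⟩
  set δ' := min (min δ δ₁) (min (1 / (2 * κ₁ * C)) (δ / (2 * κ₁ * b))) with hδ'
  have hδ'0 : 0 < δ' := by positivity
  have d1 : δ' ≤ δ := (min_le_left _ _).trans (min_le_left _ _)
  have d2 : δ' ≤ δ₁ := (min_le_left _ _).trans (min_le_right _ _)
  have d3 : κ₁ * (C * δ') ≤ 1 / 2 := by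
    have : δ' ≤ 1 / (2 * κ₁ * C) := (min_le_right _ _).trans (min_le_left _ _)
    calc _ ≤ κ₁ * (C * (1 / (2 * κ₁ * C))) := by gcongr
      _ = _ := by field_simp
  have d4 : 2 * κ₁ * (b * δ') ≤ δ := by
    have : δ' ≤ δ / (2 * κ₁ * b) := (min_le_right _ _).trans (min_le_right _ _)
    calc _ ≤ 2 * κ₁ * (b * (δ / (2 * κ₁ * b))) := by gcongr
      _ = _ := by field_simp
  have hθδ : θ ∈ Metric.closedBall θ₀ δ := mem_closedBall_iff_norm.2 (hθ.trans d1)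
  have hΨθ : ‖Ψ θ‖ ≤ b * δ' := by
    have h1 := hΨ θ hθδ θ₀ (Metric.mem_closedBall_self hδ.le)
    have h2 : Ψ θ = (Ψ θ - Ψ θ₀ - J (θ - θ₀)) + J (θ - θ₀) + Ψ θ₀ := by abel
    rw [h2]
    refine (norm_add₃_le).trans ?_
    have h3 := J.le_opNorm (θ - θ₀)
    have h4 : ‖J‖ * ‖θ - θ₀‖ ≤ ‖J‖ * δ' := by gcongr
    have h5 : c / 2 * ‖θ - θ₀‖ ≤ c / 2 * δ' := by gcongr
    have h6 : b * δ' = δ' + ‖J‖ * δ' + c / 2 * δ' := by rw [hb]; ring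
    linarith
  have hη : ‖η‖ ≤ δ := by
    have h1 : M θ η = -Ψ θ := by
      rw [eq_neg_iff_add_eq_zero, add_comm]; exact hroot
    have h2 : ‖M θ₀ η‖ ≤ ‖Ψ θ‖ + C * δ' * ‖η‖ := by
      have h3 : M θ₀ η = M θ η - (M θ - M θ₀) η := by simp
      rw [h3, h1]
      refine (norm_sub_le _ _).trans ?_
      rw [norm_neg]
      gcongr
      refine (ContinuousLinearMap.le_opNorm _ _).trans ?_
      gcongr
      refine (hlip θ (mem_closedBall_iff_norm.2 (hθ.trans d2)) θ₀
        (Metric.mem_closedBall_self hδ₁.le)).trans ?_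
      gcongr
    have h4 : ‖η‖ ≤ κ₁ * ‖Ψ θ‖ + 1 / 2 * ‖η‖ := by
      calc ‖η‖ ≤ κ₁ * ‖M θ₀ η‖ := hanti η
        _ ≤ κ₁ * (‖Ψ θ‖ + C * δ' * ‖η‖) := by gcongr
        _ = κ₁ * ‖Ψ θ‖ + κ₁ * (C * δ') * ‖η‖ := by ring
        _ ≤ _ := by gcongr
    have h5 : κ₁ * ‖Ψ θ‖ ≤ κ₁ * (b * δ') := by gcongr
    linarith
  have hz : ((θ, η) : E × F) ∈ Metric.closedBall (θ₀, (0 : F)) δ := by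
    rw [Metric.mem_closedBall, Prod.dist_eq, max_le_iff]
    exact ⟨hθδ, by rw [dist_zero_right]; exact hη⟩
  have hexp := norm_root_expansion_le hκW hκ.le hc.le hc1 (h δ hδδ Ψ hΨ) hz
    (by simp [lagrangeMap, hroot, hmθ])
  rw [lagrangeMap_base hm] at hexp
  have hn : ‖((Ψ θ₀, 0) : E × F)‖ = ‖Ψ θ₀‖ := by
    rw [Prod.norm_def, norm_zero, max_eq_left (norm_nonneg _)]
  rw [hn] at hexp
  calc _ ≤ ‖(θ, η) - (θ₀, (0 : F)) + W.symm (Ψ θ₀, 0)‖ := le_max_left _ _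
    _ ≤ _ := hexp
    _ ≤ _ := by gcongr

end Lagrange

/-! ### Radial retraction onto a ball -/

section Retraction

variable {E : Type*} [NormedAddCommGroup E] [NormedSpace ℝ E]

/-- The radial retraction onto the closed ball of centre `a` and radius `R`. -/
noncomputable def ballRetract (a : E) (R : ℝ) (θ : E) : E :=
  a + (R / max R ‖θ - a‖) • (θ - a)

theorem continuous_ballRetract (a : E) {R : ℝ} (hR : 0 < R) : Continuous (ballRetract a R) := by
  unfold ballRetract
  have : ∀ θ : E, max R ‖θ - a‖ ≠ 0 := fun θ => (lt_max_of_lt_left hR).ne'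
  fun_prop (disch := assumption)

theorem ballRetract_mem (a : E) {R : ℝ} (hR : 0 < R) (θ : E) :
    ballRetract a R θ ∈ Metric.closedBall a R := by
  have h : 0 < max R ‖θ - a‖ := lt_max_of_lt_left hR
  rw [mem_closedBall_iff_norm, ballRetract, add_sub_cancel_left, norm_smul, Real.norm_eq_abs,
    abs_of_pos (by positivity), div_mul_eq_mul_div, div_le_iff₀ h]
  gcongr
  exact le_max_right _ _

theorem ballRetract_eq (a : E) {R : ℝ} (hR : 0 < R) {θ : E} (hθ : θ ∈ Metric.closedBall a R) :
    ballRetract a R θ = θ := by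
  rw [ballRetract, max_eq_left (mem_closedBall_iff_norm.1 hθ), div_self hR.ne', one_smul]
  abel

end Retraction

/-! ### Consistent roots of random estimating equations -/

section MEstimation

variable {E F : Type*} [NormedAddCommGroup E] [InnerProductSpace ℝ E] [FiniteDimensional ℝ E]
  [MeasurableSpace E]
  [NormedAddCommGroup F] [InnerProductSpace ℝ F] [FiniteDimensional ℝ F]
  {X : Type*} [MeasurableSpace X]

/-- A centered estimating function `ψ θ x` with the derivative `D x` at `θ₀`, whose modulus of
differentiability is controlled by the integrable function `L`. -/
structure RegularScore (G : Measure X) (ψ : E → X → E) (θ₀ : E) (R : ℝ) (D : X → E →L[ℝ] E)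
    (L : X → ℝ) : Prop where
  pos : 0 < R
  continuous : ∀ x, Continuous fun θ => ψ θ x
  measurable : ∀ θ, Measurable (ψ θ)
  linApprox : ∀ x, ∀ ρ ≤ R, LinApprox (fun θ => ψ θ x) (D x) θ₀ ρ (L x * ρ)
  integrable_deriv : Integrable D G
  integrable_bound : Integrable L G
  integrable : Integrable (ψ θ₀) G
  mean : ∫ x, ψ θ₀ x ∂G = 0

variable {S : Type*} [MeasurableSpace S] {P : Measure S} [IsProbabilityMeasure P]
  {G : Measure X} {obs : ℕ → S → X} {ψ : E → X → E} {θ₀ : E} {R : ℝ} {D : X → E →L[ℝ] E}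
  {L : X → ℝ}

/-- Averaging the pointwise approximations leaves only the sample means of `D` and `L`. The law of
large numbers for these two functions suffices; no uniform law over `θ` is needed. -/
theorem likely_linApprox (hobs : ∀ i, Measurable (obs i)) (hindep : iIndepFun obs P)
    (hlaw : ∀ i, P.map (obs i) = G) (hψ : RegularScore G ψ θ₀ R D L) {c : ℝ} (hc : 0 < c) :
    ∃ δ₀ > 0, ∀ δ ≤ δ₀, Likely P fun n s =>
      LinApprox (fun θ => sampleMean (fun i : Fin n => obs i s) (ψ θ)) (∫ x, D x ∂G) θ₀ δ c := by
  -- The sample mean of `L` stays below `l` with probability tending to one.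
  set l := |∫ x, L x ∂G| + 1 with hl
  have hl0 : 0 < l := by positivity
  refine ⟨min R (c / (2 * l)), lt_min hψ.pos (by positivity), fun δ hδ => ?_⟩
  have hD := likely_sampleMean hobs hindep hlaw hψ.integrable_deriv (half_pos hc)
  have hL := likely_sampleMean hobs hindep hlaw hψ.integrable_bound one_pos
  refine (hD.and hL).mono fun n s hs θ hθ θ' hθ' => ?_
  obtain ⟨h1, h2⟩ := hs
  have hδ0 : 0 ≤ δ := dist_nonneg.trans hθ
  set x : Fin n → X := fun i => obs i s
  have h3 : sampleMean x L ≤ l := by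
    rw [Real.norm_eq_abs] at h2
    have := (abs_lt.1 h2).2
    have := le_abs_self (∫ x, L x ∂G)
    rw [hl]; linarith
  have h4 : sampleMean x L * δ ≤ c / 2 := by
    have h5 : δ ≤ c / (2 * l) := hδ.trans (min_le_right _ _)
    calc _ ≤ l * (c / (2 * l)) := by gcongr
      _ = _ := by field_simp
  have h6 : sampleMean x (ψ θ) - sampleMean x (ψ θ') - (∫ x, D x ∂G) (θ - θ') =
      sampleMean x (fun y => ψ θ y - ψ θ' y - D y (θ - θ')) +
        (sampleMean x D - ∫ x, D x ∂G) (θ - θ') := by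
    simp only [sampleMean, Finset.sum_sub_distrib, smul_sub, sub_apply,
      smul_apply, sum_apply]
    abel
  have h7 : ‖sampleMean x (fun y => ψ θ y - ψ θ' y - D y (θ - θ'))‖ ≤
      sampleMean x L * δ * ‖θ - θ'‖ := by
    rw [sampleMean, norm_smul, sampleMean, norm_inv, Real.norm_natCast, smul_eq_mul, mul_assoc,
      mul_assoc, Finset.sum_mul]
    gcongr
    refine (norm_sum_le _ _).trans (Finset.sum_le_sum fun i _ => ?_)
    rw [← mul_assoc]
    exact hψ.linApprox (x i) δ (hδ.trans (min_le_left _ _)) θ hθ θ' hθ'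
  show ‖sampleMean x (ψ θ) - sampleMean x (ψ θ') - (∫ x, D x ∂G) (θ - θ')‖ ≤ c * ‖θ - θ'‖
  rw [h6]
  calc _ ≤ _ := norm_add_le _ _
    _ ≤ sampleMean x L * δ * ‖θ - θ'‖ + c / 2 * ‖θ - θ'‖ := by
      gcongr
      refine (ContinuousLinearMap.le_opNorm _ _).trans ?_
      gcongr
    _ ≤ c / 2 * ‖θ - θ'‖ + c / 2 * ‖θ - θ'‖ := by gcongr
    _ = _ := by ring

theorem likely_score_small (hobs : ∀ i, Measurable (obs i)) (hindep : iIndepFun obs P)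
    (hlaw : ∀ i, P.map (obs i) = G) (hψ : RegularScore G ψ θ₀ R D L) {ε : ℝ} (hε : 0 < ε) :
    Likely P fun n s => ‖sampleMean (fun i : Fin n => obs i s) (ψ θ₀)‖ ≤ ε := by
  refine (likely_sampleMean hobs hindep hlaw hψ.integrable hε).mono fun n s hs => ?_
  rw [hψ.mean, sub_zero] at hs
  exact hs.le

variable {M : E → F →L[ℝ] E} {m : E → F} {W : (E × F) ≃L[ℝ] (E × F)}

/-- A score continuous in `θ` and measurable in `x` is jointly measurable, so each iterate is
measurable in the sample. Taking the limit of the iterates thus avoids a measurable selection of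
roots. -/
theorem measurable_newton_iterate [BorelSpace E] [MeasurableSpace F] [BorelSpace F]
    (hψ : RegularScore G ψ θ₀ R D L) (hM : Continuous M)
    (hm : Continuous m) (n k : ℕ) (z₀ : E × F) :
    Measurable fun x : Fin n → X =>
      (newtonStep W (lagrangeMap (fun θ => sampleMean x (ψ θ)) M m))^[k] z₀ := by
  have hjoint : Measurable (Function.uncurry ψ) :=
    measurable_uncurry_of_continuous_of_measurable (u := ψ) hψ.continuous hψ.measurable
  have hMη : Continuous fun z : E × F => M z.1 z.2 := by fun_prop
  induction k with
  | zero => exact measurable_const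
  | succ k ih =>
    simp_rw [Function.iterate_succ_apply']
    set z : (Fin n → X) → E × F := fun x =>
      (newtonStep W (lagrangeMap (fun θ => sampleMean x (ψ θ)) M m))^[k] z₀ with hz
    have h1 : Measurable fun x => sampleMean x (ψ (z x).1) := by
      unfold sampleMean
      refine Measurable.const_smul (Finset.measurable_sum _ fun i _ => ?_) _
      exact hjoint.comp (ih.fst.prodMk (measurable_pi_apply i))
    have h2 : Measurable fun x => M (z x).1 (z x).2 := hMη.measurable.comp ih
    have h3 : Measurable fun x => m (z x).1 := hm.measurable.comp ih.fst
    exact ih.sub (W.symm.continuous.measurable.comp ((h1.add h2).prodMk h3))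

/-- A measurable consistent sequence of roots of the Lagrange system. -/
theorem exists_consistent_root [BorelSpace E] (hobs : ∀ i, Measurable (obs i))
    (hindep : iIndepFun obs P)
    (hlaw : ∀ i, P.map (obs i) = G) (hψ : RegularScore G ψ θ₀ R D L)
    (hm : RegularRestriction M m θ₀) (hMc : Continuous M) (hmc : Continuous m)
    (hW : IsSaddle W (∫ x, D x ∂G) (M θ₀)) :
    ∃ est : (n : ℕ) → (Fin n → X) → E, (∀ n, Measurable (est n)) ∧
      (∀ n x, est n x ∈ Metric.closedBall θ₀ R) ∧
      (Likely P fun n s => ∃ η,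
        sampleMean (fun i : Fin n => obs i s) (ψ (est n fun i => obs i s)) +
          M (est n fun i => obs i s) η = 0 ∧ m (est n fun i => obs i s) = 0) ∧
      TendstoInMeasure P (fun n s => est n fun i => obs i s) atTop (fun _ => θ₀) := by
  borelize F
  obtain ⟨c, hc, κ, hκ, δ₀, hδ₀, H⟩ := exists_lagrange_root hm hW
  obtain ⟨δ₁, hδ₁, hlin⟩ := likely_linApprox hobs hindep hlaw hψ hc
  have hR := hψ.pos
  set δ := min R (min δ₀ δ₁) with hδ
  have hδ0 : 0 < δ := by positivity
  obtain ⟨δ', hδ', H⟩ := H δ hδ0 ((min_le_right _ _).trans (min_le_left _ _))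
  set it : (n : ℕ) → (Fin n → X) → ℕ → E × F := fun n x k =>
    (newtonStep W (lagrangeMap (fun θ => sampleMean x (ψ θ)) M m))^[k] (θ₀, 0) with hit
  have hkey : Likely P fun n s => ∃ z : E × F,
      lagrangeMap (fun θ => sampleMean (fun i : Fin n => obs i s) (ψ θ)) M m z = 0 ∧
      ‖z - (θ₀, 0)‖ ≤ δ ∧ ‖z - (θ₀, 0)‖ ≤ κ * ‖sampleMean (fun i : Fin n => obs i s) (ψ θ₀)‖ ∧
      ballRetract θ₀ R (limUnder atTop (it n fun i => obs i s)).1 = z.1 := by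
    refine ((hlin δ ((min_le_right _ _).trans (min_le_right _ _))).and
      (likely_score_small hobs hindep hlaw hψ hδ')).mono fun n s hs => ?_
    obtain ⟨z, hz, hzδ, hzκ, hlim⟩ := H _ hs.1 hs.2
    refine ⟨z, hz, hzδ, hzκ, ?_⟩
    rw [Tendsto.limUnder_eq hlim]
    refine ballRetract_eq _ hR ?_
    rw [mem_closedBall_iff_norm]
    exact ((le_max_left _ _ : ‖z.1 - θ₀‖ ≤ ‖z - (θ₀, 0)‖).trans hzδ).trans (min_le_left _ _)
  -- Where the iteration diverges, `limUnder` takes some default value, which the retraction still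
  -- sends into the ball.
  refine ⟨fun n x => ballRetract θ₀ R (limUnder atTop (it n x)).1, fun n => ?_,
    fun n x => ballRetract_mem _ hR _, ?_, ?_⟩
  · have hlim : Measurable fun x => limUnder atTop (it n x) :=
      (StronglyMeasurable.limUnder (l := atTop) (f := fun k x => it n x k) fun k =>
        (measurable_newton_iterate hψ hMc hmc n k _).stronglyMeasurable).measurable
    exact (continuous_ballRetract θ₀ hR).measurable.comp hlim.fst
  · refine hkey.mono fun n s hs => ?_
    obtain ⟨z, hz, -, -, hzr⟩ := hs
    refine ⟨z.2, ?_⟩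
    dsimp only
    rw [hzr]
    exact ⟨congrArg Prod.fst hz, congrArg Prod.snd hz⟩
  · rw [tendstoInMeasure_iff_likely]
    intro ε hε
    refine (hkey.and (likely_score_small hobs hindep hlaw hψ
      (show 0 < ε / (2 * κ) by positivity))).mono fun n s hs => ?_
    obtain ⟨⟨z, -, -, hzκ, hzr⟩, hsmall⟩ := hs
    dsimp only
    rw [hzr, dist_eq_norm]
    calc ‖z.1 - θ₀‖ ≤ ‖z - (θ₀, 0)‖ := le_max_left _ _
      _ ≤ κ * (ε / (2 * κ)) := hzκ.trans (by gcongr)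
      _ = ε / 2 := by field_simp
      _ < ε := half_lt_self hε

/-- The linear expansion of a consistent sequence of roots of the Lagrange system. -/
theorem likely_root_expansion (hobs : ∀ i, Measurable (obs i)) (hindep : iIndepFun obs P)
    (hlaw : ∀ i, P.map (obs i) = G) (hψ : RegularScore G ψ θ₀ R D L)
    (hm : RegularRestriction M m θ₀) (hW : IsSaddle W (∫ x, D x ∂G) (M θ₀)) {est : ℕ → S → E}
    (hroot : Likely P fun n s => ∃ η,
      sampleMean (fun i : Fin n => obs i s) (ψ (est n s)) + M (est n s) η = 0 ∧ m (est n s) = 0)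
    (hest : TendstoInMeasure P est atTop (fun _ => θ₀)) {ε : ℝ} (hε : 0 < ε) :
    Likely P fun n s =>
      ‖est n s - θ₀ + (W.symm (sampleMean (fun i : Fin n => obs i s) (ψ θ₀), 0)).1‖ ≤
        ε * ‖sampleMean (fun i : Fin n => obs i s) (ψ θ₀)‖ := by
  obtain ⟨c, hc, δ₀, hδ₀, H⟩ := lagrange_root_expansion hm hW hε
  obtain ⟨δ₁, hδ₁, hlin⟩ := likely_linApprox hobs hindep hlaw hψ hc
  set δ := min δ₀ δ₁ with hδ
  have hδ0 : 0 < δ := by positivity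
  obtain ⟨δ', hδ', H⟩ := H δ hδ0 (min_le_left _ _)
  refine ((((hlin δ (min_le_right _ _)).and (likely_score_small hobs hindep hlaw hψ hδ')).and
    hroot).and (tendstoInMeasure_iff_likely.1 hest δ' hδ')).mono fun n s hs => ?_
  obtain ⟨⟨⟨h1, h2⟩, η, h3, h4⟩, h5⟩ := hs
  exact H _ h1 h2 _ η (by rw [← dist_eq_norm]; exact h5.le) h3 h4

end MEstimation

/-! ### Coordinates and third-derivative bounds -/

section ParamCalculus

variable {p : ℕ}

theorem sum_smul_coordVec (v : Param p) : ∑ j, v j • coordVec j = v := by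
  ext i
  simp [coordVec, Pi.single_apply]

/-- The vector of the values of a linear form at the coordinate vectors. -/
noncomputable def toVec : (Param p →L[ℝ] ℝ) →L[ℝ] Param p :=
  ∑ j, (ContinuousLinearMap.apply ℝ ℝ (coordVec j)).smulRight (coordVec j)

@[simp]
theorem toVec_apply (φ : Param p →L[ℝ] ℝ) (j : Fin p) : toVec φ j = φ (coordVec j) := by
  simp [toVec, coordVec, Pi.single_apply]

/-- The norm of a multilinear form is at most the sum of its values at coordinate vectors. -/
theorem norm_le_sum_coordVec {k : ℕ} (T : ContinuousMultilinearMap ℝ (fun _ : Fin k => Param p) ℝ) :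
    ‖T‖ ≤ ∑ r : Fin k → Fin p, |T fun i => coordVec (r i)| := by
  refine ContinuousMultilinearMap.opNorm_le_bound
    (Finset.sum_nonneg fun r _ => abs_nonneg _) fun m => ?_
  have h1 : T m = T fun i => ∑ j, m i j • coordVec j := by
    congr 1; funext i; rw [sum_smul_coordVec]
  rw [h1, T.map_sum (g := fun i j => m i j • coordVec j), Finset.sum_mul]
  refine (norm_sum_le _ _).trans (Finset.sum_le_sum fun r _ => ?_)
  rw [T.map_smul_univ (fun i => m i (r i)) fun i => coordVec (r i), norm_smul, mul_comm]
  rw [Real.norm_eq_abs (T _), norm_prod]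
  gcongr with i
  exact PiLp.norm_apply_le (m i) (r i)

/-- A bound on the third derivative gives a Lipschitz bound on the second one, and so a linear
approximation of the first one. -/
theorem linApprox_fderiv {E : Type*} [NormedAddCommGroup E] [NormedSpace ℝ E] {V : E → ℝ}
    {ω : Set E} (hω : IsOpen ω) (hV : ContDiffOn ℝ 2 V ω)
    (hV2 : DifferentiableOn ℝ (iteratedFDeriv ℝ 2 V) ω) {C R : ℝ}
    (hC : ∀ θ ∈ ω, ‖iteratedFDeriv ℝ 3 V θ‖ ≤ C) {θ₀ : E} (hR : Metric.closedBall θ₀ R ⊆ ω)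
    {ρ : ℝ} (hρ : ρ ≤ R) :
    LinApprox (fderiv ℝ V) (fderiv ℝ (fderiv ℝ V) θ₀) θ₀ ρ (C * ρ) := by
  intro θ hθ θ' hθ'
  have hρ0 : 0 ≤ ρ := dist_nonneg.trans hθ
  have hsub : Metric.closedBall θ₀ ρ ⊆ ω := (Metric.closedBall_subset_closedBall hρ).trans hR
  have hθ₀ : θ₀ ∈ Metric.closedBall θ₀ ρ := Metric.mem_closedBall_self hρ0
  have hC0 : 0 ≤ C := (norm_nonneg _).trans (hC θ₀ (hsub hθ₀))
  have hdiff : ∀ t ∈ Metric.closedBall θ₀ ρ,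
      HasFDerivWithinAt (fderiv ℝ V) (fderiv ℝ (fderiv ℝ V) t) (Metric.closedBall θ₀ ρ) t := by
    intro t ht
    have h1 : ContDiffAt ℝ 2 V t := hV.contDiffAt (hω.mem_nhds (hsub ht))
    have h2 : ContDiffAt ℝ 1 (fderiv ℝ V) t := h1.fderiv_right (by norm_num)
    exact (h2.differentiableAt (by norm_num)).hasFDerivAt.hasFDerivWithinAt
  -- The mean value inequality is used twice: the bound on the third derivative limits the drift of
  -- the second one to `C ρ`, which limits the remainder of the first one.
  refine Convex.norm_image_sub_le_of_norm_hasFDerivWithin_le' hdiff (fun t ht => ?_)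
    (convex_closedBall θ₀ ρ) hθ' hθ
  have h3 : ‖iteratedFDeriv ℝ 2 V t - iteratedFDeriv ℝ 2 V θ₀‖ ≤ C * ‖t - θ₀‖ := by
    refine Convex.norm_image_sub_le_of_norm_hasFDerivWithin_le
      (f' := fderiv ℝ (iteratedFDeriv ℝ 2 V)) (fun y hy => ?_) (fun y hy => ?_)
      (convex_closedBall θ₀ ρ) hθ₀ ht
    · exact ((hV2.differentiableAt (hω.mem_nhds (hsub hy))).hasFDerivAt).hasFDerivWithinAt
    · rw [norm_fderiv_iteratedFDeriv]
      exact hC y (hsub hy)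
  have h4 : C * ‖t - θ₀‖ ≤ C * ρ := by
    gcongr
    exact mem_closedBall_iff_norm.1 ht
  refine ContinuousLinearMap.opNorm_le_bound _ (by positivity) fun u =>
    ContinuousLinearMap.opNorm_le_bound _ (by positivity) fun v => ?_
  have h5 : (fderiv ℝ (fderiv ℝ V) t - fderiv ℝ (fderiv ℝ V) θ₀) u v =
      (iteratedFDeriv ℝ 2 V t - iteratedFDeriv ℝ 2 V θ₀) ![u, v] := by
    simp [iteratedFDeriv_two_apply]
  rw [h5]
  refine (ContinuousMultilinearMap.le_opNorm _ _).trans ?_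
  rw [Fin.prod_univ_two, Matrix.cons_val_zero, Matrix.cons_val_one, Matrix.cons_val_fin_one,
    mul_assoc]
  gcongr
  exact h3.trans h4

end ParamCalculus

/-! ### Differentiation under the integral sign -/

section DiffUnderIntegral

variable {p : ℕ} {Y : Type*} [MeasurableSpace Y] {μ : Measure Y} {ω : Set (Param p)} {N : ℕ}
  {F : Param p → Y → ℝ}

/-- By induction the identity at order `k` holds on a neighbourhood of each point of the open set
`ω`, so it can be differentiated once more; currying commutes with the integral. -/
theorem DiffUnderIntegral.iteratedFDeriv_integral (h : DiffUnderIntegral μ ω N F) (hω : IsOpen ω)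
    {k : ℕ} (hk : k ≤ N) {θ : Param p} (hθ : θ ∈ ω) :
    iteratedFDeriv ℝ k (fun t => ∫ x, F t x ∂μ) θ =
      ∫ x, iteratedFDeriv ℝ k (fun t => F t x) θ ∂μ := by
  induction k generalizing θ with
  | zero =>
    simp only [iteratedFDeriv_zero_eq_comp, Function.comp_apply]
    exact (ContinuousLinearEquiv.integral_comp_comm
      (continuousMultilinearCurryFin0 ℝ (Param p) ℝ).symm.toContinuousLinearEquiv _).symm
  | succ k ih =>
    have hev : iteratedFDeriv ℝ k (fun t => ∫ x, F t x ∂μ) =ᶠ[𝓝 θ]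
        fun t => ∫ x, iteratedFDeriv ℝ k (fun t' => F t' x) t ∂μ := by
      filter_upwards [hω.mem_nhds hθ] with t ht
      exact ih (by omega) ht
    have hd := (h.2 k (by omega) θ hθ).congr_of_eventuallyEq hev
    simp only [iteratedFDeriv_succ_eq_comp_left, Function.comp_apply]
    rw [hd.fderiv]
    exact (ContinuousLinearEquiv.integral_comp_comm (𝕜 := ℝ) (X := Y) (μ := μ)
      (E := Param p →L[ℝ] ContinuousMultilinearMap ℝ (fun _ : Fin k => Param p) ℝ)
      (F := ContinuousMultilinearMap ℝ (fun _ : Fin (k + 1) => Param p) ℝ)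
      (continuousMultilinearCurryLeftEquiv ℝ (fun _ : Fin (k + 1) => Param p)
        ℝ).symm.toContinuousLinearEquiv
      fun x => fderiv ℝ (iteratedFDeriv ℝ k fun t => F t x) θ).symm

theorem DiffUnderIntegral.differentiableOn_iteratedFDeriv (h : DiffUnderIntegral μ ω N F)
    (hω : IsOpen ω) {k : ℕ} (hk : k < N) :
    DifferentiableOn ℝ (iteratedFDeriv ℝ k (fun t => ∫ x, F t x ∂μ)) ω := by
  intro θ hθ
  have hev : iteratedFDeriv ℝ k (fun t => ∫ x, F t x ∂μ) =ᶠ[𝓝 θ]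
      fun t => ∫ x, iteratedFDeriv ℝ k (fun t' => F t' x) t ∂μ := by
    filter_upwards [hω.mem_nhds hθ] with t ht
    exact h.iteratedFDeriv_integral hω hk.le ht
  exact ((h.2 k hk θ hθ).congr_of_eventuallyEq hev).differentiableAt.differentiableWithinAt

/-- One order is lost: the derivatives up to order `N` are differentiable, hence continuous, but
nothing makes the last one continuous. -/
theorem DiffUnderIntegral.contDiffOn {N : ℕ} (h : DiffUnderIntegral μ ω (N + 1) F)
    (hω : IsOpen ω) : ContDiffOn ℝ N (fun t => ∫ x, F t x ∂μ) ω := by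
  refine contDiffOn_of_differentiableOn (n := (N : ℕ∞)) fun k hk => ?_
  have hk' : k < N + 1 := by
    have : k ≤ N := by exact_mod_cast hk
    omega
  exact (h.differentiableOn_iteratedFDeriv hω hk').congr (iteratedFDerivWithin_of_isOpen k hω)

theorem DiffUnderIntegral.fderiv_apply (h : DiffUnderIntegral μ ω N F) (hω : IsOpen ω)
    (hN : 1 ≤ N) {θ : Param p} (hθ : θ ∈ ω) (v : Param p) :
    fderiv ℝ (fun t => ∫ x, F t x ∂μ) θ v = ∫ x, fderiv ℝ (fun t => F t x) θ v ∂μ := by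
  have h1 := h.iteratedFDeriv_integral hω hN hθ
  have h2 := DFunLike.congr_fun h1 ![v]
  rw [ContinuousMultilinearMap.integral_apply (h.1 1 hN θ hθ)] at h2
  simpa [iteratedFDeriv_one_apply] using h2

theorem DiffUnderIntegral.fderiv_fderiv_apply (h : DiffUnderIntegral μ ω N F) (hω : IsOpen ω)
    (hN : 2 ≤ N) {θ : Param p} (hθ : θ ∈ ω) (u v : Param p) :
    fderiv ℝ (fderiv ℝ fun t => ∫ x, F t x ∂μ) θ u v =
      ∫ x, fderiv ℝ (fderiv ℝ fun t => F t x) θ u v ∂μ := by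
  have h1 := h.iteratedFDeriv_integral hω hN hθ
  have h2 := DFunLike.congr_fun h1 ![u, v]
  rw [ContinuousMultilinearMap.integral_apply (h.1 2 hN θ hθ)] at h2
  simpa [iteratedFDeriv_two_apply] using h2

theorem DiffUnderIntegral.integrable_fderiv_fderiv (h : DiffUnderIntegral μ ω N F)
    (hN : 2 ≤ N) {θ : Param p} (hθ : θ ∈ ω) (u v : Param p) :
    Integrable (fun x => fderiv ℝ (fderiv ℝ fun t => F t x) θ u v) μ := by
  have h1 := h.1 2 hN θ hθ
  have h2 := (ContinuousMultilinearMap.apply ℝ (fun _ : Fin 2 => Param p) ℝ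
    ![u, v]).integrable_comp h1
  simpa [iteratedFDeriv_two_apply] using h2

end DiffUnderIntegral

/-! ### Derivatives of the generating function -/

section Generator

variable {B : ℝ → ℝ}

theorem IsBregmanGenerator.contDiffOn_deriv (hB : IsBregmanGenerator B) :
    ContDiffOn ℝ 3 (deriv B) (Set.Ioi 0) :=
  hB.contDiffOn.deriv_of_isOpen isOpen_Ioi (by norm_num)

theorem IsBregmanGenerator.hasDerivAt (hB : IsBregmanGenerator B) {y : ℝ} (hy : 0 < y) :
    HasDerivAt B (deriv B y) y :=
  ((hB.contDiffOn.contDiffAt (Ioi_mem_nhds hy)).differentiableAt (by norm_num)).hasDerivAt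

theorem IsBregmanGenerator.hasDerivAt_deriv (hB : IsBregmanGenerator B) {y : ℝ} (hy : 0 < y) :
    HasDerivAt (deriv B) (deriv (deriv B) y) y :=
  ((hB.contDiffOn_deriv.contDiffAt (Ioi_mem_nhds hy)).differentiableAt (by norm_num)).hasDerivAt

end Generator

/-! ### The weighted score as a gradient -/

section Density

variable {p : ℕ} {X : Type*} {ω : Set (Param p)} {f : Param p → X → ℝ} {B : ℝ → ℝ}
  {θ₀ θ : Param p} {x : X}

theorem hasFDerivAt_density (hω : IsOpen ω) (hsm : ContDiffOn ℝ 3 (fun t => f t x) ω)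
    (hθ : θ ∈ ω) : HasFDerivAt (fun t => f t x) (fderiv ℝ (fun t => f t x) θ) θ :=
  ((hsm.contDiffAt (hω.mem_nhds hθ)).differentiableAt (by norm_num)).hasFDerivAt

theorem hasFDerivAt_deriv_density (hB : IsBregmanGenerator B) (hω : IsOpen ω)
    (hsm : ContDiffOn ℝ 3 (fun t => f t x) ω) (hpos : ∀ t ∈ ω, 0 < f t x) (hθ : θ ∈ ω) :
    HasFDerivAt (fun t => deriv B (f t x))
      (deriv (deriv B) (f θ x) • fderiv ℝ (fun t => f t x) θ) θ :=
  HasDerivAt.comp_hasFDerivAt (h₂ := deriv B) θ (hB.hasDerivAt_deriv (hpos θ hθ))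
    (hasFDerivAt_density hω hsm hθ)

theorem contDiffOn_deriv_density (hB : IsBregmanGenerator B)
    (hsm : ContDiffOn ℝ 3 (fun t => f t x) ω) (hpos : ∀ t ∈ ω, 0 < f t x) :
    ContDiffOn ℝ 3 (fun t => deriv B (f t x)) ω :=
  hB.contDiffOn_deriv.comp hsm fun t ht => hpos t ht

/-- The factor `f` cancels the denominator of the logarithmic derivative, and the chain rule for
`B'(f)` remains. -/
theorem weightedScore_eq (hB : IsBregmanGenerator B) (hω : IsOpen ω)
    (hsm : ContDiffOn ℝ 3 (fun t => f t x) ω) (hpos : ∀ t ∈ ω, 0 < f t x) (hθ : θ ∈ ω)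
    (j : Fin p) :
    weightedScore B f θ x j = fderiv ℝ (fun t => deriv B (f t x)) θ (coordVec j) := by
  have hne := (hpos θ hθ).ne'
  rw [(hasFDerivAt_deriv_density hB hω hsm hpos hθ).fderiv, weightedScore, score, partialD,
    ((hasFDerivAt_density hω hsm hθ).log hne).fderiv]
  simp only [smul_apply, smul_eq_mul]
  field_simp

/-- The two terms `B'(f) ∇f` cancel, leaving `f ∇B'(f)`. -/
theorem fderiv_model_integrand (hB : IsBregmanGenerator B) (hω : IsOpen ω)
    (hsm : ContDiffOn ℝ 3 (fun t => f t x) ω) (hpos : ∀ t ∈ ω, 0 < f t x) (hθ : θ ∈ ω)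
    (j : Fin p) :
    fderiv ℝ (fun t => f t x * deriv B (f t x) - B (f t x)) θ (coordVec j) =
      weightedScore B f θ x j * f θ x := by
  have h1 := hasFDerivAt_density hω hsm hθ
  have h2 := hasFDerivAt_deriv_density hB hω hsm hpos hθ
  have h3 : HasFDerivAt (fun t => B (f t x)) (deriv B (f θ x) • fderiv ℝ (fun t => f t x) θ) θ :=
    (hB.hasDerivAt (hpos θ hθ)).comp_hasFDerivAt θ h1
  have h4 : HasFDerivAt (fun t => f t x * deriv B (f t x) - B (f t x)) _ θ := (h1.mul h2).sub h3
  rw [weightedScore_eq hB hω hsm hpos hθ, h2.fderiv, h4.fderiv]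
  simp only [sub_apply, add_apply, smul_apply, smul_eq_mul]
  ring

variable [MeasurableSpace X] {μ : Measure X} {Ω : Set (Param p)}

theorem IsDensityFamily.measurable_density (hf : IsDensityFamily μ Ω f) (hθ : θ ∈ Ω) :
    Measurable (f θ) :=
  hf.measurable.comp (measurable_const.prodMk measurable_id : Measurable fun x : X =>
    ((⟨θ, hθ⟩ : Ω), x))

theorem integral_modelLaw (hf : IsDensityFamily μ Ω f) (hθ : θ ∈ Ω) {H : Type*}
    [NormedAddCommGroup H] [NormedSpace ℝ H] (g : X → H) :
    ∫ x, g x ∂(modelLaw μ f θ) = ∫ x, f θ x • g x ∂μ := by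
  have h := integral_withDensity_eq_integral_smul (μ := μ)
    (f := fun x => (f θ x).toNNReal) (hf.measurable_density hθ).real_toNNReal g
  rw [modelLaw]
  refine h.trans ?_
  congr 1
  funext x
  rw [NNReal.smul_def, Real.coe_toNNReal _ (hf.nonneg θ hθ x)]

theorem integrable_modelLaw_iff (hf : IsDensityFamily μ Ω f) (hθ : θ ∈ Ω) {H : Type*}
    [NormedAddCommGroup H] [NormedSpace ℝ H] {g : X → H} :
    Integrable g (modelLaw μ f θ) ↔ Integrable (fun x => f θ x • g x) μ := by
  have h := integrable_withDensity_iff_integrable_smul (μ := μ)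
    (f := fun x => (f θ x).toNNReal) (hf.measurable_density hθ).real_toNNReal (g := g)
  rw [modelLaw]
  refine h.trans ?_
  have : (fun x => (f θ x).toNNReal • g x) = fun x => f θ x • g x := by
    funext x
    rw [NNReal.smul_def, Real.coe_toNNReal _ (hf.nonneg θ hθ x)]
  rw [this]

theorem ae_modelLaw_iff (hf : IsDensityFamily μ Ω f) (hθ : θ ∈ Ω) {q : X → Prop} :
    (∀ᵐ x ∂(modelLaw μ f θ), q x) ↔ ∀ᵐ x ∂μ, 0 < f θ x → q x := by
  rw [modelLaw, ae_withDensity_iff (hf.measurable_density hθ).ennreal_ofReal]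
  refine eventually_congr (Eventually.of_forall fun x => ?_)
  rw [ne_eq, ENNReal.ofReal_eq_zero, not_le]

theorem eqOn_zero_of_not_pos (hf : IsDensityFamily μ Ω f) (hωΩ : ω ⊆ Ω) (hθ₀ : θ₀ ∈ Ω)
    (hx : ¬ 0 < f θ₀ x) {t : Param p} (ht : t ∈ ω) : f t x = 0 := by
  have h : ¬ 0 < f t x := fun h => hx ((hf.commonSupport t (hωΩ ht) θ₀ hθ₀ x).1 h)
  exact le_antisymm (not_lt.1 h) (hf.nonneg t (hωΩ ht) x)

theorem pos_of_pos (hf : IsDensityFamily μ Ω f) (hωΩ : ω ⊆ Ω) (hθ₀ : θ₀ ∈ Ω)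
    (hx : 0 < f θ₀ x) {t : Param p} (ht : t ∈ ω) : 0 < f t x :=
  (hf.commonSupport θ₀ hθ₀ t (hωΩ ht) x).1 hx

/-- The gradient of the model term is the mean weighted score. -/
theorem fderiv_integral_model (hf : IsDensityFamily μ Ω f) (hB : IsBregmanGenerator B)
    (hω : IsOpen ω) (hωΩ : ω ⊆ Ω) (hθ₀ : θ₀ ∈ ω) (hreg : EstimationRegularity μ B f ω θ₀)
    (hθ : θ ∈ ω) (j : Fin p) :
    fderiv ℝ (fun t => ∫ y, (f t y * deriv B (f t y) - B (f t y)) ∂μ) θ (coordVec j) =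
      ∫ y, weightedScore B f θ y j * f θ y ∂μ := by
  rw [hreg.diff_model.fderiv_apply hω (by norm_num) hθ]
  refine integral_congr_ae ?_
  filter_upwards [hreg.smooth] with x hx
  by_cases hpos : 0 < f θ₀ x
  · exact fderiv_model_integrand hB hω (hx hpos) (fun t ht => pos_of_pos hf hωΩ (hωΩ hθ₀) hpos ht)
      hθ j
  -- Off the common support the integrand is constant in the parameter, whatever `B` does at `0`.
  · have hzero : ∀ t ∈ ω, f t x = 0 :=
      fun t ht => eqOn_zero_of_not_pos hf hωΩ (hωΩ hθ₀) hpos ht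
    have hev : (fun t => f t x * deriv B (f t x) - B (f t x)) =ᶠ[𝓝 θ]
        fun _ => 0 * deriv B 0 - B 0 := by
      filter_upwards [hω.mem_nhds hθ] with t ht
      rw [hzero t ht]
    rw [hev.fderiv_eq, hzero θ hθ]
    simp

/-- The regularity condition concerns `B'(f_θ) f_{θ₀}` under `μ`. The factor `f_{θ₀}` is free of
`θ`, so it leaves the derivatives and becomes the density of the law. -/
theorem integrable_fderiv_fderiv_deriv_density (hf : IsDensityFamily μ Ω f) (hωΩ : ω ⊆ Ω)
    (hθ₀ : θ₀ ∈ ω) (hreg : EstimationRegularity μ B f ω θ₀) (u v : Param p) :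
    Integrable (fun x => fderiv ℝ (fderiv ℝ fun t => deriv B (f t x)) θ₀ u v)
      (modelLaw μ f θ₀) := by
  rw [integrable_modelLaw_iff hf (hωΩ hθ₀)]
  have h := hreg.diff_cross.integrable_fderiv_fderiv (by norm_num) hθ₀ u v
  refine h.congr (Eventually.of_forall fun x => ?_)
  have h1 : (fun t => deriv B (f t x) * f θ₀ x) = f θ₀ x • fun t => deriv B (f t x) := by
    funext t
    simp [mul_comm]
  have h2 : fderiv ℝ (f θ₀ x • fun t => deriv B (f t x)) =
      f θ₀ x • fderiv ℝ fun t => deriv B (f t x) := fderiv_const_smul_field (f θ₀ x)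
  have h3 := fderiv_const_smul_field (𝕜 := ℝ) (F := Param p →L[ℝ] ℝ) (R := ℝ)
    (f := fderiv ℝ fun t => deriv B (f t x)) (f θ₀ x)
  dsimp only
  rw [h1, h2, h3]
  simp

end Density

/-! ### The gradient of the objective as a regular score -/

section Score

variable {p : ℕ} {X : Type*} [MeasurableSpace X] {μ : Measure X} {Ω ω : Set (Param p)}
  {f : Param p → X → ℝ} {B : ℝ → ℝ}
  {θ₀ θ : Param p} {x : X}

/-- The part of the objective function that does not depend on the observation. -/
noncomputable def modelTerm (μ : Measure X) (B : ℝ → ℝ) (f : Param p → X → ℝ) (θ : Param p) : ℝ :=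
  ∫ y, (f θ y * deriv B (f θ y) - B (f θ y)) ∂μ

theorem objective_eq (x : X) :
    (fun t => objective μ B f t x) = modelTerm μ B f - fun t => deriv B (f t x) := rfl

theorem contDiffOn_modelTerm (hω : IsOpen ω) (hreg : EstimationRegularity μ B f ω θ₀) :
    ContDiffOn ℝ 2 (modelTerm μ B f) ω :=
  DiffUnderIntegral.contDiffOn (N := 2) hreg.diff_model hω

theorem contDiffOn_objective (hB : IsBregmanGenerator B) (hω : IsOpen ω)
    (hreg : EstimationRegularity μ B f ω θ₀) (hsm : ContDiffOn ℝ 3 (fun t => f t x) ω)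
    (hpos : ∀ t ∈ ω, 0 < f t x) : ContDiffOn ℝ 2 (fun t => objective μ B f t x) ω :=
  (contDiffOn_modelTerm hω hreg).sub
    ((contDiffOn_deriv_density hB hsm hpos).of_le (by norm_num))

theorem iteratedFDeriv_two_objective (hB : IsBregmanGenerator B) (hω : IsOpen ω)
    (hreg : EstimationRegularity μ B f ω θ₀) (hsm : ContDiffOn ℝ 3 (fun t => f t x) ω)
    (hpos : ∀ t ∈ ω, 0 < f t x) (hθ : θ ∈ ω) :
    iteratedFDeriv ℝ 2 (fun t => objective μ B f t x) θ =
      iteratedFDeriv ℝ 2 (modelTerm μ B f) θ -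
        iteratedFDeriv ℝ 2 (fun t => deriv B (f t x)) θ := by
  rw [objective_eq]
  exact iteratedFDeriv_sub_apply ((contDiffOn_modelTerm hω hreg).contDiffAt (hω.mem_nhds hθ))
    (((contDiffOn_deriv_density hB hsm hpos).contDiffAt (hω.mem_nhds hθ)).of_le (by norm_num))

/-- Replaces `C³` regularity: the third derivative of the model term exists but need not be
continuous. -/
theorem differentiableOn_iteratedFDeriv_objective (hB : IsBregmanGenerator B) (hω : IsOpen ω)
    (hreg : EstimationRegularity μ B f ω θ₀) (hsm : ContDiffOn ℝ 3 (fun t => f t x) ω)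
    (hpos : ∀ t ∈ ω, 0 < f t x) :
    DifferentiableOn ℝ (iteratedFDeriv ℝ 2 fun t => objective μ B f t x) ω := by
  have h1 : DifferentiableOn ℝ (iteratedFDeriv ℝ 2 (modelTerm μ B f)) ω :=
    hreg.diff_model.differentiableOn_iteratedFDeriv hω (by norm_num)
  have h2 : DifferentiableOn ℝ (iteratedFDeriv ℝ 2 fun t => deriv B (f t x)) ω := by
    intro t ht
    have h3 := (contDiffOn_deriv_density hB hsm hpos).contDiffAt (hω.mem_nhds ht)
    exact (h3.differentiableAt_iteratedFDeriv (by norm_num)).differentiableWithinAt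
  exact (h1.sub h2).congr fun t ht => iteratedFDeriv_two_objective hB hω hreg hsm hpos ht

theorem fderiv_objective_apply (hf : IsDensityFamily μ Ω f) (hB : IsBregmanGenerator B)
    (hω : IsOpen ω) (hωΩ : ω ⊆ Ω) (hθ₀ : θ₀ ∈ ω)
    (hreg : EstimationRegularity μ B f ω θ₀) (hsm : ContDiffOn ℝ 3 (fun t => f t x) ω)
    (hpos : ∀ t ∈ ω, 0 < f t x) (hθ : θ ∈ ω) (j : Fin p) :
    fderiv ℝ (fun t => objective μ B f t x) θ (coordVec j) =
      (∫ y, weightedScore B f θ y j * f θ y ∂μ) - weightedScore B f θ x j := by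
  have h1 : DifferentiableAt ℝ (modelTerm μ B f) θ :=
    ((contDiffOn_modelTerm hω hreg).contDiffAt (hω.mem_nhds hθ)).differentiableAt (by norm_num)
  have h2 := (hasFDerivAt_deriv_density hB hω hsm hpos hθ).differentiableAt
  rw [objective_eq, fderiv_sub h1 h2, sub_apply, weightedScore_eq hB hω hsm hpos hθ]
  congr 1
  exact fderiv_integral_model hf hB hω hωΩ hθ₀ hreg hθ j

/-- A directional derivative with respect to the parameter is measurable in the observation. -/
theorem measurable_indicator_fderiv_apply {u : Param p → X → ℝ} (hω : IsOpen ω)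
    (hu : ∀ t ∈ ω, Measurable (u t)) {A : Set X} (hA : MeasurableSet A)
    (hd : ∀ x ∈ A, DifferentiableAt ℝ (fun t => u t x) θ) (hθ : θ ∈ ω) (v : Param p) :
    Measurable (A.indicator fun x => fderiv ℝ (fun t => u t x) θ v) := by
  classical
  set τ : ℕ → ℝ := fun n => 1 / ((n : ℝ) + 1) with hτ
  have hτ0 : Tendsto τ atTop (𝓝 0) := tendsto_one_div_add_atTop_nhds_zero_nat
  have hτpos : ∀ n, 0 < τ n := fun n => by rw [hτ]; positivity
  have hlim : Tendsto (fun n => θ + τ n • v) atTop (𝓝 θ) := by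
    have : Tendsto (fun n => θ + τ n • v) atTop (𝓝 (θ + (0 : ℝ) • v)) :=
      tendsto_const_nhds.add (hτ0.smul tendsto_const_nhds)
    simpa using this
  -- The derivative is a limit of difference quotients, set to `0` while the shifted point lies
  -- outside `ω`, where measurability of `u` is not known.
  refine measurable_of_tendsto_metrizable' atTop (f := fun n => A.indicator fun x =>
    if θ + τ n • v ∈ ω then (τ n)⁻¹ • (u (θ + τ n • v) x - u θ x) else 0) (fun n => ?_) ?_
  · refine Measurable.indicator ?_ hA
    by_cases h : θ + τ n • v ∈ ω
    · simp only [h, if_true]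
      exact ((hu _ h).sub (hu θ hθ)).const_smul (τ n)⁻¹
    · simp only [h, if_false]
      exact measurable_const
  · rw [tendsto_pi_nhds]
    intro x
    by_cases hx : x ∈ A
    · simp only [Set.indicator_of_mem hx]
      have h1 := (hd x hx).hasFDerivAt.hasLineDerivAt v
      rw [hasLineDerivAt_iff_tendsto_slope_zero] at h1
      have h2 : Tendsto τ atTop (𝓝[≠] 0) :=
        tendsto_nhdsWithin_iff.2 ⟨hτ0, Eventually.of_forall fun n => (hτpos n).ne'⟩
      refine (h1.comp h2).congr' ?_
      filter_upwards [hlim.eventually (hω.mem_nhds hθ)] with n hn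
      have hn' : θ + τ n • v ∈ ω := hn
      simp [hn']
    · simp only [Set.indicator_of_notMem hx]
      exact tendsto_const_nhds

theorem integrable_sum_smul_const {ι F : Type*} [Fintype ι] [NormedAddCommGroup F]
    [NormedSpace ℝ F] {G : Measure X} {a : ι → X → ℝ} (ha : ∀ i, Integrable (a i) G) (c : ι → F) :
    Integrable (fun x => ∑ i, a i x • c i) G :=
  integrable_finsetSum _ fun i _ => (ha i).smul_const (c i)

theorem toVec_comp_apply (T : Param p →L[ℝ] Param p →L[ℝ] ℝ) (v : Param p) (l : Fin p) :
    (toVec ∘L T) v l = ∑ k, T (coordVec k) (coordVec l) * v k := by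
  rw [ContinuousLinearMap.comp_apply, toVec_apply]
  conv_lhs => rw [← sum_smul_coordVec v]
  simp [mul_comm]

theorem integrable_toVec_comp {G : Measure X} {T : X → Param p →L[ℝ] Param p →L[ℝ] ℝ}
    (hT : ∀ k l, Integrable (fun x => T x (coordVec k) (coordVec l)) G) :
    Integrable (fun x => toVec ∘L T x) G := by
  have h := integrable_sum_smul_const (F := Param p →L[ℝ] Param p)
    (a := fun (i : Fin p × Fin p) x => T x (coordVec i.1) (coordVec i.2))
    (fun i => hT i.1 i.2)
    fun i => (EuclideanSpace.proj i.1 : Param p →L[ℝ] ℝ).smulRight (coordVec i.2)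
  refine h.congr (Eventually.of_forall fun x => ?_)
  ext v j
  dsimp only
  rw [toVec_comp_apply, sum_apply, Fintype.sum_prod_type]
  simp [coordVec, Pi.single_apply]

/-- The gradient of the objective function, set to zero on a null set and extended radially, is a
regular score, with mean derivative `J` and covariance matrix `K`. -/
theorem exists_regularScore (hf : IsDensityFamily μ Ω f) (hB : IsBregmanGenerator B)
    (hω : IsOpen ω) (hωΩ : ω ⊆ Ω) (hθ₀ : θ₀ ∈ ω) (hreg : EstimationRegularity μ B f ω θ₀)
    {R : ℝ} (hR : 0 < R) (hRω : Metric.closedBall θ₀ R ⊆ ω) :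
    ∃ ψ D L, RegularScore (modelLaw μ f θ₀) ψ θ₀ R D L ∧
      (∀ v, ((∫ x, D x ∂(modelLaw μ f θ₀)) v).ofLp =
        (matJ μ B f (modelLaw μ f θ₀) θ₀).mulVec v.ofLp) ∧
      (∀ᵐ x ∂(modelLaw μ f θ₀), ∀ θ ∈ Metric.closedBall θ₀ R, ∀ j,
        ψ θ x j = (∫ y, weightedScore B f θ y j * f θ y ∂μ) - weightedScore B f θ x j) ∧
      (∀ j, MemLp (fun x => ψ θ₀ x j) 2 (modelLaw μ f θ₀)) ∧
      ∀ j k, matK B f (modelLaw μ f θ₀) θ₀ j k =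
        ∫ x, ψ θ₀ x j * ψ θ₀ x k ∂(modelLaw μ f θ₀) := by
  have hθΩ := hωΩ hθ₀
  have hG : IsProbabilityMeasure (modelLaw μ f θ₀) := hf.isProbabilityMeasure θ₀ hθΩ
  obtain ⟨T, hTint, hT⟩ := hreg.third_bound
  set G := modelLaw μ f θ₀ with hGdef
  have hpos_ae : ∀ᵐ x ∂G, 0 < f θ₀ x := (ae_modelLaw_iff hf hθΩ).2 (ae_of_all _ fun x h => h)
  have hsm_ae : ∀ᵐ x ∂G, ContDiffOn ℝ 3 (fun θ => f θ x) ω :=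
    (ae_modelLaw_iff hf hθΩ).2 hreg.smooth
  -- A regular score must be continuous and approximable for every `x`, so the almost sure
  -- conditions are made pointwise on a measurable set `A` of full measure.
  obtain ⟨N, hNsub, hNm, hN0⟩ := exists_measurable_superset_of_null
    (ae_iff.1 (hpos_ae.and (hsm_ae.and hT)))
  set A := Nᶜ with hAdef
  have hAm : MeasurableSet A := hNm.compl
  have hA_ae : ∀ᵐ x ∂G, x ∈ A := by
    rw [ae_iff]
    simpa [hAdef] using hN0
  have hAgood : ∀ x ∈ A, 0 < f θ₀ x ∧ ContDiffOn ℝ 3 (fun θ => f θ x) ω ∧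
      ∀ θ ∈ ω, ∀ j k l, |iteratedFDeriv ℝ 3 (fun t => objective μ B f t x) θ
        ![coordVec j, coordVec k, coordVec l]| ≤ T j k l x := by
    intro x hx
    by_contra hcon
    exact hx (hNsub hcon)
  have hsm : ∀ x ∈ A, ContDiffOn ℝ 3 (fun θ => f θ x) ω := fun x hx => (hAgood x hx).2.1
  have hpos : ∀ x ∈ A, ∀ t ∈ ω, 0 < f t x :=
    fun x hx t ht => pos_of_pos hf hωΩ hθΩ (hAgood x hx).1 ht
  have hVcd : ∀ x ∈ A, ContDiffOn ℝ 2 (fun t => objective μ B f t x) ω := fun x hx =>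
    contDiffOn_objective hB hω hreg (hsm x hx) (hpos x hx)
  have hθ₀R : θ₀ ∈ Metric.closedBall θ₀ R := Metric.mem_closedBall_self hR.le
  -- The retraction makes the score continuous on the whole parameter space, although the objective
  -- is regular only on `ω`.
  set ψ : Param p → X → Param p := fun θ => A.indicator fun x =>
    toVec (fderiv ℝ (fun t => objective μ B f t x) (ballRetract θ₀ R θ)) with hψ
  set T' : X → Param p →L[ℝ] Param p →L[ℝ] ℝ := A.indicator fun x =>
    fderiv ℝ (fderiv ℝ fun t => objective μ B f t x) θ₀ with hT'
  set D : X → Param p →L[ℝ] Param p := fun x => toVec ∘L T' x with hD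
  set L : X → ℝ := A.indicator fun x => ‖(toVec : (Param p →L[ℝ] ℝ) →L[ℝ] Param p)‖ *
    ∑ r : Fin 3 → Fin p, T (r 0) (r 1) (r 2) x with hL
  have hψ_apply : ∀ x ∈ A, ∀ θ ∈ Metric.closedBall θ₀ R, ∀ j,
      ψ θ x j = (∫ y, weightedScore B f θ y j * f θ y ∂μ) - weightedScore B f θ x j := by
    intro x hx θ hθ j
    simp only [hψ, Set.indicator_of_mem hx, ballRetract_eq _ hR hθ, toVec_apply]
    exact fderiv_objective_apply hf hB hω hωΩ hθ₀ hreg (hsm x hx) (hpos x hx) (hRω hθ) j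
  have hψ_ae : ∀ j, (fun x => ψ θ₀ x j) =ᵐ[G]
      fun x => (∫ y, weightedScore B f θ₀ y j * f θ₀ y ∂μ) - weightedScore B f θ₀ x j := by
    intro j
    filter_upwards [hA_ae] with x hx
    exact hψ_apply x hx θ₀ hθ₀R j
  have hws_int : ∀ j, Integrable (fun x => weightedScore B f θ₀ x j) G :=
    fun j => (hreg.memLp_score j).integrable (by norm_num)
  -- At the true parameter the weight `f_{θ₀}` is the density of the observations; this centres the
  -- score.
  have hmean : ∀ j, ∫ y, weightedScore B f θ₀ y j * f θ₀ y ∂μ =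
      ∫ x, weightedScore B f θ₀ x j ∂G := by
    intro j
    rw [hGdef, integral_modelLaw hf hθΩ]
    simp_rw [smul_eq_mul, mul_comm]
  have hψL2 : ∀ j, MemLp (fun x => ψ θ₀ x j) 2 G := fun j =>
    (memLp_congr_ae (hψ_ae j)).2 ((memLp_const _).sub (hreg.memLp_score j))
  have hψ0 : ∀ j, ∫ x, ψ θ₀ x j ∂G = 0 := by
    intro j
    rw [integral_congr_ae (hψ_ae j), integral_sub (integrable_const _) (hws_int j), hmean]
    simp
  have hψint : Integrable (ψ θ₀) G := by
    have h1 : ψ θ₀ = fun x => ∑ j, ψ θ₀ x j • coordVec j := by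
      funext x; rw [sum_smul_coordVec]
    rw [h1]
    exact integrable_finsetSum _ fun j _ => ((hψL2 j).integrable (by norm_num)).smul_const _
  have hψmean : ∫ x, ψ θ₀ x ∂G = 0 := by
    ext j
    have h1 := (EuclideanSpace.proj j : Param p →L[ℝ] ℝ).integral_comp_comm hψint
    rw [PiLp.zero_apply, ← hψ0 j]
    exact h1.symm
  have hess_int : ∀ u v, Integrable (fun x => T' x u v) G := by
    intro u v
    have h1 : Integrable (fun x => iteratedFDeriv ℝ 2 (modelTerm μ B f) θ₀ ![u, v] -
        fderiv ℝ (fderiv ℝ fun t => deriv B (f t x)) θ₀ u v) G :=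
      (integrable_const _).sub (integrable_fderiv_fderiv_deriv_density hf hωΩ hθ₀ hreg u v)
    refine h1.congr ?_
    filter_upwards [hA_ae] with x hx
    rw [hT', Set.indicator_of_mem hx]
    have h2 := DFunLike.congr_fun
      (iteratedFDeriv_two_objective hB hω hreg (hsm x hx) (hpos x hx) hθ₀) ![u, v]
    simp only [iteratedFDeriv_two_apply, sub_apply,
      Matrix.cons_val_zero, Matrix.cons_val_one, Matrix.cons_val_fin_one] at h2 ⊢
    exact h2.symm
  have hDint : Integrable D G := integrable_toVec_comp fun k l => hess_int _ _
  have hLint : Integrable L G :=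
    ((integrable_finsetSum _ fun r _ => hTint _ _ _).const_mul _).indicator hAm
  refine ⟨ψ, D, L, ⟨hR, ?_, ?_, ?_, hDint, hLint, hψint, hψmean⟩, ?_, ?_, hψL2, ?_⟩
  · intro x
    by_cases hx : x ∈ A
    · simp only [hψ, Set.indicator_of_mem hx]
      refine toVec.continuous.comp ?_
      exact ((hVcd x hx).continuousOn_fderiv_of_isOpen hω (by norm_num)).comp_continuous
        (continuous_ballRetract θ₀ hR) fun θ => hRω (ballRetract_mem θ₀ hR θ)
    · simp only [hψ, Set.indicator_of_notMem hx]
      exact continuous_const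
  · intro θ
    have hcoord : ∀ j, Measurable fun x => ψ θ x j := by
      intro j
      have hmem := hRω (ballRetract_mem θ₀ hR θ)
      have h1 := measurable_indicator_fderiv_apply (u := fun t x => objective μ B f t x) hω
        (fun t ht => measurable_const.sub
          ((measurable_deriv B).comp (hf.measurable_density (hωΩ ht)))) hAm
        (fun x hx => ((hVcd x hx).contDiffAt (hω.mem_nhds hmem)).differentiableAt (by norm_num))
        hmem (coordVec j)
      convert h1 using 1
      funext x
      by_cases hx : x ∈ A
      · simp only [hψ, Set.indicator_of_mem hx, toVec_apply]
      · simp only [hψ, Set.indicator_of_notMem hx, PiLp.zero_apply]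
    have h2 : ψ θ = fun x => ∑ j, ψ θ x j • coordVec j := by
      funext x; rw [sum_smul_coordVec]
    rw [h2]
    exact Finset.measurable_sum _ fun j _ => (hcoord j).smul_const _
  · intro x ρ hρ θ hθ θ' hθ'
    by_cases hx : x ∈ A
    · have hθR := Metric.closedBall_subset_closedBall hρ hθ
      have hθR' := Metric.closedBall_subset_closedBall hρ hθ'
      simp only [hψ, hD, hT', hL, Set.indicator_of_mem hx, ballRetract_eq _ hR hθR,
        ballRetract_eq _ hR hθR', ContinuousLinearMap.comp_apply]
      rw [← map_sub toVec, ← map_sub toVec]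
      have hbound : ∀ t ∈ ω, ‖iteratedFDeriv ℝ 3 (fun t => objective μ B f t x) t‖ ≤
          ∑ r : Fin 3 → Fin p, T (r 0) (r 1) (r 2) x := by
        intro t ht
        refine (norm_le_sum_coordVec _).trans (Finset.sum_le_sum fun r _ => ?_)
        have h1 : (fun i => coordVec (r i) : Fin 3 → Param p) =
            ![coordVec (r 0), coordVec (r 1), coordVec (r 2)] := by
          funext i; fin_cases i <;> rfl
        rw [h1]
        exact (hAgood x hx).2.2 t ht _ _ _
      have h2 := linApprox_fderiv hω (hVcd x hx)
        (differentiableOn_iteratedFDeriv_objective hB hω hreg (hsm x hx) (hpos x hx)) hbound hRω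
        hρ θ hθ θ' hθ'
      refine (toVec.le_opNorm _).trans ?_
      rw [mul_assoc, mul_assoc]
      gcongr
      rw [← mul_assoc]
      exact h2
    · simp [hψ, hD, hT', hL, hx]
  · intro v
    ext l
    have h1 : ((∫ x, D x ∂G) v) l = ∫ x, (D x v) l ∂G := by
      rw [ContinuousLinearMap.integral_apply hDint]
      exact ((EuclideanSpace.proj l : Param p →L[ℝ] ℝ).integral_comp_comm
        (hDint.apply_continuousLinearMap v)).symm
    have h2 : ∀ x, (D x v) l = ∑ k, T' x (coordVec k) (coordVec l) * v k :=
      fun x => toVec_comp_apply _ _ _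
    have h3 : ∀ k, ∫ x, T' x (coordVec k) (coordVec l) ∂G = matJ μ B f G θ₀ l k := by
      intro k
      -- The Hessian arrives with its arguments in the opposite order; the symmetry of `J` is part
      -- of its positive definiteness.
      have hsymm : matJ μ B f G θ₀ l k = matJ μ B f G θ₀ k l := by
        have := hreg.posDef.isHermitian.apply l k
        rw [star_trivial] at this
        exact this.symm
      rw [hsymm, matJ, Matrix.of_apply]
      refine integral_congr_ae ?_
      filter_upwards [hA_ae] with x hx
      rw [hT', Set.indicator_of_mem hx, iteratedFDeriv_two_apply]
      rfl
    rw [h1]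
    simp_rw [h2]
    rw [integral_finsetSum _ fun k _ => (hess_int _ _).mul_const _]
    simp_rw [integral_mul_const, h3]
    rfl
  · filter_upwards [hA_ae] with x hx
    exact hψ_apply x hx
  · intro j k
    have h1 : (fun x => ψ θ₀ x j * ψ θ₀ x k) =ᵐ[G] fun x =>
        (weightedScore B f θ₀ x j - ∫ x, weightedScore B f θ₀ x j ∂G) *
          (weightedScore B f θ₀ x k - ∫ x, weightedScore B f θ₀ x k ∂G) := by
      filter_upwards [hψ_ae j, hψ_ae k] with x hj hk
      rw [hj, hk, hmean, hmean]
      ring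
    rw [integral_congr_ae h1]
    exact (covariance_eq_sub (hreg.memLp_score j) (hreg.memLp_score k)).symm

end Score

/-! ### Regularity of the restrictions -/

section Restriction

variable {p r : ℕ} {Ω ω : Set (Param p)} {m : Param p → EuclideanSpace ℝ (Fin r)} {θ₀ θ : Param p}

theorem norm_coordVec (j : Fin p) : ‖(coordVec j : Param p)‖ = 1 := by
  simp [coordVec]

/-- A function with bounded partial derivatives changes by at most the bound along a coordinate
segment. -/
theorem abs_sub_le_of_lineDeriv_bound {g : Param p → ℝ} {C : ℝ} {q : Param p} {k : Fin p} {c : ℝ}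
    (hg : ∀ τ ∈ Set.uIcc 0 c, LineDifferentiableAt ℝ g (q + τ • coordVec k) (coordVec k) ∧
      |lineDeriv ℝ g (q + τ • coordVec k) (coordVec k)| ≤ C) :
    |g (q + c • coordVec k) - g q| ≤ C * |c| := by
  have hder : ∀ τ ∈ Set.uIcc 0 c, HasDerivWithinAt (fun s : ℝ => g (q + s • coordVec k))
      (lineDeriv ℝ g (q + τ • coordVec k) (coordVec k)) (Set.uIcc 0 c) τ := by
    intro τ hτ
    have h1 : HasDerivAt (fun t : ℝ => g (q + τ • coordVec k + t • coordVec k))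
        (lineDeriv ℝ g (q + τ • coordVec k) (coordVec k)) (0 : ℝ) := (hg τ hτ).1.hasLineDerivAt
    have h2 := HasDerivAt.comp_sub_const (a := τ) (x := τ)
      (f := fun t : ℝ => g (q + τ • coordVec k + t • coordVec k))
      (f' := lineDeriv ℝ g (q + τ • coordVec k) (coordVec k)) (by rwa [sub_self])
    have h3 : (fun s : ℝ => g (q + τ • coordVec k + (s - τ) • coordVec k)) =
        fun s : ℝ => g (q + s • coordVec k) := by
      funext s
      congr 1
      rw [sub_smul]
      abel
    rw [h3] at h2
    exact h2.hasDerivWithinAt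
  have h4 := Convex.norm_image_sub_le_of_norm_hasDerivWithin_le hder
    (fun τ hτ => by rw [Real.norm_eq_abs]; exact (hg τ hτ).2) (convex_uIcc 0 c)
    Set.left_mem_uIcc Set.right_mem_uIcc
  simpa using h4

/-- A function with partial derivatives bounded on a ball is Lipschitz on a smaller ball. -/
theorem abs_sub_le_of_partials_bound {g : Param p → ℝ} {C : ℝ} {δ : ℝ} (hC : 0 ≤ C)
    (hg : ∀ t ∈ Metric.closedBall θ₀ ((2 * p + 1) * δ), ∀ k,
      LineDifferentiableAt ℝ g t (coordVec k) ∧ |lineDeriv ℝ g t (coordVec k)| ≤ C)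
    {θ θ' : Param p} (hθ : θ ∈ Metric.closedBall θ₀ δ) (hθ' : θ' ∈ Metric.closedBall θ₀ δ) :
    |g θ' - g θ| ≤ C * p * ‖θ' - θ‖ := by
  set c : Fin p → ℝ := fun k => (θ' - θ) k with hc
  have hcn : ∀ k, |c k| ≤ ‖θ' - θ‖ := fun k => PiLp.norm_apply_le (θ' - θ) k
  have hdist : ‖θ' - θ‖ ≤ 2 * δ := by
    have := dist_triangle_right θ' θ θ₀
    rw [dist_eq_norm] at this
    rw [Metric.mem_closedBall] at hθ hθ'
    linarith
  -- Only partial derivatives are available, so `θ` is moved to `θ'` one coordinate at a time. Such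
  -- a path may leave the ball of radius `δ`, but `p` moves of length at most `2 δ` keep it within
  -- `(2 p + 1) δ`.
  have hmem : ∀ b : Fin p → ℝ, (∀ k, |b k| ≤ ‖θ' - θ‖) →
      θ + ∑ k, b k • coordVec k ∈ Metric.closedBall θ₀ ((2 * p + 1) * δ) := by
    intro b hb
    have h1 : ‖∑ k, b k • (coordVec k : Param p)‖ ≤ p * (2 * δ) := by
      refine (norm_sum_le _ _).trans ?_
      calc ∑ k, ‖b k • (coordVec k : Param p)‖ ≤ ∑ _k : Fin p, 2 * δ := by
            refine Finset.sum_le_sum fun k _ => ?_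
            rw [norm_smul, norm_coordVec, mul_one]
            exact (hb k).trans hdist
        _ = p * (2 * δ) := by simp
    rw [mem_closedBall_iff_norm] at hθ ⊢
    calc _ = ‖(θ - θ₀) + ∑ k, b k • (coordVec k : Param p)‖ := by congr 1; abel
      _ ≤ δ + p * (2 * δ) := (norm_add_le _ _).trans (add_le_add hθ h1)
      _ = _ := by ring
  have hind : ∀ s : Finset (Fin p),
      |g (θ + ∑ k ∈ s, c k • coordVec k) - g θ| ≤ ∑ k ∈ s, C * |c k| := by
    intro s
    induction s using Finset.induction_on with
    | empty => simp
    | insert k s hk ih =>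
      rw [Finset.sum_insert hk, Finset.sum_insert hk]
      have h2 : θ + (c k • coordVec k + ∑ k ∈ s, c k • coordVec k) =
          (θ + ∑ k ∈ s, c k • coordVec k) + c k • coordVec k := by abel
      rw [h2]
      have h3 := abs_sub_le_of_lineDeriv_bound (g := g) (C := C)
        (q := θ + ∑ k ∈ s, c k • coordVec k) (k := k) (c := c k) (fun τ hτ => by
          have hτc : |τ| ≤ |c k| := by
            have := Set.abs_sub_left_of_mem_uIcc hτ
            simpa using this
          have h4 : θ + ∑ k ∈ s, c k • coordVec k + τ • coordVec k =
              θ + ∑ l, (if l = k then τ else if l ∈ s then c l else 0) • coordVec l := by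
            rw [add_assoc]
            congr 1
            have h5 : ∀ l, (if l = k then τ else if l ∈ s then c l else 0) •
                (coordVec l : Param p) = (if l ∈ s then c l • coordVec l else 0) +
                  if l = k then τ • coordVec k else 0 := by
              intro l
              by_cases hl : l = k
              · subst hl; simp [hk]
              · by_cases hls : l ∈ s <;> simp [hl, hls]
            simp_rw [h5]
            rw [Finset.sum_add_distrib]
            simp
          rw [h4]
          refine hg _ (hmem _ fun l => ?_) k
          split_ifs
          · exact hτc.trans (hcn k)
          · exact hcn l
          · simp)
      refine (abs_sub_le _ (g (θ + ∑ k ∈ s, c k • coordVec k)) _).trans ?_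
      exact add_le_add h3 ih
  have h6 := hind Finset.univ
  have h7 : θ + ∑ k, c k • coordVec k = θ' := by
    rw [hc, sum_smul_coordVec]; abel
  rw [h7] at h6
  refine h6.trans ?_
  calc ∑ k, C * |c k| ≤ ∑ _k : Fin p, C * ‖θ' - θ‖ :=
        Finset.sum_le_sum fun k _ => by gcongr; exact hcn k
    _ = _ := by simp; ring

theorem matM_apply (hΩ : IsOpen Ω) (hm : IsRestriction Ω m) (hθ : θ ∈ Ω) (j : Fin p) (l : Fin r) :
    matM m θ j l = fderiv ℝ m θ (coordVec j) l := by
  have h1 : HasFDerivAt m (fderiv ℝ m θ) θ :=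
    ((hm.contDiffOn.contDiffAt (hΩ.mem_nhds hθ)).differentiableAt (by norm_num)).hasFDerivAt
  have h2 : HasFDerivAt (fun t => m t l)
      ((EuclideanSpace.proj l : EuclideanSpace ℝ (Fin r) →L[ℝ] ℝ) ∘L fderiv ℝ m θ) θ :=
    (EuclideanSpace.proj l : EuclideanSpace ℝ (Fin r) →L[ℝ] ℝ).hasFDerivAt.comp θ h1
  rw [matM, Matrix.of_apply, partialD, h2.fderiv]
  rfl

/-- `M(θ)` is the transpose of the Jacobian of `m`, hence the adjoint. -/
theorem adjoint_fderiv_apply (hΩ : IsOpen Ω) (hm : IsRestriction Ω m) (hθ : θ ∈ Ω)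
    (η : EuclideanSpace ℝ (Fin r)) :
    ((fderiv ℝ m θ).adjoint η).ofLp = (matM m θ).mulVec η.ofLp := by
  ext j
  have h1 : ((fderiv ℝ m θ).adjoint η) j =
      inner ℝ (coordVec j) ((fderiv ℝ m θ).adjoint η) := by
    simp [coordVec, EuclideanSpace.inner_single_left]
  rw [h1, ContinuousLinearMap.adjoint_inner_right, PiLp.inner_apply, Matrix.mulVec, dotProduct]
  refine Finset.sum_congr rfl fun l _ => ?_
  rw [matM_apply hΩ hm hθ]
  simp [mul_comm]

theorem norm_le_sum_matrix (T : Param p →L[ℝ] EuclideanSpace ℝ (Fin r)) :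
    ‖T‖ ≤ ∑ j, ∑ l, |T (coordVec j) l| := by
  refine ContinuousLinearMap.opNorm_le_bound _
    (Finset.sum_nonneg fun j _ => Finset.sum_nonneg fun l _ => abs_nonneg _) fun v => ?_
  conv_lhs => rw [← sum_smul_coordVec v]
  rw [map_sum, Finset.sum_mul]
  refine (norm_sum_le _ _).trans (Finset.sum_le_sum fun j _ => ?_)
  rw [map_smul, norm_smul, mul_comm]
  have h1 : ‖T (coordVec j)‖ ≤ ∑ l, |T (coordVec j) l| := by
    conv_lhs => rw [← sum_smul_coordVec (T (coordVec j))]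
    refine (norm_sum_le _ _).trans (Finset.sum_le_sum fun l _ => ?_)
    rw [norm_smul, norm_coordVec, mul_one, Real.norm_eq_abs]
  gcongr
  exact PiLp.norm_apply_le v j

/-- A restriction with bounded second partial derivatives is regular at `θ₀`; the maps are composed
with the retraction onto a ball. -/
theorem regularRestriction_of_boundedSecondPartials (hΩ : IsOpen Ω) (hm : IsRestriction Ω m)
    (hnull : m θ₀ = 0) (hωΩ : ω ⊆ Ω) (hm₂ : BoundedSecondPartials ω m) {R : ℝ} (hR : 0 < R)
    (hRω : Metric.closedBall θ₀ R ⊆ ω) :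
    RegularRestriction (fun θ => (fderiv ℝ m (ballRetract θ₀ R θ)).adjoint)
      (fun θ => m (ballRetract θ₀ R θ)) θ₀ := by
  have hθ₀R : θ₀ ∈ Metric.closedBall θ₀ R := Metric.mem_closedBall_self hR.le
  have hθ₀Ω : θ₀ ∈ Ω := hωΩ (hRω hθ₀R)
  have hret : ballRetract θ₀ R θ₀ = θ₀ := ballRetract_eq _ hR hθ₀R
  refine ⟨by simp only [hret, hnull], ?_, ?_, ?_⟩
  · simp only [hret, ContinuousLinearMap.adjoint_adjoint]
    have h1 : HasStrictFDerivAt m (fderiv ℝ m θ₀) θ₀ :=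
      (hm.contDiffOn.contDiffAt (hΩ.mem_nhds hθ₀Ω)).hasStrictFDerivAt (by norm_num)
    refine h1.congr_of_eventuallyEq ?_
    filter_upwards [Metric.closedBall_mem_nhds θ₀ hR] with θ hθ
    rw [ballRetract_eq _ hR hθ]
  · obtain ⟨C, hC⟩ := hm₂
    -- Chosen so that the coordinate paths stay in the ball of radius `R`.
    set δ := R / (2 * p + 1) with hδ
    have hδ0 : 0 < δ := by positivity
    have hδR : (2 * p + 1) * δ = R := by rw [hδ]; field_simp
    have hδle : δ ≤ R := by
      rw [← hδR]
      have : (0 : ℝ) ≤ p := by positivity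
      nlinarith
    -- `C` may be negative if there are no indices, hence `|C|`; the final `1` stands outside the
    -- sums and makes the constant positive.
    refine ⟨∑ _j : Fin p, ∑ _l : Fin r, |C| * p + 1, by positivity, δ, hδ0, fun θ hθ θ' hθ' => ?_⟩
    have hθR := Metric.closedBall_subset_closedBall hδle hθ
    have hθR' := Metric.closedBall_subset_closedBall hδle hθ'
    simp only [ballRetract_eq _ hR hθR, ballRetract_eq _ hR hθR']
    rw [← map_sub, LinearIsometryEquiv.norm_map]
    refine (norm_le_sum_matrix _).trans ?_
    have hkey : ∑ j : Fin p, ∑ l : Fin r, |(fderiv ℝ m θ - fderiv ℝ m θ') (coordVec j) l| ≤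
        ∑ j : Fin p, ∑ l : Fin r, |C| * p * ‖θ - θ'‖ := by
      refine Finset.sum_le_sum fun j _ => Finset.sum_le_sum fun l _ => ?_
      rw [sub_apply, PiLp.sub_apply, ← matM_apply hΩ hm (hωΩ (hRω hθR)),
        ← matM_apply hΩ hm (hωΩ (hRω hθR'))]
      refine abs_sub_le_of_partials_bound (g := fun t => matM m t j l) (abs_nonneg C)
        (fun t ht k => ?_) hθ' hθ
      rw [hδR] at ht
      exact ⟨(hC t (hRω ht) j k l).1, (hC t (hRω ht) j k l).2.trans (le_abs_self C)⟩
    refine hkey.trans ?_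
    simp_rw [← Finset.sum_mul]
    gcongr
    linarith
  · simp only [hret]
    rw [injective_iff_map_eq_zero]
    intro η hη
    have h1 : (matM m θ₀).mulVec η.ofLp = 0 := by
      rw [← adjoint_fderiv_apply hΩ hm hθ₀Ω, hη]
      rfl
    -- The matrix has `r` columns and rank `r`, so rank-nullity leaves a trivial kernel.
    have h2 := (matM m θ₀).mulVecLin.finrank_range_add_finrank_ker
    have h3 : Module.finrank ℝ (matM m θ₀).mulVecLin.range = r := hm.rank_eq θ₀ hθ₀Ω hnull
    rw [h3, Module.finrank_fin_fun] at h2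
    have h4 : (matM m θ₀).mulVecLin.ker = ⊥ := by
      rw [← Submodule.finrank_eq_zero (R := ℝ)]
      omega
    have h5 : η.ofLp ∈ (matM m θ₀).mulVecLin.ker := h1
    rw [h4, Submodule.mem_bot] at h5
    ext l
    exact congrFun h5 l

theorem continuous_adjoint_fderiv_ballRetract (hΩ : IsOpen Ω) (hm : IsRestriction Ω m) {R : ℝ}
    (hR : 0 < R) (hRΩ : Metric.closedBall θ₀ R ⊆ Ω) :
    Continuous fun θ => (fderiv ℝ m (ballRetract θ₀ R θ)).adjoint := by
  refine (ContinuousLinearMap.adjoint (𝕜 := ℝ) (E := Param p)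
    (F := EuclideanSpace ℝ (Fin r))).continuous.comp ?_
  exact (hm.contDiffOn.continuousOn_fderiv_of_isOpen hΩ le_rfl).comp_continuous
    (continuous_ballRetract θ₀ hR) fun θ => hRΩ (ballRetract_mem θ₀ hR θ)

theorem continuous_comp_ballRetract (hm : IsRestriction Ω m) {R : ℝ}
    (hR : 0 < R) (hRΩ : Metric.closedBall θ₀ R ⊆ Ω) :
    Continuous fun θ => m (ballRetract θ₀ R θ) :=
  hm.contDiffOn.continuousOn.comp_continuous (continuous_ballRetract θ₀ hR)
    fun θ => hRΩ (ballRetract_mem θ₀ hR θ)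

end Restriction

/-! ### The Bregman integrand -/

section BregmanIntegrand

variable {p : ℕ} {X : Type*} {B : ℝ → ℝ}

/-- A convex function lies above its tangents; `u = 0` is allowed, as differentiability is needed
only at `v`. -/
theorem IsBregmanGenerator.tangent_le (hB : IsBregmanGenerator B) {u v : ℝ} (hu : 0 ≤ u)
    (hv : 0 < v) : 0 ≤ B u - B v - (u - v) * deriv B v := by
  have hc := hB.strictConvexOn.convexOn
  rcases lt_trichotomy u v with h | h | h
  · have h1 := hc.slope_le_of_hasDerivAt hu hv.le h (hB.hasDerivAt hv)
    rw [slope_def_field, div_le_iff₀ (by linarith)] at h1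
    linarith
  · simp [h]
  · have h1 := hc.le_slope_of_hasDerivAt hv.le hu h (hB.hasDerivAt hv)
    rw [slope_def_field, le_div_iff₀ (by linarith)] at h1
    linarith

theorem bregmanIntegrand_self (g : X → ℝ) (x : X) : bregmanIntegrand B g g x = 0 := by
  simp [bregmanIntegrand]

theorem bregmanDiv_self [MeasurableSpace X] (μ : Measure X) (g : X → ℝ) :
    bregmanDiv μ B g g = 0 := by
  simp [bregmanDiv, bregmanIntegrand_self]

/-- `B` is arbitrary on the negative axis and may fail to be measurable, but densities only take
values in `[0, ∞)`. -/
theorem IsBregmanGenerator.exists_measurable_eqOn (hB : IsBregmanGenerator B) :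
    ∃ B' : ℝ → ℝ, Measurable B' ∧ Set.EqOn B B' (Set.Ici 0) := by
  classical
  refine ⟨(Set.Ioi 0).piecewise B fun _ => B 0,
    hB.contDiffOn.continuousOn.measurable_piecewise continuousOn_const measurableSet_Ioi,
    fun y hy => ?_⟩
  rcases (Set.mem_Ici.1 hy).eq_or_lt with h | h
  · rw [← h, Set.piecewise_eq_of_notMem _ _ _ (by simp)]
  · rw [Set.piecewise_eq_of_mem _ _ _ (Set.mem_Ioi.2 h)]

/-- The second derivative of the Bregman integrand in the first density on the diagonal. -/
theorem fderiv_fderiv_bregmanIntegrand {ω : Set (Param p)} {f : Param p → X → ℝ} {b : Param p}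
    {x : X} (hB : IsBregmanGenerator B) (hω : IsOpen ω)
    (hsm : ContDiffOn ℝ 3 (fun t => f t x) ω) (hpos : ∀ t ∈ ω, 0 < f t x) (hb : b ∈ ω)
    (u v : Param p) :
    fderiv ℝ (fderiv ℝ fun a => bregmanIntegrand B (f a) (f b) x) b u v =
      deriv (deriv B) (f b x) * fderiv ℝ (fun t => f t x) b u * fderiv ℝ (fun t => f t x) b v := by
  -- The scalar factor vanishes at `a = b`, so no second derivative of the density survives there.
  have hev : fderiv ℝ (fun a => bregmanIntegrand B (f a) (f b) x) =ᶠ[𝓝 b]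
      fun a => (deriv B (f a x) - deriv B (f b x)) • fderiv ℝ (fun t => f t x) a := by
    filter_upwards [hω.mem_nhds hb] with a ha
    have h1 := hasFDerivAt_density hω hsm ha
    have h2 : HasFDerivAt (fun t => B (f t x)) (deriv B (f a x) • fderiv ℝ (fun t => f t x) a) a :=
      (hB.hasDerivAt (hpos a ha)).comp_hasFDerivAt a h1
    have h3 : HasFDerivAt (fun a => bregmanIntegrand B (f a) (f b) x) _ a :=
      (h2.sub_const (B (f b x))).sub ((h1.sub_const (f b x)).mul_const (deriv B (f b x)))
    rw [h3.fderiv, sub_smul]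
  have h4 := (hasFDerivAt_deriv_density hB hω hsm hpos hb).sub_const (deriv B (f b x))
  have h5 : HasFDerivAt (fderiv ℝ fun t => f t x) (fderiv ℝ (fderiv ℝ fun t => f t x) b) b := by
    have h6 : ContDiffAt ℝ 2 (fderiv ℝ fun t => f t x) b :=
      (hsm.contDiffAt (hω.mem_nhds hb)).fderiv_right (by norm_num)
    exact (h6.differentiableAt (by norm_num)).hasFDerivAt
  rw [hev.fderiv_eq, (h4.fun_smul h5).fderiv]
  simp

end BregmanIntegrand

/-! ### Second-order expansion from a nearly constant Hessian -/

section SecondOrder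

/-- A second-order expansion of a family of functions with a minimum on the diagonal. -/
theorem abs_two_mul_sub_le_of_fderiv_near {E : Type*} [NormedAddCommGroup E] [NormedSpace ℝ E]
    {F : E → ℝ} {s : Set E} (hs : Convex ℝ s) {H : E →L[ℝ] E →L[ℝ] ℝ}
    (hH : ∀ u v, H u v = H v u) {b : E} (hb : b ∈ s)
    (hF : ∀ a ∈ s, DifferentiableAt ℝ F a) (hF' : ∀ a ∈ s, DifferentiableAt ℝ (fderiv ℝ F) a)
    (h0 : F b = 0) (h1 : fderiv ℝ F b = 0) {c : ℝ}
    (hc : ∀ a ∈ s, ‖fderiv ℝ (fderiv ℝ F) a - H‖ ≤ c) {a : E} (ha : a ∈ s) :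
    |2 * F a - H (a - b) (a - b)| ≤ 2 * c * ‖a - b‖ ^ 2 := by
  have hc0 : 0 ≤ c := (norm_nonneg (fderiv ℝ (fderiv ℝ F) a - H)).trans (hc a ha)
  have hgrad : ∀ t ∈ s, ‖fderiv ℝ F t - H (t - b)‖ ≤ c * ‖t - b‖ := by
    intro t ht
    have h := Convex.norm_image_sub_le_of_norm_hasFDerivWithin_le' (φ := H)
      (fun y hy => (hF' y hy).hasFDerivAt.hasFDerivWithinAt) hc hs hb ht
    rwa [h1, sub_zero] at h
  -- The remainder vanishes at `b` and, by the symmetry of `H`, has derivative `2 (F' - H(· - b))`,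
  -- which `hgrad` bounds along the segment.
  have hd : ∀ t ∈ s, HasFDerivAt (fun t => 2 * F t - H (t - b) (t - b))
      ((2 : ℝ) • (fderiv ℝ F t - H (t - b))) t := by
    intro t ht
    have h2 : HasFDerivAt (fun t => t - b) (ContinuousLinearMap.id ℝ E) t :=
      (hasFDerivAt_id t).sub_const b
    have h3 : HasFDerivAt (fun t => H (t - b)) (H.comp (ContinuousLinearMap.id ℝ E)) t :=
      H.hasFDerivAt.comp t h2
    have h4 := ((hF t ht).hasFDerivAt.const_mul 2).sub (h3.clm_apply h2)
    refine h4.congr_fderiv ?_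
    ext w
    simp
    linear_combination hH w b - hH w t
  have hseg : segment ℝ b a ⊆ s := hs.segment_subset hb ha
  have h5 := Convex.norm_image_sub_le_of_norm_hasFDerivWithin_le (C := 2 * (c * ‖a - b‖))
    (fun t ht => (hd t (hseg ht)).hasFDerivWithinAt) (fun t ht => by
      rw [norm_smul, Real.norm_eq_abs, abs_of_pos two_pos]
      have h6 : ‖t - b‖ ≤ ‖a - b‖ := norm_sub_le_of_mem_segment ht
      have := hgrad t (hseg ht)
      gcongr
      exact this.trans (by gcongr))
    (convex_segment b a) (left_mem_segment ℝ b a) (right_mem_segment ℝ b a)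
  simp only [h0, sub_self, map_zero, mul_zero, sub_zero, Real.norm_eq_abs] at h5
  calc _ ≤ _ := h5
    _ = _ := by ring

end SecondOrder

/-! ### Expansion and measurability of the divergence -/

section Divergence

variable {p : ℕ} {X : Type*} [MeasurableSpace X] {μ : Measure X} {Ω ω : Set (Param p)}
  {f : Param p → X → ℝ} {B : ℝ → ℝ} {θ₀ : Param p}

theorem bregmanIntegrand_nonneg (hf : IsDensityFamily μ Ω f) (hB : IsBregmanGenerator B)
    {a b : Param p} (ha : a ∈ Ω) (hb : b ∈ Ω) (x : X) :
    0 ≤ bregmanIntegrand B (f a) (f b) x := by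
  by_cases hx : 0 < f b x
  · exact hB.tangent_le (hf.nonneg a ha x) hx
  · have h1 : f b x = 0 := le_antisymm (not_lt.1 hx) (hf.nonneg b hb x)
    have h2 : f a x = 0 := eqOn_zero_of_not_pos hf le_rfl hb hx ha
    simp [bregmanIntegrand, h1, h2]

/-- The divergence is nonnegative and zero on the diagonal, a minimum; the gradient need not be
computed. -/
theorem fderiv_bregmanDiv_self (hf : IsDensityFamily μ Ω f) (hB : IsBregmanGenerator B)
    {b : Param p} (hb : b ∈ Ω) : fderiv ℝ (fun a => bregmanDiv μ B (f a) (f b)) b = 0 := by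
  refine IsLocalMin.fderiv_eq_zero ?_
  filter_upwards [hf.isOpen.mem_nhds hb] with a ha
  rw [bregmanDiv_self]
  exact integral_nonneg fun x => bregmanIntegrand_nonneg hf hB ha hb x

/-- The Hessian of the divergence on the diagonal is the matrix `A`. -/
theorem fderiv_fderiv_bregmanDiv_coordVec (hf : IsDensityFamily μ Ω f) (hB : IsBregmanGenerator B)
    (hω : IsOpen ω) (hωΩ : ω ⊆ Ω) (hθ₀ : θ₀ ∈ ω)
    (hsm : ∀ᵐ x ∂μ, 0 < f θ₀ x → ContDiffOn ℝ 3 (fun θ => f θ x) ω)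
    (hdiv : DivergenceRegularity μ B f ω θ₀) (i j : Fin p) :
    fderiv ℝ (fderiv ℝ fun a => bregmanDiv μ B (f a) (f θ₀)) θ₀ (coordVec i) (coordVec j) =
      matA μ B f θ₀ i j := by
  have h := (hdiv.diff θ₀ hθ₀).fderiv_fderiv_apply hω le_rfl hθ₀ (coordVec i) (coordVec j)
  simp only [bregmanDiv]
  rw [h, matA, Matrix.of_apply]
  refine integral_congr_ae ?_
  filter_upwards [hsm] with x hx
  by_cases hpos : 0 < f θ₀ x
  · exact fderiv_fderiv_bregmanIntegrand hB hω (hx hpos)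
      (fun t ht => pos_of_pos hf hωΩ (hωΩ hθ₀) hpos ht) hθ₀ _ _
  · have hzero : ∀ t ∈ ω, f t x = 0 :=
      fun t ht => eqOn_zero_of_not_pos hf hωΩ (hωΩ hθ₀) hpos ht
    have h1 : (fun a => bregmanIntegrand B (f a) (f θ₀) x) =ᶠ[𝓝 θ₀] fun _ => 0 := by
      filter_upwards [hω.mem_nhds hθ₀] with t ht
      simp [bregmanIntegrand, hzero t ht, hzero θ₀ hθ₀]
    have h2 : (fun t => f t x) =ᶠ[𝓝 θ₀] fun _ => 0 := by
      filter_upwards [hω.mem_nhds hθ₀] with t ht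
      exact hzero t ht
    rw [(h1.fderiv).fderiv_eq]
    simp only [partialD, h2.fderiv_eq]
    simp

theorem transpose_matA : (matA μ B f θ₀).transpose = matA μ B f θ₀ := by
  ext i j
  simp only [matA, Matrix.transpose_apply, Matrix.of_apply]
  congr 1
  funext x
  ring

theorem bilin_eq_dotProduct {H : Param p →L[ℝ] Param p →L[ℝ] ℝ} {A : Matrix (Fin p) (Fin p) ℝ}
    (hH : ∀ i j, H (coordVec i) (coordVec j) = A i j) (u v : Param p) :
    H u v = u.ofLp ⬝ᵥ A.mulVec v.ofLp := by
  conv_lhs => rw [← sum_smul_coordVec u, ← sum_smul_coordVec v]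
  simp only [map_sum, map_smul, sum_apply, smul_apply, hH, smul_eq_mul,
    dotProduct, Matrix.mulVec, Finset.mul_sum]
  rw [Finset.sum_comm]
  refine Finset.sum_congr rfl fun i _ => Finset.sum_congr rfl fun j _ => by ring

/-- The second-order expansion of the divergence around the true parameter. -/
theorem bregmanDiv_expansion (hf : IsDensityFamily μ Ω f) (hB : IsBregmanGenerator B)
    (hω : IsOpen ω) (hωΩ : ω ⊆ Ω) (hθ₀ : θ₀ ∈ ω)
    (hsm : ∀ᵐ x ∂μ, 0 < f θ₀ x → ContDiffOn ℝ 3 (fun θ => f θ x) ω)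
    (hdiv : DivergenceRegularity μ B f ω θ₀) {c : ℝ} (hc : 0 < c) :
    ∃ δ > 0, ∀ a ∈ Metric.ball θ₀ δ, ∀ b ∈ Metric.ball θ₀ δ,
      |2 * bregmanDiv μ B (f a) (f b) - (a - b).ofLp ⬝ᵥ (matA μ B f θ₀).mulVec (a - b).ofLp| ≤
        c * ‖a - b‖ ^ 2 := by
  set H := fderiv ℝ (fderiv ℝ fun a => bregmanDiv μ B (f a) (f θ₀)) θ₀ with hHdef
  have hH := bilin_eq_dotProduct (fderiv_fderiv_bregmanDiv_coordVec hf hB hω hωΩ hθ₀ hsm hdiv)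
  rw [← hHdef] at hH
  have hsymm : ∀ u v, H u v = H v u := by
    intro u v
    rw [hH, hH, dotProduct_comm, mulVec_dotProduct_eq, transpose_matA]
  obtain ⟨δ₁, hδ₁, hsub⟩ := Metric.isOpen_iff.1 hω θ₀ hθ₀
  -- Continuity in the pair `(a, b)` makes the radius uniform in the base point `b`, which will
  -- itself be random.
  obtain ⟨δ₂, hδ₂, hcont⟩ := Metric.continuousAt_iff.1 hdiv.continuousAt (c / 2) (by positivity)
  refine ⟨min δ₁ δ₂, lt_min hδ₁ hδ₂, fun a ha b hb => ?_⟩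
  have hmem : ∀ t ∈ Metric.ball θ₀ (min δ₁ δ₂), t ∈ ω := fun t ht =>
    hsub (Metric.ball_subset_ball (min_le_left _ _) ht)
  have hreg := hdiv.diff b (hmem b hb)
  have h2 : ContDiffOn ℝ 1 (fun a => bregmanDiv μ B (f a) (f b)) ω :=
    hreg.contDiffOn hω
  have h3 : DifferentiableOn ℝ (iteratedFDeriv ℝ 1 fun a => bregmanDiv μ B (f a) (f b)) ω :=
    hreg.differentiableOn_iteratedFDeriv hω (by norm_num)
  rw [← hH]
  -- The expansion doubles the Hessian error, hence `c / 2`.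
  have key := abs_two_mul_sub_le_of_fderiv_near (c := c / 2)
    (F := fun a => bregmanDiv μ B (f a) (f b))
    (convex_ball θ₀ (min δ₁ δ₂)) hsymm hb
    (fun t ht => (h2.contDiffAt (hω.mem_nhds (hmem t ht))).differentiableAt (by norm_num))
    (fun t ht => ?_) (bregmanDiv_self μ _) (fderiv_bregmanDiv_self hf hB (hωΩ (hmem b hb)))
    (fun t ht => ?_) ha
  · rwa [mul_div_cancel₀ c two_ne_zero] at key
  · have h4 := h3.differentiableAt (hω.mem_nhds (hmem t ht))
    have h5 : (fderiv ℝ fun a => bregmanDiv μ B (f a) (f b)) =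
        fun t => (continuousMultilinearCurryFin1 ℝ (Param p) ℝ).toContinuousLinearEquiv
          (iteratedFDeriv ℝ 1 (fun a => bregmanDiv μ B (f a) (f b)) t) := by
      funext t
      ext v
      simp [iteratedFDeriv_one_apply]
    rw [h5]
    exact ((continuousMultilinearCurryFin1 ℝ (Param p)
      ℝ).toContinuousLinearEquiv.differentiableAt).comp t h4
  · have h6 : dist (t, b) (θ₀, θ₀) < δ₂ := by
      rw [Prod.dist_eq, max_lt_iff]
      exact ⟨lt_of_lt_of_le ht (min_le_right _ _), lt_of_lt_of_le hb (min_le_right _ _)⟩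
    have h7 := (hcont h6).le
    rw [dist_eq_norm] at h7
    refine ContinuousLinearMap.opNorm_le_bound₂ _ (by positivity) fun u v => ?_
    have h8 := ContinuousMultilinearMap.le_of_opNorm_le h7 ![u, v]
    simpa [iteratedFDeriv_two_apply, Fin.prod_univ_two, mul_assoc] using h8

/-- The test statistic is a measurable function of the sample. -/
theorem measurable_testStat [SigmaFinite μ] (hf : IsDensityFamily μ Ω f)
    (hB : IsBregmanGenerator B) {est est' : (n : ℕ) → (Fin n → X) → Param p} {n : ℕ}
    (hm : Measurable (est n)) (hm' : Measurable (est' n)) (hest : ∀ x, est n x ∈ Ω)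
    (hest' : ∀ x, est' n x ∈ Ω) : Measurable (testStat μ B f est est' n) := by
  -- A measurable substitute for `B` gives joint measurability in the sample and the integration
  -- variable, as needed to integrate out the latter.
  obtain ⟨B', hB', heq⟩ := hB.exists_measurable_eqOn
  have h1 : Measurable fun q : (Fin n → X) × X => f (est n q.1) q.2 :=
    hf.measurable.comp (((hm.comp measurable_fst).subtype_mk (h := fun q => hest q.1)).prodMk
      measurable_snd)
  have h2 : Measurable fun q : (Fin n → X) × X => f (est' n q.1) q.2 :=
    hf.measurable.comp (((hm'.comp measurable_fst).subtype_mk (h := fun q => hest' q.1)).prodMk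
      measurable_snd)
  have h3 : Measurable fun q : (Fin n → X) × X =>
      bregmanIntegrand B (f (est n q.1)) (f (est' n q.1)) q.2 := by
    have h4 : (fun q : (Fin n → X) × X =>
        bregmanIntegrand B (f (est n q.1)) (f (est' n q.1)) q.2) = fun q =>
        B' (f (est n q.1) q.2) - B' (f (est' n q.1) q.2) -
          (f (est n q.1) q.2 - f (est' n q.1) q.2) * deriv B (f (est' n q.1) q.2) := by
      funext q
      rw [bregmanIntegrand, heq (hf.nonneg _ (hest q.1) q.2), heq (hf.nonneg _ (hest' q.1) q.2)]
    rw [h4]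
    exact ((hB'.comp h1).sub (hB'.comp h2)).sub ((h1.sub h2).mul ((measurable_deriv B).comp h2))
  exact (h3.stronglyMeasurable.integral_prod_right').measurable.const_mul _

end Divergence

/-! ### Elimination of the multiplier, perturbed quadratic forms -/

section LinearAlgebra

variable {p r : ℕ}

theorem adjoint_apply_ofLp {T : EuclideanSpace ℝ (Fin r) →L[ℝ] Param p}
    {M : Matrix (Fin p) (Fin r) ℝ} (hT : ∀ η, (T η).ofLp = M.mulVec η.ofLp) (v : Param p) :
    (T.adjoint v).ofLp = M.transpose.mulVec v.ofLp := by
  ext l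
  have h1 : (T.adjoint v) l = inner ℝ (coordVec l) (T.adjoint v) := by
    simp [coordVec, EuclideanSpace.inner_single_left]
  rw [h1, ContinuousLinearMap.adjoint_inner_right, EuclideanSpace.inner_eq_star_dotProduct, hT]
  simp [coordVec, Matrix.mulVec, dotProduct_comm, Matrix.col_apply']

/-- The difference of the unrestricted and the restricted solutions of a linear saddle point
problem. -/
theorem mulVec_eq_sub_of_saddle {J : Matrix (Fin p) (Fin p) ℝ} {M : Matrix (Fin p) (Fin r) ℝ}
    (hJ : IsUnit J.det) (hS : IsUnit (M.transpose * J⁻¹ * M).det) {a₀ a y : Fin p → ℝ}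
    {b : Fin r → ℝ} (h0 : J.mulVec a₀ = y) (h1 : J.mulVec a + M.mulVec b = y)
    (h2 : M.transpose.mulVec a = 0) :
    (J⁻¹ * M * (M.transpose * J⁻¹ * M)⁻¹ * M.transpose * J⁻¹).mulVec y = a₀ - a := by
  have ha₀ : J⁻¹.mulVec y = a₀ := by
    rw [← h0, Matrix.mulVec_mulVec, Matrix.nonsing_inv_mul _ hJ, Matrix.one_mulVec]
  -- Applying `Mᵀ` to this identity determines `b` from `a₀`, since `Mᵀ a = 0` and `Mᵀ J⁻¹ M` is
  -- invertible.
  have hdiff : J⁻¹.mulVec (M.mulVec b) = a₀ - a := by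
    have h3 : M.mulVec b = J.mulVec (a₀ - a) := by
      rw [Matrix.mulVec_sub, h0, ← h1]
      abel
    rw [h3, Matrix.mulVec_mulVec, Matrix.nonsing_inv_mul _ hJ, Matrix.one_mulVec]
  have h4 : M.transpose.mulVec a₀ = (M.transpose * J⁻¹ * M).mulVec b := by
    rw [← Matrix.mulVec_mulVec, ← Matrix.mulVec_mulVec, hdiff, Matrix.mulVec_sub, h2, sub_zero]
  rw [← Matrix.mulVec_mulVec, ha₀, ← Matrix.mulVec_mulVec, h4, ← Matrix.mulVec_mulVec,
    Matrix.mulVec_mulVec _ _ (M.transpose * J⁻¹ * M), Matrix.nonsing_inv_mul _ hS,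
    Matrix.one_mulVec, ← Matrix.mulVec_mulVec, hdiff]

/-- Congruence by an injective matrix preserves the positive definiteness of `J⁻¹`. -/
theorem isUnit_det_transpose_mul_inv_mul {J : Matrix (Fin p) (Fin p) ℝ}
    {M : Matrix (Fin p) (Fin r) ℝ} (hJ : J.PosDef) (hM : Function.Injective M.mulVec) :
    IsUnit (M.transpose * J⁻¹ * M).det := by
  rw [← Matrix.isUnit_iff_isUnit_det, ← Matrix.conjTranspose_eq_transpose_of_trivial]
  exact (hJ.inv.conjTranspose_mul_mul_same hM).isUnit

theorem transpose_constrained_inverse {J : Matrix (Fin p) (Fin p) ℝ}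
    {M : Matrix (Fin p) (Fin r) ℝ} (hJ : J.transpose = J) :
    (J⁻¹ * M * (M.transpose * J⁻¹ * M)⁻¹ * M.transpose * J⁻¹).transpose =
      J⁻¹ * M * (M.transpose * J⁻¹ * M)⁻¹ * M.transpose * J⁻¹ := by
  simp only [Matrix.transpose_mul, Matrix.transpose_nonsing_inv, hJ, Matrix.transpose_transpose,
    Matrix.mul_assoc]

/-- A quadratic form that is only known up to second order, at a point that is only known up to
first order. -/
theorem exists_quadraticForm_perturbation {E : Type*} [NormedAddCommGroup E]
    [InnerProductSpace ℝ E] (A B : E →L[ℝ] E) {c : ℝ} (hc : 0 < c) :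
    ∃ ε > 0, ∀ (d y : E) (q : ℝ), ‖d + B y‖ ≤ ε * ‖y‖ → |q - inner ℝ d (A d)| ≤ ε * ‖d‖ ^ 2 →
      |q - inner ℝ (B y) (A (B y))| ≤ c * ‖y‖ ^ 2 := by
  -- For `ε ≤ 1` one has `‖d‖ ≤ (‖B‖ + 1) ‖y‖`; the square is the cost of the error in `q`, the
  -- other term that of replacing `d` by `-B y`.
  set K : ℝ := (‖B‖ + 1) ^ 2 + ‖A‖ * (2 * ‖B‖ + 1) with hK
  have hK0 : 0 < K := by positivity
  refine ⟨min 1 (c / K), by positivity, fun d y q h1 h2 => ?_⟩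
  set ε := min 1 (c / K) with hε
  have hε0 : 0 < ε := by positivity
  have hε1 : ε ≤ 1 := min_le_left _ _
  have hεK : ε * K ≤ c := (le_div_iff₀ hK0).1 (min_le_right _ _)
  have hBy : ‖B y‖ ≤ ‖B‖ * ‖y‖ := B.le_opNorm y
  have hd : ‖d‖ ≤ (‖B‖ + 1) * ‖y‖ := by
    have h3 := norm_sub_le (d + B y) (B y)
    rw [add_sub_cancel_right] at h3
    nlinarith [norm_nonneg y]
  have h4 : inner ℝ d (A d) - inner ℝ (B y) (A (B y)) =
      inner ℝ (d + B y) (A d) - inner ℝ (B y) (A (d + B y)) := by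
    rw [map_add, inner_add_left, inner_add_right]
    ring
  have h5 : |inner ℝ (d + B y) (A d)| ≤ ε * ‖y‖ * (‖A‖ * ((‖B‖ + 1) * ‖y‖)) := by
    refine (abs_real_inner_le_norm _ _).trans ?_
    have := A.le_opNorm d
    gcongr
    exact this.trans (by gcongr)
  have h6 : |inner ℝ (B y) (A (d + B y))| ≤ ‖B‖ * ‖y‖ * (‖A‖ * (ε * ‖y‖)) := by
    refine (abs_real_inner_le_norm _ _).trans ?_
    have := A.le_opNorm (d + B y)
    gcongr
    exact this.trans (by gcongr)
  have h7 : ε * ‖d‖ ^ 2 ≤ ε * ((‖B‖ + 1) * ‖y‖) ^ 2 := by gcongr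
  calc |q - inner ℝ (B y) (A (B y))|
      = |(q - inner ℝ d (A d)) +
          (inner ℝ (d + B y) (A d) - inner ℝ (B y) (A (d + B y)))| := by
        congr 1
        linarith
    _ ≤ ε * ((‖B‖ + 1) * ‖y‖) ^ 2 +
          (ε * ‖y‖ * (‖A‖ * ((‖B‖ + 1) * ‖y‖)) + ‖B‖ * ‖y‖ * (‖A‖ * (ε * ‖y‖))) :=
        (abs_add_le _ _).trans (add_le_add (h2.trans h7)
          ((abs_sub _ _).trans (add_le_add h5 h6)))
    _ = ε * K * ‖y‖ ^ 2 := by rw [hK]; ring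
    _ ≤ c * ‖y‖ ^ 2 := by gcongr

end LinearAlgebra

/-! ### The unrestricted problem as the case of no restrictions -/

section NoRestriction

variable {p : ℕ} {Ω ω : Set (Param p)}

theorem isRestriction_zero :
    IsRestriction Ω (fun _ : Param p => (0 : EuclideanSpace ℝ (Fin 0))) :=
  ⟨contDiffOn_const, fun θ _ _ => Nat.le_zero.1 (by
    simpa using Matrix.rank_le_width (matM (fun _ : Param p => (0 : EuclideanSpace ℝ (Fin 0))) θ))⟩

theorem boundedSecondPartials_zero :
    BoundedSecondPartials ω (fun _ : Param p => (0 : EuclideanSpace ℝ (Fin 0))) :=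
  ⟨0, fun _ _ _ _ l => l.elim0⟩

/-- The multiplier ranges over a zero-dimensional space. Results on restricted roots thereby cover
both estimators. -/
theorem isRestrictedRoot_zero_iff {X : Type*} [MeasurableSpace X] {μ : Measure X} {B : ℝ → ℝ}
    {f : Param p → X → ℝ} {n : ℕ} {x : Fin n → X} {θ : Param p} :
    IsRestrictedRoot μ B f (fun _ : Param p => (0 : EuclideanSpace ℝ (Fin 0))) x θ ↔
      IsRoot μ B f x θ := by
  simp [IsRestrictedRoot, IsRoot, Matrix.mulVec_empty]

end NoRestriction

/-! ### Root sequences of the Bregman estimating equations -/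

section RootSequences

variable {p r : ℕ} {X : Type*} [MeasurableSpace X] {μ : Measure X} {Ω ω : Set (Param p)}
  {f : Param p → X → ℝ} {B : ℝ → ℝ} {m : Param p → EuclideanSpace ℝ (Fin r)} {θ₀ : Param p}
  {S : Type*} [MeasurableSpace S] {P : Measure S} {G : Measure X}
  {obs : ℕ → S → X} {ψ : Param p → X → Param p} {R : ℝ} {D : X → Param p →L[ℝ] Param p}
  {L : X → ℝ}

/-- The estimating function is almost surely a sample mean. -/
theorem eventually_ae_estimatingFun (hobs : ∀ i, Measurable (obs i)) (hlaw : ∀ i, P.map (obs i) = G)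
    (hψ : ∀ᵐ x ∂G, ∀ θ ∈ Metric.closedBall θ₀ R, ∀ j,
      ψ θ x j = (∫ y, weightedScore B f θ y j * f θ y ∂μ) - weightedScore B f θ x j) :
    ∀ᶠ n : ℕ in atTop, ∀ᵐ s ∂P, ∀ θ ∈ Metric.closedBall θ₀ R,
      (sampleMean (fun i : Fin n => obs i s) (ψ θ)).ofLp =
        estimatingFun μ B f (fun i : Fin n => obs i s) θ := by
  have hall : ∀ᵐ s ∂P, ∀ i, ∀ θ ∈ Metric.closedBall θ₀ R, ∀ j, ψ θ (obs i s) j =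
      (∫ y, weightedScore B f θ y j * f θ y ∂μ) - weightedScore B f θ (obs i s) j := by
    rw [ae_all_iff]
    intro i
    rw [← hlaw i] at hψ
    exact ae_of_ae_map (hobs i).aemeasurable hψ
  -- For the empty sample the mean is `0`, while the estimating function keeps its integral term.
  filter_upwards [eventually_ne_atTop 0] with n hn
  filter_upwards [hall] with s hs θ hθ
  have hn' : (n : ℝ) ≠ 0 := Nat.cast_ne_zero.2 hn
  ext j
  simp only [sampleMean, estimatingFun, PiLp.smul_apply, WithLp.ofLp_sum, Finset.sum_apply,
    hs _ θ hθ j, Finset.sum_sub_distrib, Finset.sum_const, Finset.card_univ, Fintype.card_fin,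
    nsmul_eq_mul, smul_eq_mul, mul_sub]
  rw [inv_mul_cancel_left₀ hn']

/-- Left to right turns constructed roots into roots of the model equations; right to left makes
arbitrary consistent sequences accessible to the expansion. -/
theorem eventually_ae_isRestrictedRoot_iff (hobs : ∀ i, Measurable (obs i))
    (hlaw : ∀ i, P.map (obs i) = G)
    (hψ : ∀ᵐ x ∂G, ∀ θ ∈ Metric.closedBall θ₀ R, ∀ j,
      ψ θ x j = (∫ y, weightedScore B f θ y j * f θ y ∂μ) - weightedScore B f θ x j)
    (hΩ : IsOpen Ω) (hm : IsRestriction Ω m) (hR : 0 < R) (hRΩ : Metric.closedBall θ₀ R ⊆ Ω) :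
    ∀ᶠ n : ℕ in atTop, ∀ᵐ s ∂P, ∀ θ ∈ Metric.closedBall θ₀ R,
      ((∃ η, sampleMean (fun i : Fin n => obs i s) (ψ θ) +
          (fderiv ℝ m (ballRetract θ₀ R θ)).adjoint η = 0 ∧ m (ballRetract θ₀ R θ) = 0) ↔
        IsRestrictedRoot μ B f m (fun i : Fin n => obs i s) θ) := by
  filter_upwards [eventually_ae_estimatingFun hobs hlaw hψ] with n hn
  filter_upwards [hn] with s hs θ hθ
  rw [ballRetract_eq _ hR hθ]
  have key : ∀ η : EuclideanSpace ℝ (Fin r), sampleMean (fun i : Fin n => obs i s) (ψ θ) +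
      (fderiv ℝ m θ).adjoint η = 0 ↔
      estimatingFun μ B f (fun i : Fin n => obs i s) θ + (matM m θ).mulVec η.ofLp = 0 := by
    intro η
    rw [← hs θ hθ, ← adjoint_fderiv_apply hΩ hm (hRΩ hθ)]
    exact (WithLp.ofLp_eq_zero 2).symm
  constructor
  · rintro ⟨η, h1, h2⟩
    exact ⟨h2, η.ofLp, (key η).1 h1⟩
  · rintro ⟨h2, η, h1⟩
    exact ⟨WithLp.toLp 2 η, (key _).2 h1, h2⟩

theorem exists_isConsistentRootSeq [IsProbabilityMeasure P]
    (hobs : ∀ i, Measurable (obs i)) (hindep : iIndepFun obs P)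
    (hlaw : ∀ i, P.map (obs i) = G) (hscore : RegularScore G ψ θ₀ R D L)
    (hψ : ∀ᵐ x ∂G, ∀ θ ∈ Metric.closedBall θ₀ R, ∀ j,
      ψ θ x j = (∫ y, weightedScore B f θ y j * f θ y ∂μ) - weightedScore B f θ x j)
    (hΩ : IsOpen Ω) (hωΩ : ω ⊆ Ω) (hRω : Metric.closedBall θ₀ R ⊆ ω) (hm : IsRestriction Ω m)
    (hnull : m θ₀ = 0) (hm₂ : BoundedSecondPartials ω m)
    {W : (Param p × EuclideanSpace ℝ (Fin r)) ≃L[ℝ] (Param p × EuclideanSpace ℝ (Fin r))}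
    (hW : IsSaddle W (∫ x, D x ∂G) (fderiv ℝ m (ballRetract θ₀ R θ₀)).adjoint) :
    ∃ est,
    IsConsistentRootSeq P obs Ω θ₀ (fun _ x θ => IsRestrictedRoot μ B f m x θ) est := by
  have hR := hscore.pos
  have hRΩ := hRω.trans hωΩ
  obtain ⟨est, h1, h2, h3, h4⟩ := exists_consistent_root hobs hindep hlaw hscore
    (regularRestriction_of_boundedSecondPartials hΩ hm hnull hωΩ hm₂ hR hRω)
    (continuous_adjoint_fderiv_ballRetract hΩ hm hR hRΩ)
    (continuous_comp_ballRetract hm hR hRΩ) hW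
  refine ⟨est, h1, fun n x => hRΩ (h2 n x), ?_, h4⟩
  refine h3.mono_ae ?_
  filter_upwards [eventually_ae_isRestrictedRoot_iff hobs hlaw hψ hΩ hm hR hRΩ] with n hn
  filter_upwards [hn] with s hs h
  exact (hs _ (h2 _ _)).1 h

theorem IsConsistentRootSeq.likely_expansion [IsProbabilityMeasure P]
    (hobs : ∀ i, Measurable (obs i)) (hindep : iIndepFun obs P)
    (hlaw : ∀ i, P.map (obs i) = G) (hscore : RegularScore G ψ θ₀ R D L)
    (hψ : ∀ᵐ x ∂G, ∀ θ ∈ Metric.closedBall θ₀ R, ∀ j,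
      ψ θ x j = (∫ y, weightedScore B f θ y j * f θ y ∂μ) - weightedScore B f θ x j)
    (hΩ : IsOpen Ω) (hωΩ : ω ⊆ Ω) (hRω : Metric.closedBall θ₀ R ⊆ ω) (hm : IsRestriction Ω m)
    (hnull : m θ₀ = 0) (hm₂ : BoundedSecondPartials ω m)
    {W : (Param p × EuclideanSpace ℝ (Fin r)) ≃L[ℝ] (Param p × EuclideanSpace ℝ (Fin r))}
    (hW : IsSaddle W (∫ x, D x ∂G) (fderiv ℝ m (ballRetract θ₀ R θ₀)).adjoint)
    {est : (n : ℕ) → (Fin n → X) → Param p}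
    (hest : IsConsistentRootSeq P obs Ω θ₀ (fun _ x θ => IsRestrictedRoot μ B f m x θ) est)
    {ε : ℝ} (hε : 0 < ε) :
    Likely P fun n s => ‖(est n fun i => obs i s) - θ₀ +
        (W.symm (sampleMean (fun i : Fin n => obs i s) (ψ θ₀), 0)).1‖ ≤
      ε * ‖sampleMean (fun i : Fin n => obs i s) (ψ θ₀)‖ := by
  have hR := hscore.pos
  have hRΩ := hRω.trans hωΩ
  refine likely_root_expansion (est := fun n s => est n fun i => obs i s) hobs hindep hlaw hscore
    (regularRestriction_of_boundedSecondPartials hΩ hm hnull hωΩ hm₂ hR hRω) hW ?_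
    hest.consistent hε
  have hroot : Likely P fun n s =>
    IsRestrictedRoot μ B f m (fun i : Fin n => obs i s) (est n fun i => obs i s) := hest.root
  -- Consistency puts the estimator into the ball, where the retracted system and the original one
  -- agree.
  refine (hroot.and (tendstoInMeasure_iff_likely.1 hest.consistent R hR)).mono_ae ?_
  filter_upwards [eventually_ae_isRestrictedRoot_iff hobs hlaw hψ hΩ hm hR hRΩ] with n hn
  filter_upwards [hn] with s hs h
  exact (hs _ (Metric.ball_subset_closedBall h.2)).2 h.1

end RootSequences

/-! ### Limit law of the test statistic -/

/-- Only the law of the limit matters, so the Gaussian quadratic form may be exchanged for the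
weighted squares on another probability space. -/
theorem tendstoInDistribution_of_map_eq {S S' S'' E : Type*} [MeasurableSpace S]
    [MeasurableSpace S'] [MeasurableSpace S''] [TopologicalSpace E] [MeasurableSpace E]
    [OpensMeasurableSpace E] {P : Measure S} [IsProbabilityMeasure P] {P' : Measure S'}
    [IsProbabilityMeasure P'] {P'' : Measure S''} [IsProbabilityMeasure P''] {Y : ℕ → S → E}
    {Z : S' → E} {Z' : S'' → E} (h : TendstoInDistribution Y atTop Z (fun _ => P) P')
    (hZ' : AEMeasurable Z' P'') (hmap : P'.map Z = P''.map Z') :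
    TendstoInDistribution Y atTop Z' (fun _ => P) P'' := by
  refine ⟨h.forall_aemeasurable, hZ', ?_⟩
  have h1 := h.tendsto
  simp only [hmap] at h1
  exact h1

theorem measurable_sum_mul_sq {k : ℕ} (lam : Fin k → ℝ) :
    Measurable fun z : Fin k → ℝ => ∑ i, lam i * z i ^ 2 := by
  fun_prop

theorem theorem4 {p r : ℕ} (hr : r < p)
    {X : Type*} [MeasurableSpace X] (μ : Measure X) [SigmaFinite μ]
    (Ω : Set (Param p)) (f : Param p → X → ℝ) (hf : IsDensityFamily μ Ω f)
    (B₁ B₂ : ℝ → ℝ) (hB₁ : IsBregmanGenerator B₁) (hB₂ : IsBregmanGenerator B₂)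
    (m : Param p → EuclideanSpace ℝ (Fin r)) (hm : IsRestriction Ω m)
    (θ₀ : Param p) (hnull : m θ₀ = 0)
    (ω : Set (Param p)) (hω : IsOpen ω) (hωΩ : ω ⊆ Ω) (hθ₀ : θ₀ ∈ ω)
    (hreg : EstimationRegularity μ B₁ f ω θ₀)
    (hm₂ : BoundedSecondPartials ω m)
    (hdiv : DivergenceRegularity μ B₂ f ω θ₀)
    {S : Type*} [MeasurableSpace S] (P : Measure S) [IsProbabilityMeasure P]
    (obs : ℕ → S → X) (hobs : ∀ i, Measurable (obs i)) (hindep : iIndepFun obs P)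
    (hlaw : ∀ i, P.map (obs i) = modelLaw μ f θ₀) :
    let G : Measure X := modelLaw μ f θ₀
    let A : Matrix (Fin p) (Fin p) ℝ := matA μ B₂ f θ₀
    let B : Matrix (Fin p) (Fin p) ℝ := matB μ B₁ f G m θ₀
    let K : Matrix (Fin p) (Fin p) ℝ := matK B₁ f G θ₀
    let k : ℕ := (B * K * B * A * B * K * B).rank
    ∃ lam : Fin k → ℝ, ListsNonzeroEigenvalues (A * B * K * B) lam ∧
      (∃ est, IsConsistentRootSeq P obs Ω θ₀ (fun _ x θ => IsRoot μ B₁ f x θ) est) ∧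
      (∃ est, IsConsistentRootSeq P obs Ω θ₀ (fun _ x θ => IsRestrictedRoot μ B₁ f m x θ) est) ∧
      ∀ est est' : (n : ℕ) → (Fin n → X) → Param p,
        IsConsistentRootSeq P obs Ω θ₀ (fun _ x θ => IsRoot μ B₁ f x θ) est →
        IsConsistentRootSeq P obs Ω θ₀ (fun _ x θ => IsRestrictedRoot μ B₁ f m x θ) est' →
        TendstoInDistribution
          (fun n s => testStat μ B₂ f est est' n (fun i => obs i s)) atTop
          (fun z : Fin k → ℝ => ∑ i, lam i * z i ^ 2)
          (fun _ => P) (Measure.pi fun _ : Fin k => gaussianReal 0 1) := by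
  have hθΩ : θ₀ ∈ Ω := hωΩ hθ₀
  have hG : IsProbabilityMeasure (modelLaw μ f θ₀) := hf.isProbabilityMeasure θ₀ hθΩ
  obtain ⟨R, hR, hRω⟩ := Metric.nhds_basis_closedBall.mem_iff.1 (hω.mem_nhds hθ₀)
  obtain ⟨ψ, D, L, hscore, hJ, hψ, hψ2, hK⟩ := exists_regularScore hf hB₁ hω hωΩ hθ₀ hreg hR hRω
  have hret : ballRetract θ₀ R θ₀ = θ₀ := ballRetract_eq _ hR (Metric.mem_closedBall_self hR.le)
  have hJpos : ∀ v : Param p, v ≠ 0 → 0 < inner ℝ ((∫ x, D x ∂(modelLaw μ f θ₀)) v) v := by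
    intro v hv
    have h1 := hreg.posDef.dotProduct_mulVec_pos (x := v.ofLp)
      (fun h => hv ((WithLp.ofLp_eq_zero 2).1 h))
    rw [EuclideanSpace.inner_eq_star_dotProduct, hJ]
    simpa using h1
  have hmreg := regularRestriction_of_boundedSecondPartials hf.isOpen hm hnull hωΩ hm₂ hR hRω
  have hmreg₀ := regularRestriction_of_boundedSecondPartials hf.isOpen
    (isRestriction_zero (Ω := Ω)) (θ₀ := θ₀) rfl hωΩ boundedSecondPartials_zero hR hRω
  -- Two saddle maps with the same `J`: `W` with the restrictions, `W₀` without any.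
  obtain ⟨W, hW⟩ := exists_isSaddle hJpos hmreg.injective
  obtain ⟨W₀, hW₀⟩ := exists_isSaddle hJpos hmreg₀.injective
  have hroot_iff : (fun (n : ℕ) (x : Fin n → X) θ => IsRestrictedRoot μ B₁ f
      (fun _ : Param p => (0 : EuclideanSpace ℝ (Fin 0))) x θ) =
      fun n x θ => IsRoot μ B₁ f x θ := by
    funext n x θ
    exact propext isRestrictedRoot_zero_iff
  intro G A B K k
  have hJt : (matJ μ B₁ f G θ₀).transpose = matJ μ B₁ f G θ₀ := by
    rw [← Matrix.conjTranspose_eq_transpose_of_trivial]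
    exact hreg.posDef.isHermitian
  have hBt : B.transpose = B := transpose_constrained_inverse hJt
  have hKpsd : K.PosSemidef := posSemidef_of_secondMoment (g := fun x i => ψ θ₀ x i) hψ2 hK
  obtain ⟨lam, hlam, hlamlaw⟩ := exists_eigenvalues_quadraticForm (A := A) transpose_matA hBt hKpsd
  refine ⟨lam, hlam, ?_, ?_, ?_⟩
  · have h := exists_isConsistentRootSeq hobs hindep hlaw hscore hψ hf.isOpen hωΩ hRω
      isRestriction_zero rfl boundedSecondPartials_zero hW₀
    rwa [hroot_iff] at h
  · exact exists_isConsistentRootSeq hobs hindep hlaw hscore hψ hf.isOpen hωΩ hRω hm hnull hm₂ hW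
  intro est est' hest hest'
  rw [← hroot_iff] at hest
  set y : ℕ → S → Param p := fun n s => sampleMean (fun i : Fin n => obs i s) (ψ θ₀) with hy
  have hclt : TendstoInDistribution (fun (n : ℕ) s => √(n : ℝ) • y n s) atTop
      (id : Param p → Param p) (fun _ => P) (multivariateGaussian 0 K) := by
    refine tendstoInDistribution_sqrt_smul_sampleMean hobs hindep hlaw (hscore.measurable θ₀)
      hψ2 (fun i => ?_) hK
    have h1 := (EuclideanSpace.proj i : Param p →L[ℝ] ℝ).integral_comp_comm hscore.integrable
    rw [hscore.mean, map_zero] at h1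
    exact h1
  set Q : Param p → ℝ := fun v => B.mulVec v.ofLp ⬝ᵥ A.mulVec (B.mulVec v.ofLp) with hQ
  have hQc : Continuous Q := by
    simp only [hQ, dotProduct, Matrix.mulVec]
    fun_prop
  have hQlim := hclt.continuous_comp hQc
  have hinner : ∀ v : Param p, inner ℝ v (Matrix.toEuclideanCLM (𝕜 := ℝ) A v) =
      v.ofLp ⬝ᵥ A.mulVec v.ofLp :=
    fun v => Matrix.inner_toEuclideanCLM A v v
  have hQB : ∀ v : Param p, Q v = inner ℝ (Matrix.toEuclideanCLM (𝕜 := ℝ) B v)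
      (Matrix.toEuclideanCLM (𝕜 := ℝ) A (Matrix.toEuclideanCLM (𝕜 := ℝ) B v)) := fun v => by
    rw [hinner, Matrix.ofLp_toEuclideanCLM]
  -- `B` is what remains when the two saddle systems are solved for the same right-hand side and
  -- subtracted.
  have hdiff : ∀ v : Param p, Matrix.toEuclideanCLM (𝕜 := ℝ) B v =
      (W₀.symm (v, 0)).1 - (W.symm (v, 0)).1 := by
    intro v
    have hT : ∀ η, ((fderiv ℝ m (ballRetract θ₀ R θ₀)).adjoint η).ofLp =
        (matM m θ₀).mulVec η.ofLp := by
      rw [hret]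
      exact adjoint_fderiv_apply hf.isOpen hm hθΩ
    have h1 := hW (W.symm (v, 0)).1 (W.symm (v, 0)).2
    have h2 := hW₀ (W₀.symm (v, 0)).1 (W₀.symm (v, 0)).2
    rw [Prod.mk.eta, ContinuousLinearEquiv.apply_symm_apply, Prod.mk.injEq] at h1 h2
    have h3 : (W₀.symm (v, 0)).2 = 0 := Subsingleton.elim _ _
    rw [h3, map_zero, add_zero] at h2
    have hinj : Function.Injective (matM m θ₀).mulVec := by
      intro a b hab
      have h4 := hmreg.injective (a₁ := WithLp.toLp 2 a) (a₂ := WithLp.toLp 2 b) (by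
        apply WithLp.ofLp_injective 2
        simp only
        rw [hT, hT]
        exact hab)
      simpa using h4
    have key := mulVec_eq_sub_of_saddle (J := matJ μ B₁ f G θ₀) (M := matM m θ₀)
      (a₀ := (W₀.symm (v, 0)).1.ofLp) (a := (W.symm (v, 0)).1.ofLp) (y := v.ofLp)
      (b := (W.symm (v, 0)).2.ofLp)
      ((Matrix.isUnit_iff_isUnit_det _).1 hreg.posDef.isUnit)
      (isUnit_det_transpose_mul_inv_mul hreg.posDef hinj)
      (by rw [← hJ, ← h2.1]) (by rw [← hJ, ← hT]; exact congrArg WithLp.ofLp h1.1.symm)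
      (by rw [← adjoint_apply_ofLp hT, ← h1.2]; rfl)
    apply WithLp.ofLp_injective 2
    rw [Matrix.ofLp_toEuclideanCLM]
    exact key
  have hmeas : ∀ n, AEMeasurable (fun s => testStat μ B₂ f est est' n fun i => obs i s) P :=
    fun n => ((measurable_testStat hf hB₂ (hest.measurable n) (hest'.measurable n) (hest.mem n)
      (hest'.mem n)).comp (measurable_pi_lambda _ fun i : Fin n => hobs i)).aemeasurable
  have hrem : TendstoInMeasure P
      ((fun n s => testStat μ B₂ f est est' n fun i => obs i s) -
        fun (n : ℕ) => Q ∘ fun s => √(n : ℝ) • y n s) atTop 0 := by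
    refine tendstoInMeasure_zero_of_likely_le hclt fun c hc => ?_
    obtain ⟨ε, hε, hpert⟩ := exists_quadraticForm_perturbation
      (Matrix.toEuclideanCLM (𝕜 := ℝ) A) (Matrix.toEuclideanCLM (𝕜 := ℝ) B) hc
    obtain ⟨δ, hδ, hexp⟩ := bregmanDiv_expansion hf hB₂ hω hωΩ hθ₀ hreg.smooth hdiv hε
    -- Each expansion is taken with `ε / 2`, so the difference of the estimators has error `ε ‖y‖`.
    have e1 := hest.likely_expansion hobs hindep hlaw hscore hψ hf.isOpen hωΩ hRω
      isRestriction_zero rfl boundedSecondPartials_zero hW₀ (half_pos hε)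
    have e2 := hest'.likely_expansion hobs hindep hlaw hscore hψ hf.isOpen hωΩ hRω hm hnull hm₂ hW
      (half_pos hε)
    refine ((e1.and e2).and ((tendstoInMeasure_iff_likely.1 hest.consistent δ hδ).and
      (tendstoInMeasure_iff_likely.1 hest'.consistent δ hδ))).mono fun n s hs => ?_
    obtain ⟨⟨h1, h2⟩, h3, h4⟩ := hs
    set a := est n fun i => obs i s with ha
    set b := est' n fun i => obs i s with hb
    have h5 := hexp a h3 b h4
    rw [← hinner] at h5
    -- The difference is close to `-B y`; the sign disappears in the quadratic form.
    have h6 : ‖(a - b) + Matrix.toEuclideanCLM (𝕜 := ℝ) B (y n s)‖ ≤ ε * ‖y n s‖ := by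
      have h7 : (a - b) + Matrix.toEuclideanCLM (𝕜 := ℝ) B (y n s) =
          (a - θ₀ + (W₀.symm (y n s, 0)).1) - (b - θ₀ + (W.symm (y n s, 0)).1) := by
        rw [hdiff]
        abel
      rw [h7]
      calc _ ≤ _ := (norm_sub_le _ _).trans (add_le_add h1 h2)
        _ = ε * ‖y n s‖ := by ring
    have h8 := hpert _ _ _ h6 h5
    rw [← hQB] at h8
    have hQs : Q (√(n : ℝ) • y n s) = n * Q (y n s) := by
      simp only [hQB, map_smul, inner_smul_left, inner_smul_right, ← mul_assoc]
      simp
    have h9 : testStat μ B₂ f est est' n (fun i => obs i s) - Q (√(n : ℝ) • y n s) =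
        n * (2 * bregmanDiv μ B₂ (f a) (f b) - Q (y n s)) := by
      rw [hQs, testStat]
      ring
    calc _ = |testStat μ B₂ f est est' n (fun i => obs i s) - Q (√(n : ℝ) • y n s)| := rfl
      _ = n * |2 * bregmanDiv μ B₂ (f a) (f b) - Q (y n s)| := by
        rw [h9, abs_mul, Nat.abs_cast]
      _ ≤ n * (c * ‖y n s‖ ^ 2) := by gcongr
      _ = c * ‖√(n : ℝ) • y n s‖ ^ 2 := by
        rw [norm_smul, mul_pow, Real.norm_eq_abs, sq_abs, Real.sq_sqrt (Nat.cast_nonneg n)]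
        ring
  -- Slutsky: the statistic and the quadratic form differ by a term that tends to zero in
  -- probability.
  refine tendstoInDistribution_of_map_eq
    (tendstoInDistribution_of_tendstoInMeasure_sub _ _ hQlim hrem hmeas) ?_ hlamlaw
  exact (measurable_sum_mul_sq lam).aemeasurable
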